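/- Let $p,q,n$ be positive integers with $p+q$ odd and let $a,b\in\{1,-1\}$, where $p\neq1$ if $a^nb=1$, and $q\neq1$ if $a=1$. For $c=\pm1$, $\alpha>0$ and an integer $m\ge1$ with $(c,m)\neq(1,1)$ let $\Phi(c,m,\alpha)=\sum_{i=0}^{\infty}\frac{c^{i}}{(i+\alpha)^{m}}$ be the Lerch transcendent, and let $\Phi(c,0,\alpha)$ be the value at $s=0$ of the analytic continuation of $\sum_{i\ge0}c^i(i+\alpha)^{-s}$, so that $\Phi(1,0,1)=\zeta(0)=-\tfrac12$ and $\Phi(-1,0,1)=\tfrac12$. For $0<s<r$ and an integer $m\geq 1$ let \[\Theta(c,m,s,r)=\Phi\left(c,m,\tfrac sr\right)+c(-1)^m\,\Phi\left(c,m,\tfrac{r-s}{r}\right)\quad\text{if }(c,m)\ne(1,1),\qquad \Theta(1,1,s,r)=\pi\cot\left(\tfrac{\pi s}{r}\right).\] For real $x<1$, and for $x=1$ if $p\ge2$, let \[\operatorname{Li}_p(x)=\frac{(-1)^{p-1}}{(p-1)!}\int_0^1\frac{x\ln^{p-1}(y)}{1-xy}\,\mathrm dy,\] and for $x>1$ define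 $\operatorname{Li}_p(x)$ by the same formula with the Cauchy principal value of the integral at $y=1/x$, which exists. Then the following two integrals converge absolutely, and: (i) \[\begin{aligned}\int_0^1\frac{\ln^{q-1}(x)\operatorname{Li}_{p}(bx^{n})}{1-ax}\,\mathrm dx={}&\tfrac12 ab(-1)^{q}(q-1)!\,n^{-q}\,\Phi(b,p+q,1)-\tfrac12a^{n}b\,(1+(-1)^{q})(q-1)!\,\Phi(a,q,1)\,\Phi(a^nb,p,1)\\ &+a^{n-1}n^{-q}(q-1)!\sum_{j=0}^{\lfloor q/2\rfloor}\binom{p+q-2j-1}{p-1}\Phi(b,2j,1)\,\Phi(a^nb,p+q-2j,1)\\ &+b\,n^{p}(q-1)!\sum_{k=0}^{\lfloor p/2\rfloor}\binom{p+q-2k-1}{q-1}n^{-2k}\,\Phi(b,2k,1)\,\Phi(a,p+q-2k,1)\\ &+\tfrac12a^{n}b\,n^{-q}(q-1)!\sum_{j=2}^{n}\sum_{k=1}^{q}\binom{p+q-k-1}{p-1}a^{j}(-1)^{k}\,\Theta(b,k,j-1,n)\,\Phi\left(a^nb,p+q-k,\tfrac{n-j+1}{n}\right);\end{aligned}\]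 (ii) \[\begin{aligned}\int_0^1\frac{\ln^{q-1}(x)\operatorname{Li}_{p}(bx^{-n})}{1-ax}\,\mathrm dx={}&\tfrac12 ab\,(q-1)!\,n^{-q}\,\Phi(b,p+q,1)-\tfrac12a^{n}b\,(1+(-1)^{q})(q-1)!\,\Phi(a^nb,p,1)\,\Phi(a,q,1)\\ &+a^{n-1}(-n)^{-q}(q-1)!\sum_{j=0}^{\lfloor q/2\rfloor}\binom{p+q-2j-1}{p-1}\Phi(b,2j,1)\,\Phi(a^nb,p+q-2j,1)\\ &+b\,(-n)^{p}(q-1)!\sum_{k=0}^{\lfloor p/2\rfloor}\binom{p+q-2k-1}{q-1}n^{-2k}\,\Phi(b,2k,1)\,\Phi(a,p+q-2k,1)\\ &+\tfrac12a^{n}b\,(-n)^{-q}(q-1)!\sum_{j=2}^{n}\sum_{k=1}^{q}\binom{p+q-k-1}{p-1}a^{j}(-1)^{k}\,\Theta(b,k,j-1,n)\,\Phi\left(a^nb,p+q-k,\tfrac{n-j+1}{n}\right).\end{aligned}\] -/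

import Mathlib

namespace LerchPolylog

open Filter Topology MeasureTheory

/-- The Lerch transcendent `Φ(c, q, α) = ∑_{m ≥ 0} c ^ m / (m + α) ^ q` for `c = ±1`, `α > 0` and an
integer order `q`. For `q ≥ 1` it is the sum of the series, as the limit of the partial sums (the
series converges only conditionally for `c = -1`, `q = 1`; it diverges for `c = 1`, `q = 1`).
At `q = 0` it is the value at `s = 0` of the analytic continuation in `s` of `∑ c ^ m / (m + α) ^ s`:
for `c = 1` this is the Hurwitz zeta value `ζ(0, α) = 1 / 2 - α`, and for `c = -1` it is
`2 ζ(0, α / 2) - ζ(0, α) = 1 / 2`. -/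
noncomputable def lerch (c : ℝ) (q : ℕ) (α : ℝ) : ℝ :=
  if q = 0 then (if c = 1 then 1 / 2 - α else 1 / 2)
  else limUnder atTop (fun N : ℕ => ∑ m ∈ Finset.range N, c ^ m / ((m : ℝ) + α) ^ q)

/-- `Φ(1, 0, 1) = ζ(0)`. -/
theorem lerch_one_zero_one : ((lerch 1 0 1 : ℝ) : ℂ) = riemannZeta 0 := by
  rw [riemannZeta_zero]
  norm_num [lerch]

/-- `Φ(-1, 0, 1) = η(0)`, where `η(s) = (1 - 2 ^ (1 - s)) ζ(s)` is the Dirichlet eta function. -/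
theorem lerch_neg_one_zero_one :
    ((lerch (-1) 0 1 : ℝ) : ℂ) = (1 - (2 : ℂ) ^ ((1 : ℂ) - 0)) * riemannZeta 0 := by
  rw [riemannZeta_zero]
  norm_num [lerch]

/-- `Θ(c, q, s, r) = Φ(c, q, s / r) + c (-1) ^ q Φ(c, q, (r - s) / r)`. For `c = 1`, `q = 1`, where the
two series diverge separately, `Θ` is the principal value of the integral of
`r x ^ (s - 1) / (1 - x ^ r)` over `(0, ∞)`, which is `π cot (π s / r)`. -/
noncomputable def theta (c : ℝ) (q : ℕ) (s r : ℝ) : ℝ :=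
  if c = 1 ∧ q = 1 then Real.pi * Real.cot (Real.pi * s / r)
  else lerch c q (s / r) + c * (-1) ^ q * lerch c q ((r - s) / r)

/-- `I` is the Cauchy principal value of the integral of `f` over `(u, v)` with respect to the
interior singularity `w`. -/
def HasCauchyPV (f : ℝ → ℝ) (u w v I : ℝ) : Prop :=
  (∀ᶠ ε in 𝓝[>] (0 : ℝ),
    IntervalIntegrable f volume u (w - ε) ∧ IntervalIntegrable f volume (w + ε) v) ∧
  Tendsto (fun ε : ℝ => (∫ y in u..(w - ε), f y) + ∫ y in (w + ε)..v, f y) (𝓝[>] 0) (𝓝 I)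

/-- The Cauchy principal value of the integral of `f` over `(u, v)` with singularity at `w`
(meaningful when it exists). -/
noncomputable def cauchyPV (f : ℝ → ℝ) (u w v : ℝ) : ℝ :=
  limUnder (𝓝[>] (0 : ℝ))
    (fun ε : ℝ => (∫ y in u..(w - ε), f y) + ∫ y in (w + ε)..v, f y)

theorem HasCauchyPV.cauchyPV_eq {f : ℝ → ℝ} {u w v I : ℝ} (h : HasCauchyPV f u w v I) :
    cauchyPV f u w v = I :=
  h.2.limUnder_eq

/-- The integrand `x ln ^ (p - 1) y / (1 - x y)` of the integral representation of `Li_p(x)`. -/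
noncomputable def polylogKernel (p : ℕ) (x y : ℝ) : ℝ :=
  x * Real.log y ^ (p - 1) / (1 - x * y)

/-- The polylogarithm `Li_p(x)` of order `p ≥ 1` at a real `x`:
`(-1) ^ (p - 1) / (p - 1)! * ∫_0^1 x ln ^ (p - 1) y / (1 - x y) dy`, where for `x > 1` the integral is
the Cauchy principal value at the singularity `y = 1 / x`. -/
noncomputable def polylog (p : ℕ) (x : ℝ) : ℝ :=
  (-1) ^ (p - 1) / (Nat.factorial (p - 1) : ℝ) *
    (if x ≤ 1 then ∫ y in (0 : ℝ)..1, polylogKernel p x y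
      else cauchyPV (polylogKernel p x) 0 (1 / x) 1)

end LerchPolylog

namespace LerchPolylog

open Filter Topology MeasureTheory Finset
open Set (Ioo Ioc)

/-! Part (i). Expanding `Li_p(b x^n)` in powers of `x` and using `∫ x^N log^(q-1) x / (1 - a x) =
(-1)^(q-1) (q-1)! Φ(a, q, N+1)` turns the integral into `(-1)^(q-1) (q-1)! a S`, where `S = ∑ b^k
a^l / (k^p (n k + l)^q)` over `k, l ≥ 1` is `quadrantSum`. Everything rests on a parity theorem for
`S`, `two_mul_quadrantSum`.

To prove it, let `k` run over all nonzero integers. For fixed `l`, partial fractions of `1 / (k^p (l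
+ n k)^q)` in `k` reduce the bilateral sum to the sums `∑ b^k / k^i` and `∑ b^k / (l + n k)^i`; the
latter are quasi-periodic in `l` modulo `n` and are `Θ` values (`bilatSum_eq_theta`). Summing over
`l` by residue classes gives `G = mixedLimit`, built from products of single Lerch values. Summing
over `l` first instead, the positive `k` give `S`. For `-k < 0` the terms `l > n k` give a product
`P = Φ(a^n b, p, 0) Φ(a, q, 0)` of single series with sign `(-1)^p`, and the terms `l < n k`,
reflected by `m = n k - l`, give a sum `R` with sign `(-1)^(p+q) = -1`. Completing the inner sum of
`R` shows `R = P - D - S`, with `D` the diagonal `m = n k`. Hence `G = S + (-1)^p P - R`, that is `2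
S = G + (1 - (-1)^p) P - D`.

The double series converge only conditionally, so `a^l` is damped to `(a ρ)^l`, the orders of
summation are exchanged for `ρ < 1`, and `ρ → 1`. The bound `abs_lerchSum_le`, uniform in `ρ`, comes
from the integral representation and supplies the domination.

Part (ii). The inversion formula `polylog_inversion` expresses `Li_p(b / t)` through `Li_p(b t)` and
powers of `log t`. With `t = x^n` this reduces (ii) to (i) plus integrals of `log^m x / (1 - a x)`.
-/

/-! ### Convergence of Lerch series and Abel limits. -/

/-- The series `∑ c ^ m / (m + α) ^ e` converges: `c = ±1`, `e ≥ 1`, `(c, e) ≠ (1, 1)`. -/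
def LerchConv (c : ℝ) (e : ℕ) : Prop := 1 ≤ e ∧ (c = 1 ∧ 2 ≤ e ∨ c = -1)

/-- The series `∑ z ^ m / (m + α) ^ e` as an unconditional sum. -/
noncomputable def lerchSum (z : ℝ) (e : ℕ) (α : ℝ) : ℝ := ∑' m : ℕ, z ^ m / ((m : ℝ) + α) ^ e

theorem LerchConv.sq {c : ℝ} {e : ℕ} (h : LerchConv c e) : c * c = 1 := by
  rcases h.2 with h | h <;> simp [h]

theorem summable_inv_add_pow {e : ℕ} (he : 2 ≤ e) {α : ℝ} (hα : 0 ≤ α) :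
    Summable fun m : ℕ => 1 / ((m : ℝ) + α) ^ e := by
  have h1 : Summable fun m : ℕ => 1 / (m : ℝ) ^ e :=
    Real.summable_one_div_nat_pow.mpr (by omega)
  -- The comparison with `1 / m ^ e` fails at `m = 0`, where the latter is `0` by convention.
  rw [← summable_nat_add_iff 1] at h1 ⊢
  refine Summable.of_nonneg_of_le (fun m => by positivity) (fun m => ?_) h1
  have : (0 : ℝ) < ((m + 1 : ℕ) : ℝ) := by positivity
  gcongr
  linarith

theorem exists_tendsto_lerch_of_pos {c : ℝ} {e : ℕ} (h : LerchConv c e) {α : ℝ} (hα : 0 < α) :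
    ∃ l, Tendsto (fun N : ℕ => ∑ m ∈ range N, c ^ m / ((m : ℝ) + α) ^ e) atTop (𝓝 l) := by
  rcases h with ⟨he, ⟨rfl, h2⟩ | rfl⟩
  · refine ⟨_, Summable.tendsto_sum_tsum_nat ?_⟩
    simpa using summable_inv_add_pow h2 hα.le
  · have hanti : Antitone fun m : ℕ => 1 / ((m : ℝ) + α) ^ e := by
      intro i j hij
      have : (i : ℝ) ≤ j := by exact_mod_cast hij
      have hi : (0 : ℝ) < i + α := by positivity
      dsimp only
      gcongr
    have hlim : Tendsto (fun m : ℕ => 1 / ((m : ℝ) + α) ^ e) atTop (𝓝 0) := by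
      have : Tendsto (fun m : ℕ => ((m : ℝ) + α) ^ e) atTop atTop :=
        (tendsto_pow_atTop (by omega)).comp
          (tendsto_atTop_add_const_right _ _ tendsto_natCast_atTop_atTop)
      exact this.inv_tendsto_atTop.congr fun m => (one_div _).symm
    obtain ⟨l, hl⟩ := hanti.tendsto_alternating_series_of_tendsto_zero hlim
    exact ⟨l, hl.congr fun N => sum_congr rfl fun m _ => mul_one_div _ _⟩

theorem lerch_sum_range_succ (c : ℝ) (e : ℕ) (α : ℝ) (M N : ℕ) :
    ∑ m ∈ range (M + N), c ^ m / ((m : ℝ) + α) ^ e =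
      ∑ m ∈ range M, c ^ m / ((m : ℝ) + α) ^ e +
        c ^ M * ∑ m ∈ range N, c ^ m / ((m : ℝ) + (α + M)) ^ e := by
  rw [sum_range_add, mul_sum]
  congr 1
  refine sum_congr rfl fun m _ => ?_
  rw [pow_add]
  push_cast
  ring

theorem lerch_tendsto {c : ℝ} {e : ℕ} (h : LerchConv c e) {α : ℝ} (hα : 0 ≤ α) :
    Tendsto (fun N : ℕ => ∑ m ∈ range N, c ^ m / ((m : ℝ) + α) ^ e) atTop
      (𝓝 (lerch c e α)) := by
  have hex : ∃ l, Tendsto (fun N : ℕ => ∑ m ∈ range N, c ^ m / ((m : ℝ) + α) ^ e) atTop (𝓝 l) := by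
    -- The start is moved to `α + 1`: for `α = 0` the first term is `1 / 0 ^ e = 0`, which breaks
    -- the monotonicity behind the alternating series test.
    obtain ⟨l, hl⟩ := exists_tendsto_lerch_of_pos h (show 0 < α + 1 by linarith)
    refine ⟨∑ m ∈ range 1, c ^ m / ((m : ℝ) + α) ^ e + c ^ 1 * l,
      (tendsto_add_atTop_iff_nat 1).1 ?_⟩
    have := (hl.const_mul (c ^ 1)).const_add (∑ m ∈ range 1, c ^ m / ((m : ℝ) + α) ^ e)
    refine this.congr fun N => ?_
    rw [add_comm N 1, lerch_sum_range_succ]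
    simp
  have he : e ≠ 0 := by have := h.1; omega
  rw [lerch, if_neg he]
  exact tendsto_nhds_limUnder hex

theorem lerch_eq_sum_add {c : ℝ} {e : ℕ} (h : LerchConv c e) {α : ℝ} (hα : 0 ≤ α) (N : ℕ) :
    lerch c e α = ∑ m ∈ range N, c ^ m / ((m : ℝ) + α) ^ e + c ^ N * lerch c e (α + N) := by
  have h1 := (tendsto_add_atTop_iff_nat N).2 (lerch_tendsto h hα)
  have h2 := ((lerch_tendsto h (show 0 ≤ α + N by positivity)).const_mul (c ^ N)).const_add
    (∑ m ∈ range N, c ^ m / ((m : ℝ) + α) ^ e)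
  refine tendsto_nhds_unique h1 (h2.congr fun M => ?_)
  rw [add_comm M N, lerch_sum_range_succ]

/-- At `α = 0` the term `m = 0` is `1 / 0 ^ e = 0`, so `lerch c e 0` is the sum of `c ^ m / m ^ e`
over `m ≥ 1`, the form in which single series arise below. -/
theorem lerch_zero {c : ℝ} {e : ℕ} (h : LerchConv c e) : lerch c e 0 = c * lerch c e 1 := by
  have he : e ≠ 0 := by have := h.1; omega
  rw [lerch_eq_sum_add h le_rfl 1]
  simp [he]

/-- Abel's limit theorem. All passages from damped to undamped single series go through it. -/
theorem lerchSum_tendsto {c : ℝ} {e : ℕ} (h : LerchConv c e) {α : ℝ} (hα : 0 ≤ α) :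
    Tendsto (fun σ : ℝ => lerchSum (c * σ) e α) (𝓝[<] 1) (𝓝 (lerch c e α)) := by
  refine (Real.tendsto_tsum_powerSeries_nhdsWithin_lt (lerch_tendsto h hα)).congr fun σ => ?_
  refine tsum_congr fun m => ?_
  rw [mul_pow]
  ring

theorem summable_lerchSum {z : ℝ} (hz : |z| < 1) (e : ℕ) {α : ℝ} (hα : 0 ≤ α) :
    Summable fun m : ℕ => z ^ m / ((m : ℝ) + α) ^ e := by
  rw [← summable_nat_add_iff 1]
  have h1 : Summable fun m : ℕ => |z| ^ (m + 1) :=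
    (summable_nat_add_iff 1).2 (summable_geometric_of_lt_one (abs_nonneg z) hz)
  refine Summable.of_norm_bounded h1 fun m => ?_
  rw [norm_div, norm_pow, norm_pow, Real.norm_eq_abs, Real.norm_eq_abs]
  refine div_le_self (by positivity) (one_le_pow₀ ?_)
  rw [abs_of_nonneg (by positivity)]
  push_cast
  have : (0 : ℝ) ≤ m := by positivity
  linarith

theorem lerch_eq_tsum {c : ℝ} {e : ℕ} (hc : |c| = 1) (he : 2 ≤ e) {α : ℝ} (hα : 0 ≤ α) :
    HasSum (fun m : ℕ => c ^ m / ((m : ℝ) + α) ^ e) (lerch c e α) := by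
  have hs : Summable fun m : ℕ => c ^ m / ((m : ℝ) + α) ^ e := by
    refine Summable.of_norm_bounded (summable_inv_add_pow he hα) fun m => ?_
    rw [norm_div, norm_pow, Real.norm_eq_abs, hc, one_pow, Real.norm_eq_abs,
      abs_of_nonneg (by positivity)]
  have hconv : LerchConv c e := ⟨by omega, by
    rcases (abs_eq zero_le_one).1 hc with h | h
    · exact Or.inl ⟨h, he⟩
    · exact Or.inr h⟩
  rw [hs.hasSum_iff_tendsto_nat]
  exact lerch_tendsto hconv hα

/-! ### Moments of powers of the logarithm on (0, 1). -/

theorem continuousOn_mul_log_pow (m : ℕ) :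
    ContinuousOn (fun x : ℝ => x * Real.log x ^ m) (Set.Ici 0) := by
  rcases Nat.eq_zero_or_pos m with rfl | hm
  · simpa using! (continuousOn_id (α := ℝ))
  intro x hx
  rcases eq_or_lt_of_le (show (0 : ℝ) ≤ x from hx) with rfl | hx
  · rw [← continuousWithinAt_Ioi_iff_Ici]
    have hm' : (0 : ℝ) < m := by exact_mod_cast hm
    have h1 := (tendsto_log_mul_rpow_nhdsGT_zero (show (0 : ℝ) < 1 / m by positivity)).pow m
    simp only [ContinuousWithinAt, zero_mul]
    rw [zero_pow hm.ne'] at h1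
    refine h1.congr' ?_
    filter_upwards [self_mem_nhdsWithin] with x hx
    have hx : 0 < x := hx
    rw [mul_pow, ← Real.rpow_natCast (x ^ (1 / (m : ℝ))), ← Real.rpow_mul hx.le,
      one_div_mul_cancel hm'.ne', Real.rpow_one, mul_comm]
  · exact (continuousAt_id.mul ((Real.continuousAt_log hx.ne').pow m)).continuousWithinAt

theorem integrableOn_log_pow (m : ℕ) : IntegrableOn (fun x : ℝ => Real.log x ^ m) (Ioo 0 1) := by
  rcases Nat.eq_zero_or_pos m with rfl | hm
  · simp
  have hm' : (0 : ℝ) < m := by exact_mod_cast hm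
  -- From `|log x| ≤ x ^ (-t) / t`, this exponent makes the `m`-th power a multiple of the
  -- integrable `x ^ (-1/2)`.
  set t : ℝ := 1 / (2 * m) with ht
  have htp : 0 < t := by positivity
  have h1 : IntegrableOn (fun x : ℝ => (1 / t) ^ m * x ^ (-(1 / 2) : ℝ)) (Ioo 0 1) := by
    refine Integrable.const_mul ?_ _
    have := (intervalIntegral.intervalIntegrable_rpow' (a := 0) (b := 1)
      (show (-1 : ℝ) < -(1 / 2) by norm_num))
    rwa [intervalIntegrable_iff_integrableOn_Ioo_of_le zero_le_one] at this
  refine Integrable.mono' h1 (by fun_prop) ?_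
  refine (ae_restrict_iff' measurableSet_Ioo).2 (ae_of_all _ fun x hx => ?_)
  have h2 := (Real.abs_log_mul_self_rpow_lt x t hx.1 hx.2.le htp).le
  rw [abs_mul, abs_of_pos (Real.rpow_pos_of_pos hx.1 t)] at h2
  have h3 : |Real.log x| ≤ 1 / t * x ^ (-t) := by
    rw [Real.rpow_neg hx.1.le, ← div_eq_mul_inv, le_div_iff₀ (Real.rpow_pos_of_pos hx.1 t)]
    exact h2
  rw [norm_pow, Real.norm_eq_abs]
  calc |Real.log x| ^ m ≤ (1 / t * x ^ (-t)) ^ m := by gcongr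
    _ = (1 / t) ^ m * x ^ (-(1 / 2) : ℝ) := by
      rw [mul_pow, ← Real.rpow_natCast (x ^ (-t)), ← Real.rpow_mul hx.1.le]
      congr 2
      rw [ht]; field_simp

theorem integrableOn_pow_mul_log_pow (N m : ℕ) :
    IntegrableOn (fun x : ℝ => x ^ N * Real.log x ^ m) (Ioo 0 1) := by
  refine Integrable.mono (integrableOn_log_pow m) (by fun_prop) ?_
  refine (ae_restrict_iff' measurableSet_Ioo).2 (ae_of_all _ fun x hx => ?_)
  rw [norm_mul]
  refine mul_le_of_le_one_left (norm_nonneg _) ?_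
  rw [norm_pow, Real.norm_eq_abs, abs_of_pos hx.1]
  exact pow_le_one₀ hx.1.le hx.2.le

/-- Induction on `m` by integrating the derivative of `x ^ (N+1) log ^ (m+1) x`, which vanishes at
both endpoints. -/
theorem integral_pow_mul_log_pow (N m : ℕ) :
    ∫ x in Ioo (0 : ℝ) 1, x ^ N * Real.log x ^ m =
      (-1) ^ m * (m.factorial : ℝ) / ((N : ℝ) + 1) ^ (m + 1) := by
  have hN : (N : ℝ) + 1 ≠ 0 := by positivity
  induction m with
  | zero =>
    rw [← integral_Ioc_eq_integral_Ioo, ← intervalIntegral.integral_of_le zero_le_one]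
    simp [integral_pow]
  | succ m ih =>
    have hcont : ContinuousOn (fun x : ℝ => x ^ (N + 1) * Real.log x ^ (m + 1)) (Set.Icc 0 1) := by
      have := (continuous_pow N).continuousOn.mul
        ((continuousOn_mul_log_pow (m + 1)).mono (fun x hx => hx.1 : Set.Icc (0 : ℝ) 1 ⊆ _))
      refine this.congr fun x _ => ?_
      rw [pow_succ x, mul_assoc]
      rfl
    have hder : ∀ x ∈ Ioo (0 : ℝ) 1, HasDerivAt (fun x : ℝ => x ^ (N + 1) * Real.log x ^ (m + 1))
        (((N : ℝ) + 1) * (x ^ N * Real.log x ^ (m + 1)) +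
          ((m : ℝ) + 1) * (x ^ N * Real.log x ^ m)) x := by
      intro x hx
      have h1 := (hasDerivAt_pow (N + 1) x).mul ((Real.hasDerivAt_log hx.1.ne').pow (m + 1))
      refine HasDerivAt.congr_deriv (f := fun x => x ^ (N + 1) * Real.log x ^ (m + 1)) h1 ?_
      have := hx.1.ne'
      simp only [Pi.pow_apply, Nat.add_sub_cancel]
      push_cast
      field_simp
      ring
    have hi1 := (integrableOn_pow_mul_log_pow N (m + 1)).const_mul ((N : ℝ) + 1)
    have hi2 := (integrableOn_pow_mul_log_pow N m).const_mul ((m : ℝ) + 1)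
    have hint : IntervalIntegrable (fun x : ℝ => ((N : ℝ) + 1) * (x ^ N * Real.log x ^ (m + 1)) +
          ((m : ℝ) + 1) * (x ^ N * Real.log x ^ m)) volume 0 1 := by
      rw [intervalIntegrable_iff_integrableOn_Ioo_of_le zero_le_one]
      exact hi1.add hi2
    have key := intervalIntegral.integral_eq_sub_of_hasDerivAt_of_le zero_le_one hcont hder hint
    rw [intervalIntegral.integral_of_le zero_le_one, integral_Ioc_eq_integral_Ioo,
      integral_add hi1 hi2, integral_const_mul, integral_const_mul, ih] at key
    simp only [Real.log_one, ne_eq, Nat.add_eq_zero_iff, one_ne_zero, and_false,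
      not_false_eq_true, zero_pow, mul_zero, zero_mul, sub_zero] at key
    have : ∫ x in Ioo (0 : ℝ) 1, x ^ N * Real.log x ^ (m + 1) =
      -(((m : ℝ) + 1) * ((-1) ^ m * (m.factorial : ℝ) / ((N : ℝ) + 1) ^ (m + 1))) / (N + 1) := by
      rw [eq_div_iff hN]; linarith
    rw [this, Nat.factorial_succ]
    push_cast
    field_simp
    ring

theorem abs_log_pow {x : ℝ} (hx : x ∈ Ioo (0 : ℝ) 1) (m : ℕ) :
    |Real.log x| ^ m = (-1) ^ m * Real.log x ^ m := by
  rw [abs_of_neg (Real.log_neg hx.1 hx.2), neg_pow]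

theorem integral_pow_mul_abs_log_pow (N m : ℕ) :
    ∫ x in Ioo (0 : ℝ) 1, x ^ N * |Real.log x| ^ m =
      (m.factorial : ℝ) / ((N : ℝ) + 1) ^ (m + 1) := by
  rw [setIntegral_congr_fun (g := fun x => (-1) ^ m * (x ^ N * Real.log x ^ m)) measurableSet_Ioo
    (fun x hx => ?_), integral_const_mul, integral_pow_mul_log_pow, ← mul_div_assoc, ← mul_assoc,
    ← mul_pow]
  · norm_num
  · simp only [abs_log_pow hx]
    ring

theorem integrableOn_pow_mul_abs_log_pow (N m : ℕ) :
    IntegrableOn (fun x : ℝ => x ^ N * |Real.log x| ^ m) (Ioo 0 1) := by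
  refine (integrableOn_pow_mul_log_pow N m).norm.congr ?_
  refine (ae_restrict_iff' measurableSet_Ioo).2 (ae_of_all _ fun x hx => ?_)
  simp only [norm_mul, norm_pow, Real.norm_eq_abs, abs_of_pos hx.1]

/-! ### The kernel log^m x / (1 - a x) and integral representations of Lerch values. -/

theorem one_sub_mul_pos {a x : ℝ} (ha : |a| ≤ 1) (hx : x ∈ Ioo (0 : ℝ) 1) : 0 < 1 - a * x := by
  have := abs_le.1 ha
  nlinarith [hx.1, hx.2]

/-- For `a = 1` one has `m ≥ 1`. On `x ≤ 1/2` the denominator is at least `1/2`; on `x ≥ 1/2` one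
factor `|log x| ≤ 2 (1 - x)` cancels it, whence the power `m - 1`. -/
theorem abs_log_pow_div_le {a : ℝ} {m : ℕ} (h : LerchConv a (m + 1)) {x : ℝ}
    (hx : x ∈ Ioo (0 : ℝ) 1) :
    |Real.log x| ^ m / (1 - a * x) ≤ 2 * |Real.log x| ^ m + 2 * |Real.log x| ^ (m - 1) := by
  obtain ⟨hx0, hx1⟩ := hx
  have h0 := abs_nonneg (Real.log x)
  have hm := pow_nonneg h0 m
  have hm1 := pow_nonneg h0 (m - 1)
  rcases h.2 with ⟨rfl, h2⟩ | rfl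
  · rw [div_le_iff₀ (by linarith)]
    obtain ⟨k, rfl⟩ : ∃ k, m = k + 1 := ⟨m - 1, by omega⟩
    simp only [Nat.add_sub_cancel] at *
    rcases le_total x (1 / 2) with hx2 | hx2
    · nlinarith
    · have hlog : |Real.log x| ≤ 2 * (1 - x) := by
        rw [abs_of_neg (Real.log_neg hx0 hx1)]
        have := Real.one_sub_inv_le_log_of_pos hx0
        have h3 : x⁻¹ - 1 ≤ 2 * (1 - x) := by
          rw [inv_eq_one_div, div_sub' hx0.ne', div_le_iff₀ hx0]
          nlinarith
        linarith
      have : |Real.log x| ^ (k + 1) ≤ 2 * (1 - x) * |Real.log x| ^ k := by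
        rw [pow_succ, mul_comm]
        gcongr
      nlinarith [mul_nonneg hm (show 0 ≤ 1 - x by linarith)]
  · have : |Real.log x| ^ m / (1 - -1 * x) ≤ |Real.log x| ^ m :=
      div_le_self hm (by linarith)
    linarith

/-- Bounds for the kernel `|log x| ^ m x ^ N / (1 - a x)`. -/
theorem pow_mul_kernel_le {a : ℝ} {m : ℕ} (h : LerchConv a (m + 1)) (N : ℕ) {x : ℝ}
    (hx : x ∈ Ioo (0 : ℝ) 1) :
    x ^ N * (|Real.log x| ^ m / (1 - a * x)) ≤
      2 * (x ^ N * |Real.log x| ^ m) + 2 * (x ^ N * |Real.log x| ^ (m - 1)) := by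
  have := mul_le_mul_of_nonneg_left (abs_log_pow_div_le h hx) (pow_nonneg hx.1.le N)
  linarith

theorem LerchConv.abs_eq_one {c : ℝ} {e : ℕ} (h : LerchConv c e) : |c| = 1 := by
  rcases h.2 with h | h <;> simp [h]

theorem integrableOn_pow_mul_abs_kernel {a : ℝ} {m : ℕ} (h : LerchConv a (m + 1)) (N : ℕ) :
    IntegrableOn (fun x : ℝ => x ^ N * (|Real.log x| ^ m / (1 - a * x))) (Ioo 0 1) := by
  refine Integrable.mono' (((integrableOn_pow_mul_abs_log_pow N m).const_mul 2).add
    ((integrableOn_pow_mul_abs_log_pow N (m - 1)).const_mul 2)) ?_ ?_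
  · exact Measurable.aestronglyMeasurable (by fun_prop)
  refine (ae_restrict_iff' measurableSet_Ioo).2 (ae_of_all _ fun x hx => ?_)
  rw [Real.norm_of_nonneg]
  · exact pow_mul_kernel_le h N hx
  · have := one_sub_mul_pos h.abs_eq_one.le hx
    have := hx.1
    positivity

/-- The decay `1 / (N + 1)` is the essential point: with `N = n k` and the weight `1 / k ^ p` it
yields summability like `k ^ (-2)`, even for `p = 1`. -/
theorem integral_pow_mul_abs_kernel_le {a : ℝ} {m : ℕ} (h : LerchConv a (m + 1)) (N : ℕ) :
    ∫ x in Ioo (0 : ℝ) 1, x ^ N * (|Real.log x| ^ m / (1 - a * x)) ≤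
      4 * (m.factorial : ℝ) / ((N : ℝ) + 1) := by
  have h1 := integrableOn_pow_mul_abs_log_pow N m
  have h2 := integrableOn_pow_mul_abs_log_pow N (m - 1)
  have := setIntegral_mono_on (integrableOn_pow_mul_abs_kernel h N)
    ((h1.const_mul 2).add (h2.const_mul 2)) measurableSet_Ioo
    (fun x hx => pow_mul_kernel_le h N hx)
  refine this.trans ?_
  simp only [Pi.add_apply]
  rw [integral_add (h1.const_mul 2) (h2.const_mul 2), integral_const_mul, integral_const_mul,
    integral_pow_mul_abs_log_pow, integral_pow_mul_abs_log_pow]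
  have hN : (1 : ℝ) ≤ (N : ℝ) + 1 := by have := Nat.cast_nonneg (α := ℝ) N; linarith
  have aux : ∀ j : ℕ, j ≤ m → (j.factorial : ℝ) / ((N : ℝ) + 1) ^ (j + 1) ≤
      (m.factorial : ℝ) / ((N : ℝ) + 1) := by
    intro j hj
    have : (j.factorial : ℝ) ≤ m.factorial := by exact_mod_cast Nat.factorial_le hj
    gcongr
    calc (N : ℝ) + 1 = ((N : ℝ) + 1) ^ 1 := (pow_one _).symm
      _ ≤ _ := pow_le_pow_right₀ hN (by omega)
  have e1 := aux m le_rfl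
  have e2 := aux (m - 1) (Nat.sub_le _ _)
  calc _ ≤ 2 * ((m.factorial : ℝ) / ((N : ℝ) + 1)) + 2 * ((m.factorial : ℝ) / ((N : ℝ) + 1)) := by
        gcongr
    _ = _ := by ring

theorem integrableOn_pow_mul_kernel {a : ℝ} {m : ℕ} (h : LerchConv a (m + 1)) (N : ℕ) :
    IntegrableOn (fun x : ℝ => x ^ N * (Real.log x ^ m / (1 - a * x))) (Ioo 0 1) := by
  refine Integrable.mono' (integrableOn_pow_mul_abs_kernel h N)
    (Measurable.aestronglyMeasurable (by fun_prop)) ?_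
  refine (ae_restrict_iff' measurableSet_Ioo).2 (ae_of_all _ fun x hx => ?_)
  rw [norm_mul, norm_div, norm_pow, norm_pow, Real.norm_of_nonneg hx.1.le, Real.norm_eq_abs,
    Real.norm_of_nonneg (one_sub_mul_pos h.abs_eq_one.le hx).le]

theorem hasSum_geometric_mul_pow {z : ℝ} (hz : |z| < 1) {x : ℝ} (hx : x ∈ Ioo (0 : ℝ) 1) :
    HasSum (fun i : ℕ => z ^ i * x ^ i) (1 / (1 - z * x)) := by
  simp only [← mul_pow, one_div]
  refine hasSum_geometric_of_abs_lt_one ?_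
  rw [abs_mul, abs_of_pos hx.1]
  nlinarith [hx.1, hx.2, abs_nonneg z]

theorem integral_pow_mul_kernel_of_lt {z : ℝ} (hz : |z| < 1) (m N : ℕ) :
    ∫ x in Ioo (0 : ℝ) 1, x ^ N * (Real.log x ^ m / (1 - z * x)) =
      (-1) ^ m * (m.factorial : ℝ) * lerchSum z (m + 1) ((N : ℝ) + 1) := by
  set F : ℕ → ℝ → ℝ := fun i x => z ^ i * (x ^ (N + i) * Real.log x ^ m)
  have hF : ∀ i, Integrable (F i) (volume.restrict (Ioo 0 1)) := fun i =>
    (integrableOn_pow_mul_log_pow (N + i) m).const_mul _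
  have hnorm : ∀ i, ∫ x in Ioo (0 : ℝ) 1, ‖F i x‖ =
      (m.factorial : ℝ) * (|z| ^ i / ((i : ℝ) + ((N : ℝ) + 1)) ^ (m + 1)) := by
    intro i
    have e : ∀ x ∈ Ioo (0 : ℝ) 1, ‖F i x‖ = |z| ^ i * (x ^ (N + i) * |Real.log x| ^ m) := by
      intro x hx
      simp only [F, norm_mul, norm_pow, Real.norm_eq_abs, abs_of_pos hx.1]
    rw [setIntegral_congr_fun measurableSet_Ioo e, integral_const_mul,
      integral_pow_mul_abs_log_pow]
    push_cast
    rw [show (i : ℝ) + (N + 1) = N + i + 1 by ring]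
    ring
  have hsum : Summable fun i => ∫ x in Ioo (0 : ℝ) 1, ‖F i x‖ := by
    simp only [hnorm]
    exact (summable_lerchSum (by simpa using hz) (m + 1) (by positivity)).mul_left _
  have key := hasSum_integral_of_summable_integral_norm hF hsum
  have e2 : ∀ x ∈ Ioo (0 : ℝ) 1, ∑' i, F i x = x ^ N * (Real.log x ^ m / (1 - z * x)) := by
    intro x hx
    have := (hasSum_geometric_mul_pow hz hx).mul_left (x ^ N * Real.log x ^ m)
    rw [← mul_div_assoc, ← mul_one_div, ← this.tsum_eq]
    refine tsum_congr fun i => ?_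
    simp only [F, pow_add]
    ring
  rw [setIntegral_congr_fun measurableSet_Ioo e2] at key
  rw [← key.tsum_eq, lerchSum, ← tsum_mul_left]
  refine tsum_congr fun i => ?_
  simp only [F]
  rw [integral_const_mul, integral_pow_mul_log_pow]
  push_cast
  rw [show (i : ℝ) + (N + 1) = N + i + 1 by ring]
  ring

/-- Rests on `1 - a x ≤ 2 (1 - a σ x)`: for `a = 1` even without the factor `2`, for `a = -1`
because `1 + x ≤ 2`. -/
theorem abs_damped_kernel_le {a : ℝ} {m : ℕ} (h : LerchConv a (m + 1)) (N : ℕ) {σ : ℝ}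
    (hσ : σ ∈ Ioo (0 : ℝ) 1) {x : ℝ} (hx : x ∈ Ioo (0 : ℝ) 1) :
    ‖x ^ N * (Real.log x ^ m / (1 - a * σ * x))‖ ≤
      2 * (x ^ N * (|Real.log x| ^ m / (1 - a * x))) := by
  have hσx : σ * x ∈ Ioo (0 : ℝ) 1 := ⟨mul_pos hσ.1 hx.1, by nlinarith [hσ.1, hσ.2, hx.1, hx.2]⟩
  have h1 := one_sub_mul_pos h.abs_eq_one.le hx
  have h2 := one_sub_mul_pos h.abs_eq_one.le hσx
  rw [← mul_assoc] at h2
  rw [norm_mul, norm_div, norm_pow, norm_pow, Real.norm_of_nonneg hx.1.le, Real.norm_eq_abs,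
    Real.norm_of_nonneg h2.le]
  have h3 : 1 - a * x ≤ 2 * (1 - a * σ * x) := by
    rcases h.2 with ⟨rfl, -⟩ | rfl
    · nlinarith [hσ.1, hσ.2, hx.1, hx.2]
    · nlinarith [hσ.1, hσ.2, hx.1, hx.2, hσx.1]
  have h4 : |Real.log x| ^ m / (1 - a * σ * x) ≤ 2 * (|Real.log x| ^ m / (1 - a * x)) := by
    rw [← mul_div_assoc, div_le_div_iff₀ h2 h1]
    nlinarith [pow_nonneg (abs_nonneg (Real.log x)) m]
  have := mul_le_mul_of_nonneg_left h4 (pow_nonneg hx.1.le N)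
  linarith

/-- The geometric series is integrated termwise for `a σ` with `σ < 1`, where convergence is
absolute. As `σ → 1` the integrals converge by domination and the series by Abel's theorem. -/
theorem integral_pow_mul_kernel {a : ℝ} {m : ℕ} (h : LerchConv a (m + 1)) (N : ℕ) :
    ∫ x in Ioo (0 : ℝ) 1, x ^ N * (Real.log x ^ m / (1 - a * x)) =
      (-1) ^ m * (m.factorial : ℝ) * lerch a (m + 1) ((N : ℝ) + 1) := by
  have hlt : ∀ᶠ σ : ℝ in 𝓝[<] 1, σ ∈ Ioo (0 : ℝ) 1 := Ioo_mem_nhdsLT zero_lt_one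
  have h1 : Tendsto (fun σ : ℝ => ∫ x in Ioo (0 : ℝ) 1,
      x ^ N * (Real.log x ^ m / (1 - a * σ * x))) (𝓝[<] 1)
      (𝓝 (∫ x in Ioo (0 : ℝ) 1, x ^ N * (Real.log x ^ m / (1 - a * x)))) := by
    refine tendsto_integral_filter_of_dominated_convergence
      (fun x => 2 * (x ^ N * (|Real.log x| ^ m / (1 - a * x)))) ?_ ?_
      ((integrableOn_pow_mul_abs_kernel h N).const_mul 2) ?_
    · exact Eventually.of_forall fun σ => Measurable.aestronglyMeasurable (by fun_prop)
    · filter_upwards [hlt] with σ hσ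
      exact (ae_restrict_iff' measurableSet_Ioo).2 (ae_of_all _ fun x hx =>
        abs_damped_kernel_le h N hσ hx)
    · refine (ae_restrict_iff' measurableSet_Ioo).2 (ae_of_all _ fun x hx => ?_)
      have h2 := (one_sub_mul_pos h.abs_eq_one.le hx).ne'
      have : ContinuousAt (fun σ : ℝ => x ^ N * (Real.log x ^ m / (1 - a * σ * x))) 1 := by
        refine continuousAt_const.mul (ContinuousAt.div continuousAt_const (by fun_prop) ?_)
        simpa using h2
      have := this.tendsto.mono_left (nhdsWithin_le_nhds (s := Set.Iio 1))
      simpa using this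
  have h2 := (lerchSum_tendsto h (show (0 : ℝ) ≤ (N : ℝ) + 1 by positivity)).const_mul
    ((-1) ^ m * (m.factorial : ℝ))
  refine tendsto_nhds_unique h1 (h2.congr' ?_)
  filter_upwards [hlt] with σ hσ
  rw [integral_pow_mul_kernel_of_lt]
  rw [abs_mul, h.abs_eq_one, one_mul, abs_of_pos hσ.1]
  exact hσ.2

/-- A bound for the damped Lerch series that is uniform in the damping factor. -/
theorem abs_lerchSum_le {a : ℝ} {m : ℕ} (h : LerchConv a (m + 1)) (N : ℕ) {σ : ℝ}
    (hσ : σ ∈ Ioo (0 : ℝ) 1) :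
    |lerchSum (a * σ) (m + 1) ((N : ℝ) + 1)| ≤ 8 / ((N : ℝ) + 1) := by
  have hz : |a * σ| < 1 := by
    rw [abs_mul, h.abs_eq_one, one_mul, abs_of_pos hσ.1]; exact hσ.2
  -- The bound is read off the integral: for `a = -1`, `m = 0` the sum of the absolute values of the
  -- terms is unbounded as `σ → 1`.
  have h1 := integral_pow_mul_kernel_of_lt hz m N
  have h2 : ‖∫ x in Ioo (0 : ℝ) 1, x ^ N * (Real.log x ^ m / (1 - a * σ * x))‖ ≤
      ∫ x in Ioo (0 : ℝ) 1, 2 * (x ^ N * (|Real.log x| ^ m / (1 - a * x))) :=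
    norm_integral_le_of_norm_le ((integrableOn_pow_mul_abs_kernel h N).const_mul 2)
      ((ae_restrict_iff' measurableSet_Ioo).2 (ae_of_all _ fun x hx =>
        abs_damped_kernel_le h N hσ hx))
  rw [h1, integral_const_mul, norm_mul, norm_mul, norm_pow, norm_neg, norm_one, one_pow, one_mul,
    Real.norm_of_nonneg (by positivity), Real.norm_eq_abs] at h2
  have h3 := integral_pow_mul_abs_kernel_le h N
  have hf : (0 : ℝ) < m.factorial := by exact_mod_cast Nat.factorial_pos m
  have h4 : (m.factorial : ℝ) * |lerchSum (a * σ) (m + 1) ((N : ℝ) + 1)| ≤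
      (m.factorial : ℝ) * (8 / ((N : ℝ) + 1)) := by
    calc _ ≤ _ := h2
      _ ≤ 2 * (4 * (m.factorial : ℝ) / ((N : ℝ) + 1)) := by gcongr
      _ = _ := by ring
  exact le_of_mul_le_mul_left h4 hf

/-! ### The power series of Li_p and termwise integration. -/

/-- Besides the exchange of sum and integral, this yields integrability of the limit, hence the
absolute convergence claimed in the theorem. -/
theorem integrable_of_hasSum_of_summable_integral_norm {α : Type*} [MeasurableSpace α]
    {μ : Measure α} {F : ℕ → α → ℝ} {f : α → ℝ} (hF : ∀ i, Integrable (F i) μ)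
    (hs : Summable fun i => ∫ x, ‖F i x‖ ∂μ) (hf : ∀ᵐ x ∂μ, HasSum (fun i => F i x) (f x)) :
    Integrable f μ ∧ HasSum (fun i => ∫ x, F i x ∂μ) (∫ x, f x ∂μ) := by
  refine ⟨⟨?_, ?_⟩, ?_⟩
  · refine aestronglyMeasurable_of_tendsto_ae atTop
      (f := fun N x => ∑ i ∈ range N, F i x) (fun N => ?_) ?_
    · exact (integrable_finsetSum _ fun i _ => hF i).1
    · filter_upwards [hf] with x hx using hx.tendsto_sum_nat
  · have h1 : ∫⁻ x, ‖f x‖ₑ ∂μ ≤ ∫⁻ x, ∑' i, ‖F i x‖ₑ ∂μ := by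
      refine lintegral_mono_ae ?_
      filter_upwards [hf] with x hx
      rw [← hx.tsum_eq]
      exact enorm_tsum_le_tsum_enorm
    refine lt_of_le_of_lt h1 ?_
    rw [lintegral_tsum fun i => (hF i).1.enorm]
    have h2 : ∀ i, ∫⁻ x, ‖F i x‖ₑ ∂μ = ENNReal.ofReal (∫ x, ‖F i x‖ ∂μ) := fun i =>
      (ofReal_integral_norm_eq_lintegral_enorm (hF i)).symm
    simp only [h2]
    rw [← ENNReal.ofReal_tsum_of_nonneg (fun i => integral_nonneg fun x => norm_nonneg _) hs]
    exact ENNReal.ofReal_lt_top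
  · have := hasSum_integral_of_summable_integral_norm hF hs
    rwa [integral_congr_ae (g := f) (by filter_upwards [hf] with x hx using hx.tsum_eq)] at this

theorem integrableOn_polylogKernel_of_lt {p : ℕ} {z : ℝ} (hz : |z| < 1) :
    IntegrableOn (polylogKernel p z) (Ioo 0 1) := by
  have h1 : 0 < 1 - |z| := by linarith
  refine Integrable.mono' (((integrableOn_pow_mul_abs_log_pow 0 (p - 1)).const_mul (1 / (1 - |z|))))
    (Measurable.aestronglyMeasurable (by unfold polylogKernel; fun_prop)) ?_
  refine (ae_restrict_iff' measurableSet_Ioo).2 (ae_of_all _ fun x hx => ?_)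
  have hx' : 1 - |z| ≤ 1 - z * x := by
    have := le_abs_self z
    nlinarith [hx.1, hx.2, abs_nonneg z]
  rw [polylogKernel, norm_div, norm_mul, norm_pow, Real.norm_eq_abs, Real.norm_eq_abs,
    Real.norm_of_nonneg (h1.le.trans hx'), pow_zero, one_mul, mul_comm (1 / _), mul_one_div]
  have : |z| * |Real.log x| ^ (p - 1) ≤ |Real.log x| ^ (p - 1) :=
    mul_le_of_le_one_left (by positivity) hz.le
  gcongr

theorem polylog_eq_mul_lerchSum {p : ℕ} (hp : 1 ≤ p) {z : ℝ} (hz : |z| < 1) :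
    polylog p z = z * lerchSum z p 1 := by
  have h1 := integral_pow_mul_kernel_of_lt hz (p - 1) 0
  rw [polylog, if_pos (le_of_lt (lt_of_le_of_lt (le_abs_self z) hz)),
    intervalIntegral.integral_of_le zero_le_one, integral_Ioc_eq_integral_Ioo]
  have h2 : ∫ y in Ioo (0 : ℝ) 1, polylogKernel p z y =
      z * ∫ x in Ioo (0 : ℝ) 1, x ^ 0 * (Real.log x ^ (p - 1) / (1 - z * x)) := by
    rw [← integral_const_mul]
    refine integral_congr_ae (ae_of_all _ fun x => ?_)
    simp only [polylogKernel, pow_zero, one_mul]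
    ring
  rw [h2, h1, Nat.sub_add_cancel hp]
  have hf : ((p - 1).factorial : ℝ) ≠ 0 := by exact_mod_cast Nat.factorial_ne_zero _
  have hs : ((-1 : ℝ) ^ (p - 1)) * (-1) ^ (p - 1) = 1 := by rw [← mul_pow]; norm_num
  simp only [Nat.cast_zero, zero_add]
  field_simp
  linear_combination z * lerchSum z p 1 * hs

theorem hasSum_polylog {p : ℕ} (hp : 1 ≤ p) {z : ℝ} (hz : |z| < 1) :
    HasSum (fun k : ℕ => z ^ (k + 1) / ((k : ℝ) + 1) ^ p) (polylog p z) := by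
  rw [polylog_eq_mul_lerchSum hp hz]
  refine ((summable_lerchSum hz p zero_le_one).hasSum.mul_left z).congr_fun ?_
  intro k
  rw [pow_succ]; ring

theorem abs_mul_pow_lt_one {b : ℝ} (hb : |b| = 1) {n : ℕ} (hn : 1 ≤ n) {x : ℝ}
    (hx : x ∈ Ioo (0 : ℝ) 1) : |b * x ^ n| < 1 := by
  rw [abs_mul, hb, one_mul, abs_of_pos (pow_pos hx.1 n)]
  exact pow_lt_one₀ hx.1.le hx.2 (by omega)

/-- Termwise integration of the polylogarithm against `log x ^ m / (1 - a x)`. -/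
theorem integral_log_pow_mul_polylog {a b : ℝ} {p m n : ℕ} (hp : 1 ≤ p) (hn : 1 ≤ n)
    (ha : LerchConv a (m + 1)) (hb : |b| = 1) :
    IntegrableOn (fun x : ℝ => Real.log x ^ m * polylog p (b * x ^ n) / (1 - a * x)) (Ioo 0 1) ∧
    HasSum (fun k : ℕ => b ^ (k + 1) / ((k : ℝ) + 1) ^ p *
        ((-1) ^ m * (m.factorial : ℝ) * lerch a (m + 1) (((n * (k + 1) : ℕ) : ℝ) + 1)))
      (∫ x in Ioo (0 : ℝ) 1, Real.log x ^ m * polylog p (b * x ^ n) / (1 - a * x)) := by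
  set F : ℕ → ℝ → ℝ := fun k x => b ^ (k + 1) / ((k : ℝ) + 1) ^ p *
    (x ^ (n * (k + 1)) * (Real.log x ^ m / (1 - a * x)))
  have hF : ∀ k, IntegrableOn (F k) (Ioo 0 1) := fun k =>
    (integrableOn_pow_mul_kernel ha (n * (k + 1))).const_mul _
  have hs : Summable fun k => ∫ x in Ioo (0 : ℝ) 1, ‖F k x‖ := by
    -- The weight `1 / (k+1) ^ p` gives one factor `1 / (k+1)`, and the decay of the kernel integral
    -- at `N = n (k+1)` gives the other.
    have h2 : Summable fun k : ℕ => 4 * (m.factorial : ℝ) * (1 / ((k : ℝ) + 1) ^ 2) :=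
      (summable_inv_add_pow le_rfl zero_le_one).mul_left _
    refine Summable.of_nonneg_of_le (fun k => integral_nonneg fun x => norm_nonneg _)
      (fun k => ?_) h2
    have e : ∀ x ∈ Ioo (0 : ℝ) 1, ‖F k x‖ = 1 / ((k : ℝ) + 1) ^ p *
        (x ^ (n * (k + 1)) * (|Real.log x| ^ m / (1 - a * x))) := by
      intro x hx
      simp only [F]
      rw [norm_mul, norm_mul, norm_div, norm_div, norm_pow, norm_pow, norm_pow, norm_pow,
        Real.norm_of_nonneg hx.1.le, Real.norm_eq_abs, hb, one_pow, Real.norm_eq_abs (Real.log x),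
        Real.norm_of_nonneg (one_sub_mul_pos ha.abs_eq_one.le hx).le,
        Real.norm_of_nonneg (show (0 : ℝ) ≤ (k : ℝ) + 1 by positivity)]
    rw [setIntegral_congr_fun measurableSet_Ioo e, integral_const_mul]
    have h3 := integral_pow_mul_abs_kernel_le ha (n * (k + 1))
    have hk : (1 : ℝ) ≤ (k : ℝ) + 1 := by have := Nat.cast_nonneg (α := ℝ) k; linarith
    have h4 : (k : ℝ) + 1 ≤ ((n * (k + 1) : ℕ) : ℝ) + 1 := by
      have : (k + 1 : ℕ) ≤ n * (k + 1) := Nat.le_mul_of_pos_left _ hn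
      have : ((k + 1 : ℕ) : ℝ) ≤ ((n * (k + 1) : ℕ) : ℝ) := by exact_mod_cast this
      push_cast at *
      linarith
    calc _ ≤ 1 / ((k : ℝ) + 1) * (4 * (m.factorial : ℝ) / ((k : ℝ) + 1)) := by
          gcongr
          · exact le_trans (by positivity) (integral_nonneg_of_ae
              ((ae_restrict_iff' measurableSet_Ioo).2 (ae_of_all _ fun x hx => by
                have := one_sub_mul_pos ha.abs_eq_one.le hx
                have := hx.1
                dsimp only [Pi.zero_apply]
                positivity)))
          · calc (k : ℝ) + 1 = ((k : ℝ) + 1) ^ 1 := (pow_one _).symm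
              _ ≤ _ := pow_le_pow_right₀ hk hp
          · refine h3.trans ?_
            gcongr
      _ = _ := by field_simp
  have hf : ∀ x ∈ Ioo (0 : ℝ) 1, HasSum (fun k => F k x)
      (Real.log x ^ m * polylog p (b * x ^ n) / (1 - a * x)) := by
    intro x hx
    have := (hasSum_polylog hp (abs_mul_pow_lt_one hb hn hx)).mul_left
      (Real.log x ^ m / (1 - a * x))
    rw [div_mul_eq_mul_div] at this
    refine this.congr_fun fun k => ?_
    simp only [F]
    rw [mul_pow, ← pow_mul]
    ring
  obtain ⟨h1, h2⟩ := integrable_of_hasSum_of_summable_integral_norm hF hs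
    ((ae_restrict_iff' measurableSet_Ioo).2 (ae_of_all _ hf))
  refine ⟨h1, h2.congr_fun fun k => ?_⟩
  simp only [F]
  rw [integral_const_mul, integral_pow_mul_kernel ha]

/-! ### Principal values of Li_p outside the unit disc. -/

/-- The kernel of `Li` at `b / t` with its singular part at `y = t` removed. -/
noncomputable def regKernel (b t : ℝ) (m : ℕ) (y : ℝ) : ℝ :=
  b * (Real.log y ^ m - Real.log t ^ m) / (t - b * y)

theorem abs_log_sub_log_le {x y : ℝ} (hx : 0 < x) (hy : 0 < y) :
    |Real.log x - Real.log y| ≤ (1 / x + 1 / y) * |x - y| := by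
  have key : ∀ {u v : ℝ}, 0 < u → 0 < v → Real.log u - Real.log v ≤ 1 / v * |u - v| := by
    intro u v hu hv
    rw [← Real.log_div hu.ne' hv.ne']
    have h1 := Real.log_le_sub_one_of_pos (div_pos hu hv)
    have h2 : u / v - 1 = 1 / v * (u - v) := by field_simp
    rw [h2] at h1
    exact h1.trans (by gcongr; exact le_abs_self _)
  rw [abs_le]
  have h1 := key hx hy
  have h2 := key hy hx
  rw [abs_sub_comm] at h2
  have h3 : 0 ≤ 1 / x * |x - y| := by positivity
  have h4 : 0 ≤ 1 / y * |x - y| := by positivity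
  constructor <;> linarith

/-- If `|t - b y| ≥ t / 2` the quotient is bounded crudely. Otherwise `b = 1` and `y > t / 2`, and
the numerator is `log y - log t` times a bounded geometric sum, so the Lipschitz bound for `log`
cancels `t - y`. -/
theorem abs_regKernel_le {b t : ℝ} (hb : b = 1 ∨ b = -1) (ht : t ∈ Ioo (0 : ℝ) 1) (m : ℕ) :
    ∃ C, ∀ y ∈ Ioo (0 : ℝ) 1, |regKernel b t m y| ≤
      2 / t * |Real.log y| ^ m + C := by
  have ht0 := ht.1
  set L := Real.log t
  set A := |Real.log (t / 2)|
  have hA : 0 ≤ A := abs_nonneg _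
  refine ⟨2 / t * |L| ^ m + 3 / t * ∑ i ∈ range m, A ^ i * A ^ (m - 1 - i), fun y hy => ?_⟩
  have hS : 0 ≤ ∑ i ∈ range m, A ^ i * A ^ (m - 1 - i) := sum_nonneg fun i _ => by positivity
  have hb1 : |b| = 1 := by rcases hb with h | h <;> simp [h]
  rw [regKernel, abs_div, abs_mul, hb1, one_mul]
  have hnum : |Real.log y ^ m - L ^ m| ≤ |Real.log y| ^ m + |L| ^ m := by
    refine (abs_sub _ _).trans ?_
    rw [abs_pow, abs_pow]
  by_cases hfar : t / 2 ≤ |t - b * y|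
  · have : |Real.log y ^ m - L ^ m| / |t - b * y| ≤ (|Real.log y| ^ m + |L| ^ m) / (t / 2) := by
      gcongr
    calc _ ≤ _ := this
      _ = 2 / t * |Real.log y| ^ m + 2 / t * |L| ^ m := by field_simp
      _ ≤ _ := by
        have : 0 ≤ 3 / t * ∑ i ∈ range m, A ^ i * A ^ (m - 1 - i) := by positivity
        linarith
  · have hb' : b = 1 := by
      rcases hb with h | h
      · exact h
      · exfalso
        rw [h] at hfar
        apply hfar
        rw [abs_of_pos (by linarith [hy.1])]
        linarith [hy.1]
    subst hb'
    rw [one_mul] at hfar ⊢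
    have hyt : t / 2 < y := by
      by_contra hle
      push Not at hle hfar
      rw [abs_of_pos (by linarith)] at hfar
      linarith
    have hlogy : |Real.log y| ≤ A := by
      have h1 : Real.log (t / 2) ≤ Real.log y := Real.log_le_log (by linarith) hyt.le
      rw [abs_of_neg (Real.log_neg hy.1 hy.2)]
      exact le_trans (by linarith) (neg_le_abs _)
    have hlogt : |L| ≤ A := by
      have h1 : Real.log (t / 2) ≤ Real.log t := Real.log_le_log (by linarith) (by linarith)
      rw [abs_of_neg (Real.log_neg ht.1 ht.2)]
      exact le_trans (by linarith) (neg_le_abs _)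
    rw [← (Commute.all (Real.log y) L).geom_sum₂_mul m, abs_mul]
    have h1 : |∑ i ∈ range m, Real.log y ^ i * L ^ (m - 1 - i)| ≤
        ∑ i ∈ range m, A ^ i * A ^ (m - 1 - i) := by
      refine (abs_sum_le_sum_abs _ _).trans (sum_le_sum fun i _ => ?_)
      rw [abs_mul, abs_pow, abs_pow]
      gcongr
    have h2 : |Real.log y - L| / |t - y| ≤ 3 / t := by
      have h3 := abs_log_sub_log_le hy.1 ht.1
      have h4 : 1 / y + 1 / t ≤ 3 / t := by
        have : 1 / y ≤ 2 / t := by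
          rw [div_le_div_iff₀ hy.1 ht.1]; linarith
        have : (3 : ℝ) / t = 2 / t + 1 / t := by ring
        linarith
      refine div_le_of_le_mul₀ (abs_nonneg _) (by positivity) (h3.trans ?_)
      rw [abs_sub_comm y t]
      gcongr
    rw [mul_div_assoc]
    calc _ ≤ (∑ i ∈ range m, A ^ i * A ^ (m - 1 - i)) * (3 / t) := by gcongr
      _ ≤ _ := by
        have : 0 ≤ 2 / t * |Real.log y| ^ m + 2 / t * |L| ^ m := by positivity
        linarith

theorem integrableOn_regKernel {b t : ℝ} (hb : b = 1 ∨ b = -1) (ht : t ∈ Ioo (0 : ℝ) 1) (m : ℕ) :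
    IntegrableOn (regKernel b t m) (Ioo 0 1) := by
  obtain ⟨C, hC⟩ := abs_regKernel_le hb ht m
  have h1 : IntegrableOn (fun x : ℝ => |Real.log x| ^ m) (Ioo 0 1) := by
    simpa using integrableOn_pow_mul_abs_log_pow 0 m
  refine Integrable.mono' ((h1.const_mul (2 / t)).add (g := fun _ => C) (by simp))
    (Measurable.aestronglyMeasurable (by unfold regKernel; fun_prop)) ?_
  exact (ae_restrict_iff' measurableSet_Ioo).2 (ae_of_all _ hC)

theorem polylogKernel_div (p : ℕ) {b t : ℝ} (ht : t ≠ 0) (y : ℝ) :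
    polylogKernel p (b / t) y =
      regKernel b t (p - 1) y + Real.log t ^ (p - 1) * (b / (t - b * y)) := by
  have h : 1 - b / t * y = (t - b * y) / t := by field_simp
  rw [polylogKernel, regKernel, h]
  rcases eq_or_ne (t - b * y) 0 with h0 | h0
  · simp [h0]
  · field_simp
    ring

/-- `Real.log` is `log |·|`, so a single formula serves on both sides of the singularity. -/
theorem integral_inv_sub {t u v : ℝ} (h : ∀ y ∈ Set.uIcc u v, t - y ≠ 0) :
    IntervalIntegrable (fun y => 1 / (t - y)) volume u v ∧
      ∫ y in u..v, 1 / (t - y) = Real.log (t - u) - Real.log (t - v) := by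
  have hc : ContinuousOn (fun y : ℝ => 1 / (t - y)) (Set.uIcc u v) :=
    continuousOn_const.div (by fun_prop) h
  refine ⟨hc.intervalIntegrable, ?_⟩
  rw [intervalIntegral.integral_eq_sub_of_hasDerivAt (f := fun y => -Real.log (t - y))
    (fun y hy => ?_) hc.intervalIntegrable]
  · ring
  · have := (((hasDerivAt_id y).const_sub t).log (h y hy)).neg
    simpa [neg_div] using! this

/-- After the cut-off the singular part integrates to `log t - log ε + log ε - log (1 - t)`, so `ε`
drops out exactly. The regularized part is integrable and needs no principal value. -/
theorem hasCauchyPV_polylogKernel (p : ℕ) {t : ℝ} (ht : t ∈ Ioo (0 : ℝ) 1) :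
    HasCauchyPV (polylogKernel p (1 / t)) 0 t 1
      (Real.log t ^ (p - 1) * (Real.log t - Real.log (1 - t)) +
        ∫ y in Ioo (0 : ℝ) 1, regKernel 1 t (p - 1) y) := by
  have ht0 := ht.1
  have ht1 := ht.2
  have hf : polylogKernel p (1 / t) = fun y => regKernel 1 t (p - 1) y +
      Real.log t ^ (p - 1) * (1 / (t - y)) := by
    funext y
    rw [polylogKernel_div p ht.1.ne' y, one_mul]
  have hreg : IntervalIntegrable (regKernel 1 t (p - 1)) volume 0 1 := by
    rw [intervalIntegrable_iff_integrableOn_Ioo_of_le zero_le_one]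
    exact integrableOn_regKernel (Or.inl rfl) ht _
  have hev : ∀ᶠ ε : ℝ in 𝓝[>] 0, ε ∈ Ioo 0 (min t (1 - t)) :=
    Ioo_mem_nhdsGT (lt_min ht.1 (by linarith))
  have hpieces : ∀ ε ∈ Ioo 0 (min t (1 - t)),
      (IntervalIntegrable (regKernel 1 t (p - 1)) volume 0 (t - ε) ∧
        IntervalIntegrable (regKernel 1 t (p - 1)) volume (t + ε) 1) ∧
      (IntervalIntegrable (fun y => 1 / (t - y)) volume 0 (t - ε) ∧
        ∫ y in (0 : ℝ)..(t - ε), 1 / (t - y) = Real.log (t - 0) - Real.log (t - (t - ε))) ∧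
      (IntervalIntegrable (fun y => 1 / (t - y)) volume (t + ε) 1 ∧
        ∫ y in (t + ε)..(1 : ℝ), 1 / (t - y) = Real.log (t - (t + ε)) - Real.log (t - 1)) := by
    intro ε hε
    have h1 := hε.1
    have h2 := hε.2.trans_le (min_le_left _ _)
    have h3 := hε.2.trans_le (min_le_right _ _)
    refine ⟨⟨hreg.mono_set ?_, hreg.mono_set ?_⟩, integral_inv_sub ?_, integral_inv_sub ?_⟩
    · rw [Set.uIcc_of_le (by linarith), Set.uIcc_of_le zero_le_one]
      exact Set.Icc_subset_Icc le_rfl (by linarith)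
    · rw [Set.uIcc_of_le (by linarith), Set.uIcc_of_le zero_le_one]
      exact Set.Icc_subset_Icc (by linarith) le_rfl
    · rw [Set.uIcc_of_le (by linarith)]
      intro y hy
      have := hy.2
      exact (by linarith : 0 < t - y).ne'
    · rw [Set.uIcc_of_le (by linarith)]
      intro y hy
      have := hy.1
      exact (by linarith : t - y < 0).ne
  refine ⟨?_, ?_⟩
  · filter_upwards [hev] with ε hε
    obtain ⟨⟨h1, h2⟩, ⟨h3, -⟩, h4, -⟩ := hpieces ε hε
    rw [hf]
    exact ⟨h1.add (h3.const_mul _), h2.add (h4.const_mul _)⟩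
  · have hcont : ContinuousOn (fun x => ∫ y in (0 : ℝ)..x, regKernel 1 t (p - 1) y)
        (Set.uIcc 0 1) :=
      intervalIntegral.continuousOn_primitive_interval
        ((intervalIntegrable_iff' (by simp)).1 hreg)
    have hct : ContinuousAt (fun x => ∫ y in (0 : ℝ)..x, regKernel 1 t (p - 1) y) t :=
      hcont.continuousAt (by rw [Set.uIcc_of_le zero_le_one]; exact Icc_mem_nhds ht.1 ht.2)
    have hl1 : Tendsto (fun ε : ℝ => t - ε) (𝓝[>] 0) (𝓝 t) := by
      have : Tendsto (fun ε : ℝ => t - ε) (𝓝 0) (𝓝 (t - 0)) := by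
        exact (continuous_const.sub continuous_id).tendsto _
      rw [sub_zero] at this
      exact this.mono_left nhdsWithin_le_nhds
    have hl2 : Tendsto (fun ε : ℝ => t + ε) (𝓝[>] 0) (𝓝 t) := by
      have : Tendsto (fun ε : ℝ => t + ε) (𝓝 0) (𝓝 (t + 0)) := by
        exact (continuous_const.add continuous_id).tendsto _
      rw [add_zero] at this
      exact this.mono_left nhdsWithin_le_nhds
    have hlim := (((hct.tendsto.comp hl1).sub (hct.tendsto.comp hl2)).add_const
      (∫ y in (0 : ℝ)..1, regKernel 1 t (p - 1) y)).add_const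
      (Real.log t ^ (p - 1) * (Real.log t - Real.log (1 - t)))
    rw [sub_self, zero_add, intervalIntegral.integral_of_le zero_le_one,
      integral_Ioc_eq_integral_Ioo, add_comm] at hlim
    refine hlim.congr' ?_
    filter_upwards [hev] with ε hε
    obtain ⟨⟨h1, h2⟩, ⟨h3, e3⟩, h4, e4⟩ := hpieces ε hε
    have h5 : IntervalIntegrable (regKernel 1 t (p - 1)) volume 0 (t + ε) := by
      have h6 := hε.1
      have h7 := hε.2.trans_le (min_le_right _ _)
      refine hreg.mono_set ?_
      rw [Set.uIcc_of_le (by linarith), Set.uIcc_of_le zero_le_one]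
      exact Set.Icc_subset_Icc le_rfl (by linarith)
    rw [hf, intervalIntegral.integral_add h1 (h3.const_mul _),
      intervalIntegral.integral_add h2 (h4.const_mul _), intervalIntegral.integral_const_mul,
      intervalIntegral.integral_const_mul, e3, e4]
    have h6 := intervalIntegral.integral_add_adjacent_intervals h5 h2
    rw [intervalIntegral.integral_of_le zero_le_one, integral_Ioc_eq_integral_Ioo] at h6
    simp only [Function.comp_apply]
    rw [show t - (t + ε) = -ε by ring, show t - 1 = -(1 - t) by ring, Real.log_neg_eq_log,
      Real.log_neg_eq_log, show t - (t - ε) = ε by ring, sub_zero]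
    linear_combination -h6

theorem exists_hasCauchyPV_polylogKernel (p : ℕ) {z : ℝ} (hz : 1 < z) :
    ∃ I, HasCauchyPV (polylogKernel p z) 0 (1 / z) 1 I := by
  have h0 : 0 < z := by linarith
  have := hasCauchyPV_polylogKernel p (t := 1 / z)
    ⟨by positivity, by rw [div_lt_one h0]; exact hz⟩
  rw [one_div_one_div] at this
  exact ⟨_, this⟩

/-- `Li_p` outside the unit disc through the regularized kernel. -/
theorem polylog_div {b t : ℝ} (hb : b = 1 ∨ b = -1) (ht : t ∈ Ioo (0 : ℝ) 1) (p : ℕ) :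
    polylog p (b / t) = (-1) ^ (p - 1) / (Nat.factorial (p - 1) : ℝ) *
      (Real.log t ^ (p - 1) * (Real.log t - Real.log (1 - b * t)) +
        ∫ y in Ioo (0 : ℝ) 1, regKernel b t (p - 1) y) := by
  have ht0 := ht.1
  have ht1 := ht.2
  rw [polylog]
  congr 1
  rcases hb with rfl | rfl
  · have : 1 < 1 / t := by rw [lt_div_iff₀ ht.1, one_mul]; exact ht.2
    rw [if_neg (not_le.2 this), one_div_one_div, one_mul]
    exact (hasCauchyPV_polylogKernel p ht).cauchyPV_eq
  · have : -1 / t ≤ 1 := by rw [div_le_one ht.1]; linarith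
    rw [if_pos this]
    have h1 : IntervalIntegrable (regKernel (-1) t (p - 1)) volume 0 1 := by
      rw [intervalIntegrable_iff_integrableOn_Ioo_of_le zero_le_one]
      exact integrableOn_regKernel (Or.inr rfl) ht _
    have h0 : ∀ y ∈ Set.uIcc (0 : ℝ) 1, -t - y ≠ 0 := by
      rw [Set.uIcc_of_le zero_le_one]
      intro y hy
      have := hy.1
      exact (by linarith : -t - y < 0).ne
    obtain ⟨h2, h3⟩ := integral_inv_sub h0
    have hf : polylogKernel p (-1 / t) = fun y => regKernel (-1) t (p - 1) y +
        Real.log t ^ (p - 1) * (1 / (-t - y)) := by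
      funext y
      rw [polylogKernel_div p ht.1.ne' y]
      congr 2
      rw [show t - -1 * y = -(-t - y) by ring, neg_div_neg_eq]
    rw [hf, intervalIntegral.integral_add h1 (h2.const_mul _), intervalIntegral.integral_const_mul,
      h3, intervalIntegral.integral_of_le zero_le_one, integral_Ioc_eq_integral_Ioo, sub_zero,
      Real.log_neg_eq_log, show -t - 1 = -(1 - -1 * t) by ring, Real.log_neg_eq_log]
    ring

/-! ### The inversion formula for the polylogarithm. -/

theorem setIntegral_Ioo_comp_mul (f : ℝ → ℝ) {t : ℝ} (ht : 0 < t) :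
    ∫ y in Ioo 0 t, f y = ∫ u in Ioo (0 : ℝ) 1, t * f (t * u) := by
  have himg : (fun u => t * u) '' Ioo (0 : ℝ) 1 = Ioo 0 t := by
    rw [Set.image_mul_left_Ioo ht, mul_zero, mul_one]
  rw [← himg, integral_image_eq_integral_abs_deriv_smul (f' := fun _ => t) measurableSet_Ioo
    (fun x _ => by simpa using ((hasDerivAt_id x).const_mul t).hasDerivWithinAt)
    (fun x _ y _ h => mul_left_cancel₀ ht.ne' h)]
  simp [abs_of_pos ht]

theorem image_div_Ioo {t : ℝ} (ht : t ∈ Ioo (0 : ℝ) 1) :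
    (fun v => t / v) '' Ioo t 1 = Ioo t 1 := by
  have ht0 := ht.1
  have hmaps : ∀ v ∈ Ioo t 1, t / v ∈ Ioo t 1 := by
    intro v hv
    have hv0 : 0 < v := ht0.trans hv.1
    exact ⟨by rw [lt_div_iff₀ hv0]; nlinarith [hv.2], by rw [div_lt_one hv0]; exact hv.1⟩
  refine Set.Subset.antisymm (Set.image_subset_iff.2 hmaps) fun v hv => ?_
  have hv0 : 0 < v := ht0.trans hv.1
  exact ⟨t / v, hmaps v hv, by field_simp⟩

theorem hasDerivWithinAt_const_div {t : ℝ} (ht : t ∈ Ioo (0 : ℝ) 1) :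
    ∀ v ∈ Ioo t 1, HasDerivWithinAt (fun v => t / v) (-t / v ^ 2) (Ioo t 1) v := by
  intro v hv
  have hv0 : 0 < v := ht.1.trans hv.1
  have := ((hasDerivAt_inv hv0.ne').const_mul t).hasDerivWithinAt (s := Ioo t 1)
  refine (HasDerivWithinAt.congr_deriv (f := fun v => t / v) this ?_)
  field_simp

theorem injOn_const_div {t : ℝ} (ht : t ∈ Ioo (0 : ℝ) 1) :
    Set.InjOn (fun v => t / v) (Ioo t 1) := by
  intro x hx y hy h
  have hx0 : 0 < x := ht.1.trans hx.1
  have hy0 : 0 < y := ht.1.trans hy.1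
  have h : t / x = t / y := h
  have := ht.1
  field_simp at h
  exact h.symm

theorem setIntegral_Ioo_comp_div (f : ℝ → ℝ) {t : ℝ} (ht : t ∈ Ioo (0 : ℝ) 1) :
    ∫ y in Ioo t 1, f y = ∫ v in Ioo t 1, t / v ^ 2 * f (t / v) := by
  conv_lhs => rw [← image_div_Ioo ht]
  rw [integral_image_eq_integral_abs_deriv_smul measurableSet_Ioo
    (hasDerivWithinAt_const_div ht) (injOn_const_div ht)]
  refine setIntegral_congr_fun measurableSet_Ioo fun v hv => ?_
  have := ht.1
  simp only [smul_eq_mul]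
  rw [neg_div, abs_neg, abs_of_nonneg (by positivity)]

theorem setIntegral_Ioo_split {f : ℝ → ℝ} (hf : IntegrableOn f (Ioo 0 1)) {t : ℝ}
    (ht : t ∈ Ioo (0 : ℝ) 1) :
    ∫ y in Ioo 0 1, f y = (∫ y in Ioo 0 t, f y) + ∫ y in Ioo t 1, f y := by
  have h1 : IntervalIntegrable f volume 0 1 := by
    rwa [intervalIntegrable_iff_integrableOn_Ioo_of_le zero_le_one]
  have h2 : IntervalIntegrable f volume 0 t := by
    rw [intervalIntegrable_iff_integrableOn_Ioo_of_le ht.1.le]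
    exact hf.mono_set (Set.Ioo_subset_Ioo le_rfl ht.2.le)
  have h3 : IntervalIntegrable f volume t 1 := by
    rw [intervalIntegrable_iff_integrableOn_Ioo_of_le ht.2.le]
    exact hf.mono_set (Set.Ioo_subset_Ioo ht.1.le le_rfl)
  have := intervalIntegral.integral_add_adjacent_intervals h2 h3
  rw [intervalIntegral.integral_of_le zero_le_one, intervalIntegral.integral_of_le ht.1.le,
    intervalIntegral.integral_of_le ht.2.le] at this
  simp only [integral_Ioc_eq_integral_Ioo] at this
  exact this.symm

theorem sq_eq_one {b : ℝ} (hb : b = 1 ∨ b = -1) : b * b = 1 := by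
  rcases hb with rfl | rfl <;> norm_num

theorem abs_eq_one' {b : ℝ} (hb : b = 1 ∨ b = -1) : |b| = 1 := by
  rcases hb with rfl | rfl <;> norm_num

/-- The integrands `b ((L ± log v) ^ m - L ^ m) / (1 - b v)` obtained from `regKernel` by the
substitutions `y = t v` and `y = t / v`. -/
noncomputable def diffKernel (b s L : ℝ) (m : ℕ) (v : ℝ) : ℝ :=
  b * ((L + s * Real.log v) ^ m - L ^ m) / (1 - b * v)

theorem scale_regKernel {b t : ℝ} (ht : t ∈ Ioo (0 : ℝ) 1) (m : ℕ) {u : ℝ}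
    (hu : u ∈ Ioo (0 : ℝ) 1) :
    t * regKernel b t m (t * u) = diffKernel b 1 (Real.log t) m u := by
  have := ht.1.ne'
  rw [regKernel, diffKernel, Real.log_mul ht.1.ne' hu.1.ne', one_mul,
    show t - b * (t * u) = t * (1 - b * u) by ring, ← mul_div_assoc, mul_div_mul_left _ _ this]

/-- The map `y = t / v` preserves `(t, 1)`. Since `b² = 1`, the new kernel is `-1 / (v (1 - b v)) =
-1 / v - b / (1 - b v)`, which separates an elementary term from `diffKernel`. -/
theorem flip_regKernel {b t : ℝ} (hb : b = 1 ∨ b = -1) (ht : t ∈ Ioo (0 : ℝ) 1) (m : ℕ) {v : ℝ}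
    (hv : v ∈ Ioo t 1) :
    t / v ^ 2 * regKernel b t m (t / v) =
      -(((Real.log t - Real.log v) ^ m - Real.log t ^ m) / v) -
      diffKernel b (-1) (Real.log t) m v := by
  have hv0 : 0 < v := ht.1.trans hv.1
  have ht0 := ht.1
  have h1 := one_sub_mul_pos (abs_eq_one' hb).le (⟨hv0, hv.2⟩ : v ∈ Ioo (0 : ℝ) 1)
  have h4 := sq_eq_one hb
  have hb0 : b ≠ 0 := by rintro rfl; simp at h4
  rw [regKernel, diffKernel, Real.log_div ht.1.ne' hv0.ne',
    show Real.log t + -1 * Real.log v = Real.log t - Real.log v by ring]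
  generalize (Real.log t - Real.log v) ^ m - Real.log t ^ m = X
  have h3 : t - b * (t / v) = -(b * t * (1 - b * v)) / v := by
    rw [eq_div_iff hv0.ne']
    field_simp
    linear_combination (-v) * h4
  have h5 : b * v = 1 - (1 - b * v) := by ring
  rw [h3]
  generalize hd : 1 - b * v = d at *
  field_simp
  linear_combination X * h5

theorem sum_Icc_zero_eq (f : ℕ → ℝ) (p : ℕ) :
    ∑ k ∈ Icc 0 p, f k = f 0 + ∑ k ∈ Icc 1 p, f k := by
  induction p with
  | zero => simp
  | succ p ih => rw [sum_Icc_succ_top (by omega), ih, sum_Icc_succ_top (by omega), add_assoc]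

theorem sum_Icc_one_succ (f : ℕ → ℝ) (p : ℕ) :
    ∑ k ∈ Icc 1 (p + 1), f k = f 1 + ∑ k ∈ Icc 1 p, f (k + 1) := by
  induction p with
  | zero => simp
  | succ p ih => rw [sum_Icc_succ_top (by omega), ih, sum_Icc_succ_top (by omega), add_assoc]

/-- Subtracting `L ^ m` removes the term `e = 0` of the binomial expansion, the only one not
integrable for `b = 1`. -/
theorem diffKernel_eq_sum (b s L : ℝ) (m : ℕ) (v : ℝ) :
    diffKernel b s L m v = ∑ e ∈ Icc 1 m, b * (m.choose e : ℝ) * L ^ (m - e) * s ^ e *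
      (v ^ 0 * (Real.log v ^ e / (1 - b * v))) := by
  have h : (L + s * Real.log v) ^ m - L ^ m =
      ∑ e ∈ Icc 1 m, (s * Real.log v) ^ e * L ^ (m - e) * (m.choose e : ℝ) := by
    rw [add_comm L, add_pow, Nat.range_succ_eq_Icc_zero, sum_Icc_zero_eq]
    simp
  rw [diffKernel, h, mul_sum, sum_div]
  refine sum_congr rfl fun e _ => ?_
  rw [mul_pow]
  ring

theorem lerchConv_succ {b : ℝ} (hb : b = 1 ∨ b = -1) {e : ℕ} (he : 1 ≤ e) :
    LerchConv b (e + 1) :=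
  ⟨by omega, hb.imp (fun h => ⟨h, by omega⟩) id⟩

theorem integrableOn_diffKernel {b : ℝ} (hb : b = 1 ∨ b = -1) (s L : ℝ) (m : ℕ) :
    IntegrableOn (diffKernel b s L m) (Ioo 0 1) := by
  rw [funext (diffKernel_eq_sum b s L m)]
  refine integrable_finsetSum _ fun e he => ?_
  exact (integrableOn_pow_mul_kernel (lerchConv_succ hb (mem_Icc.1 he).1) 0).const_mul _

theorem integral_diffKernel {b : ℝ} (hb : b = 1 ∨ b = -1) (s L : ℝ) (m : ℕ) :
    ∫ v in Ioo 0 1, diffKernel b s L m v = ∑ e ∈ Icc 1 m, b * (m.choose e : ℝ) * L ^ (m - e) *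
      s ^ e * ((-1) ^ e * (e.factorial : ℝ) * lerch b (e + 1) 1) := by
  rw [funext (diffKernel_eq_sum b s L m), integral_finsetSum]
  · refine sum_congr rfl fun e he => ?_
    rw [integral_const_mul, integral_pow_mul_kernel (lerchConv_succ hb (mem_Icc.1 he).1)]
    simp
  · intro e he
    exact (integrableOn_pow_mul_kernel (lerchConv_succ hb (mem_Icc.1 he).1) 0).const_mul _

/-- `Li_p` inside the unit disc, in the variable of the substituted kernels. -/
theorem integral_diffKernel_Ioo {b t : ℝ} (hb : b = 1 ∨ b = -1) (ht : t ∈ Ioo (0 : ℝ) 1) (p : ℕ) :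
    ∫ v in Ioo 0 t, diffKernel b (-1) (Real.log t) (p - 1) v =
      (Nat.factorial (p - 1) : ℝ) * polylog p (b * t) +
        Real.log t ^ (p - 1) * Real.log (1 - b * t) := by
  have ht0 := ht.1
  set L := Real.log t
  set m := p - 1 with hm
  have hbt : |b * t| < 1 := by
    have := abs_mul_pow_lt_one (abs_eq_one' hb) le_rfl ht
    rwa [pow_one] at this
  have hf : (m.factorial : ℝ) ≠ 0 := by exact_mod_cast Nat.factorial_ne_zero _
  have hs : ((-1 : ℝ) ^ m) * (-1) ^ m = 1 := by rw [← mul_pow]; norm_num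
  have h1 : (m.factorial : ℝ) * polylog p (b * t) =
      ∫ u in Ioo (0 : ℝ) 1, (-1) ^ m * polylogKernel p (b * t) u := by
    rw [integral_const_mul, polylog, if_pos ((le_abs_self _).trans hbt.le),
      intervalIntegral.integral_of_le zero_le_one, integral_Ioc_eq_integral_Ioo]
    field_simp
    rw [← hm]
    ring
  have hne : ∀ y ∈ Set.uIcc 0 t, 0 < 1 - b * y := by
    rw [Set.uIcc_of_le ht.1.le]
    intro y hy
    have := abs_le.1 (abs_eq_one' hb).le
    nlinarith [hy.1, hy.2, ht.2]
  have hcont : ContinuousOn (fun y : ℝ => b / (1 - b * y)) (Set.uIcc 0 t) :=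
    continuousOn_const.div (by fun_prop) fun y hy => (hne y hy).ne'
  have h2 : ∫ y in (0 : ℝ)..t, b / (1 - b * y) = -Real.log (1 - b * t) := by
    rw [intervalIntegral.integral_eq_sub_of_hasDerivAt (f := fun y => -Real.log (1 - b * y))
      (fun y hy => ?_) hcont.intervalIntegrable]
    · simp
    · have := ((((hasDerivAt_id y).const_mul b).const_sub 1).log (hne y hy).ne').neg
      simpa [neg_div] using! this
  have h3 : ∫ u in Ioo (0 : ℝ) 1, t * (b / (1 - b * (t * u))) = -Real.log (1 - b * t) := by
    rw [← setIntegral_Ioo_comp_mul (fun y => b / (1 - b * y)) ht.1, ← h2,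
      intervalIntegral.integral_of_le ht.1.le, integral_Ioc_eq_integral_Ioo]
  have h4 : IntegrableOn (fun u => t * (b / (1 - b * (t * u)))) (Ioo 0 1) := by
    have hc : ContinuousOn (fun u : ℝ => t * (b / (1 - b * (t * u)))) (Set.uIcc 0 1) := by
      refine continuousOn_const.mul (continuousOn_const.div (by fun_prop) fun u hu => ?_)
      rw [Set.uIcc_of_le zero_le_one] at hu
      refine (hne (t * u) ?_).ne'
      rw [Set.uIcc_of_le ht.1.le]
      exact ⟨mul_nonneg ht.1.le hu.1, mul_le_of_le_one_right ht.1.le hu.2⟩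
    have := hc.intervalIntegrable (μ := volume)
    rwa [intervalIntegrable_iff_integrableOn_Ioo_of_le zero_le_one] at this
  rw [h1, setIntegral_Ioo_comp_mul _ ht.1]
  -- At `v = t u` one has `L - log v = -log u`, so the power of the logarithm becomes that of the
  -- kernel of `Li_p(b t)`.
  have h5 : ∀ u ∈ Ioo (0 : ℝ) 1, t * diffKernel b (-1) L m (t * u) =
      (-1) ^ m * polylogKernel p (b * t) u - L ^ m * (t * (b / (1 - b * (t * u)))) := by
    intro u hu
    rw [diffKernel, polylogKernel, Real.log_mul ht.1.ne' hu.1.ne', ← hm,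
      show L + -1 * (Real.log t + Real.log u) = -Real.log u by simp only [L]; ring,
      neg_pow (Real.log u), mul_assoc b t u]
    ring
  rw [setIntegral_congr_fun measurableSet_Ioo h5,
    integral_sub ((integrableOn_polylogKernel_of_lt hbt).const_mul _) (h4.const_mul _),
    integral_const_mul (L ^ m), h3]
  ring

theorem integral_log_sub_pow_div {t : ℝ} (ht : t ∈ Ioo (0 : ℝ) 1) (m : ℕ) :
    IntegrableOn (fun v => ((Real.log t - Real.log v) ^ m - Real.log t ^ m) / v) (Ioo t 1) ∧
    ∫ v in Ioo t 1, ((Real.log t - Real.log v) ^ m - Real.log t ^ m) / v =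
      Real.log t ^ (m + 1) - Real.log t ^ (m + 1) / (m + 1) := by
  have hm : (m : ℝ) + 1 ≠ 0 := by positivity
  have hne : ∀ v ∈ Set.uIcc t 1, v ≠ 0 := by
    rw [Set.uIcc_of_le ht.2.le]
    intro v hv
    exact (ht.1.trans_le hv.1).ne'
  have hc : ContinuousOn (fun v => ((Real.log t - Real.log v) ^ m - Real.log t ^ m) / v)
      (Set.uIcc t 1) := by
    refine ContinuousOn.div ?_ continuousOn_id hne
    exact ((continuousOn_const.sub (Real.continuousOn_log.mono hne)).pow m).sub continuousOn_const
  refine ⟨?_, ?_⟩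
  · have := hc.intervalIntegrable (μ := volume)
    rwa [intervalIntegrable_iff_integrableOn_Ioo_of_le ht.2.le] at this
  · rw [← integral_Ioc_eq_integral_Ioo, ← intervalIntegral.integral_of_le ht.2.le,
      intervalIntegral.integral_eq_sub_of_hasDerivAt (f := fun v =>
        -((Real.log t - Real.log v) ^ (m + 1) / (m + 1)) - Real.log t ^ m * Real.log v)
        (fun v hv => ?_) hc.intervalIntegrable]
    · simp
      ring
    · have h1 := Real.hasDerivAt_log (hne v hv)
      have h2 := ((((h1.const_sub (Real.log t)).pow (m + 1)).div_const ((m : ℝ) + 1)).neg).sub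
        (h1.const_mul (Real.log t ^ m))
      refine HasDerivAt.congr_deriv (f := fun v =>
        -((Real.log t - Real.log v) ^ (m + 1) / (m + 1)) - Real.log t ^ m * Real.log v) h2 ?_
      have := hne v hv
      simp only [Nat.add_sub_cancel]
      push_cast
      field_simp

/-- The integral is cut at `t`, with `y = t u` below and `y = t / v` above. The second piece covers
only `(t, 1)`; completing it to `(0, 1)` brings in `Li_p(b t)`. -/
theorem integral_regKernel {b t : ℝ} (hb : b = 1 ∨ b = -1) (ht : t ∈ Ioo (0 : ℝ) 1) (p : ℕ) :
    ∫ y in Ioo 0 1, regKernel b t (p - 1) y =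
      (∫ v in Ioo 0 1, diffKernel b 1 (Real.log t) (p - 1) v) -
      (∫ v in Ioo 0 1, diffKernel b (-1) (Real.log t) (p - 1) v) +
      ((Nat.factorial (p - 1) : ℝ) * polylog p (b * t) +
        Real.log t ^ (p - 1) * Real.log (1 - b * t)) -
      (Real.log t ^ (p - 1 + 1) - Real.log t ^ (p - 1 + 1) / ((p - 1 : ℕ) + 1)) := by
  rw [setIntegral_Ioo_split (integrableOn_regKernel hb ht _) ht, setIntegral_Ioo_comp_mul _ ht.1,
    setIntegral_congr_fun measurableSet_Ioo (fun u hu => scale_regKernel ht (p - 1) hu),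
    setIntegral_Ioo_comp_div _ ht,
    setIntegral_congr_fun measurableSet_Ioo (fun u hu => flip_regKernel hb ht (p - 1) hu)]
  obtain ⟨h1, h2⟩ := integral_log_sub_pow_div ht (p - 1)
  have h3 := integrableOn_diffKernel hb (-1) (Real.log t) (p - 1)
  have h5 := integral_sub (h1.const_mul (-1)) (h3.mono_set (Set.Ioo_subset_Ioo ht.1.le le_rfl))
  rw [integral_const_mul, h2] at h5
  simp only [neg_one_mul] at h5
  rw [h5]
  have h4 := setIntegral_Ioo_split h3 ht
  rw [integral_diffKernel_Ioo hb ht] at h4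
  linear_combination h4

theorem sum_even_terms (p : ℕ) (x : ℕ → ℝ) :
    ∑ i ∈ Icc 1 p, (1 + (-1) ^ i) * x i = 2 * ∑ k ∈ Icc 1 (p / 2), x (2 * k) := by
  induction p with
  | zero => simp
  | succ p ih =>
    rw [sum_Icc_succ_top (by omega), ih]
    rcases Nat.even_or_odd (p + 1) with h | h
    · obtain ⟨k, hk⟩ := h
      have h1 : p / 2 = k - 1 := by omega
      have h2 : (p + 1) / 2 = (k - 1) + 1 := by omega
      rw [h2, h1, sum_Icc_succ_top (by omega), Even.neg_one_pow ⟨k, hk⟩,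
        show 2 * (k - 1 + 1) = p + 1 by omega]
      ring
    · have h2 : (p + 1) / 2 = p / 2 := by obtain ⟨k, hk⟩ := h; omega
      rw [h2, h.neg_one_pow]
      ring

/-- The inversion formula for the polylogarithm. -/
theorem polylog_inversion {b t : ℝ} (hb : b = 1 ∨ b = -1) (ht : t ∈ Ioo (0 : ℝ) 1) {p : ℕ}
    (hp : 1 ≤ p) :
    polylog p (b / t) = (-1) ^ p * (2 * b * ∑ k ∈ Icc 0 (p / 2),
      lerch b (2 * k) 1 * (Real.log t ^ (p - 2 * k) / ((p - 2 * k).factorial : ℝ)) -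
        polylog p (b * t)) := by
  rw [polylog_div hb ht, integral_regKernel hb ht, integral_diffKernel hb, integral_diffKernel hb]
  obtain ⟨m, rfl⟩ : ∃ m, p = m + 1 := ⟨p - 1, by omega⟩
  simp only [Nat.add_sub_cancel]
  have hf : (m.factorial : ℝ) ≠ 0 := by exact_mod_cast Nat.factorial_ne_zero _
  -- The two sums differ by the sign `(-1) ^ e`, so only odd `e` survive, that is, Lerch values of
  -- even order `e + 1 = 2 k`.
  have hX : (∑ e ∈ Icc 1 m, b * (m.choose e : ℝ) * Real.log t ^ (m - e) * 1 ^ e *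
        ((-1) ^ e * (e.factorial : ℝ) * lerch b (e + 1) 1)) -
      (∑ e ∈ Icc 1 m, b * (m.choose e : ℝ) * Real.log t ^ (m - e) * (-1) ^ e *
        ((-1) ^ e * (e.factorial : ℝ) * lerch b (e + 1) 1)) =
      -(m.factorial : ℝ) * (2 * b * ∑ k ∈ Icc 1 ((m + 1) / 2), lerch b (2 * k) 1 *
        (Real.log t ^ (m + 1 - 2 * k) / ((m + 1 - 2 * k).factorial : ℝ))) := by
    have h1 := sum_even_terms (m + 1) fun i => lerch b i 1 *
        (Real.log t ^ (m + 1 - i) / ((m + 1 - i).factorial : ℝ))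
    rw [mul_comm 2 b, mul_assoc, ← h1, sum_Icc_one_succ, ← sum_sub_distrib, pow_one, add_neg_cancel,
      zero_mul, zero_add, mul_sum, mul_sum]
    refine sum_congr rfl fun e he => ?_
    have hc : (m.choose e : ℝ) * e.factorial = m.factorial / ((m - e).factorial : ℝ) := by
      rw [eq_div_iff (by exact_mod_cast Nat.factorial_ne_zero _)]
      exact_mod_cast Nat.choose_mul_factorial_mul_factorial (mem_Icc.1 he).2
    have hs : ((-1 : ℝ) ^ e) * (-1) ^ e = 1 := by rw [← mul_pow]; norm_num
    rw [Nat.add_sub_add_right, one_pow]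
    linear_combination (b * Real.log t ^ (m - e) * lerch b (e + 1) 1) * (((-1) ^ e - 1) * hc -
      (m.choose e : ℝ) * e.factorial * hs)
  -- This lets the elementary leftover `-log ^ p t / p!` be absorbed as the summand `k = 0`.
  have h0 : 2 * b * lerch b 0 1 = -1 := by
    rcases hb with rfl | rfl <;> norm_num [lerch]
  rw [sum_Icc_zero_eq, hX, mul_zero, Nat.sub_zero, Nat.factorial_succ]
  push_cast
  field_simp
  rw [pow_succ (-1 : ℝ) m]
  linear_combination ((-1) ^ m) * Real.log t ^ (m + 1) * h0

/-! ### Partial fractions. -/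

/-- The part of the partial fraction expansion of `A ^ p M ^ q` in powers of `A`, where
`A M = r (A + μ M)`. -/
def fracSum (μ r A : ℝ) (p q : ℕ) : ℝ :=
  ∑ j ∈ range p, ((q + j - 1).choose j : ℝ) * μ ^ j * r ^ (q + j) * A ^ (p - j)

/-- Pascal's rule for the coefficients. For `q = 0` the truncated `q + j - 1` leaves only the
coefficient at `j = 0`, equal to `1`. -/
theorem fracSum_succ (μ r A : ℝ) (p q : ℕ) :
    fracSum μ r A (p + 1) (q + 1) = r * (fracSum μ r A (p + 1) q + μ * fracSum μ r A p (q + 1)) := by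
  have hch : ∀ j, ((q + 1 + (j + 1) - 1).choose (j + 1) : ℝ) =
      ((q + 1 + j - 1).choose j : ℝ) + ((q + (j + 1) - 1).choose (j + 1) : ℝ) := by
    intro j
    rw [show q + 1 + (j + 1) - 1 = (q + j) + 1 by omega, Nat.choose_succ_succ,
      show q + 1 + j - 1 = q + j by omega, show q + (j + 1) - 1 = q + j by omega]
    push_cast
    ring
  simp only [fracSum]
  rw [sum_range_succ', sum_range_succ' _ p,
    mul_sum (range p) (fun j => ((q + 1 + j - 1).choose j : ℝ) * μ ^ j * r ^ (q + 1 + j) *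
      A ^ (p - j)) μ, add_right_comm (∑ j ∈ range p, _) (_ : ℝ) (∑ j ∈ range p, _),
    ← sum_add_distrib, mul_add, mul_sum]
  congr 1
  · refine sum_congr rfl fun j hj => ?_
    rw [hch, show p + 1 - (j + 1) = p - j by omega]
    ring
  · simp
    ring

/-- Double induction: one factor `A M` is replaced by `r (A + μ M)`, lowering one exponent in each
summand. It is applied to `A = 1 / k`, `M = 1 / (l + n k)`, `r = 1 / l`, `μ = -n`. For `p = q = 0`
both sums are empty, so this case is excluded. -/
theorem pow_mul_pow_eq_fracSum {μ r A M : ℝ} (h : A * M = r * (A + μ * M)) (p q : ℕ)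
    (hpq : p + q ≠ 0) :
    A ^ p * M ^ q = fracSum μ r A p q + μ ^ p * fracSum 1 r M q p := by
  induction p generalizing q with
  | zero =>
    obtain ⟨k, rfl⟩ : ∃ k, q = k + 1 := ⟨q - 1, by omega⟩
    simp only [fracSum]
    rw [sum_range_succ']
    simp
  | succ p ihp =>
    induction q with
    | zero =>
      simp only [fracSum]
      rw [sum_range_succ']
      simp
    | succ q ihq =>
      rw [fracSum_succ, fracSum_succ, show A ^ (p + 1) * M ^ (q + 1) = A ^ p * M ^ q * (A * M) by ring,
        h, show A ^ p * M ^ q * (r * (A + μ * M)) =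
          r * (A ^ (p + 1) * M ^ q + μ * (A ^ p * M ^ (q + 1))) by ring,
        ihq (by omega), ihp (q + 1) (by omega)]
      ring

theorem sum_range_sub_eq_sum_Icc (f : ℕ → ℝ) (p : ℕ) :
    ∑ j ∈ range p, f (p - j) = ∑ i ∈ Icc 1 p, f i := by
  induction p with
  | zero => simp
  | succ p ih =>
    rw [sum_range_succ', sum_Icc_succ_top (by omega), ← ih]
    simp

theorem fracSum_eq_sum_Icc (μ r A : ℝ) (p : ℕ) {q : ℕ} (hq : 1 ≤ q) :
    fracSum μ r A p q = ∑ i ∈ Icc 1 p,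
      ((p + q - i - 1).choose (q - 1) : ℝ) * μ ^ (p - i) * r ^ (p + q - i) * A ^ i := by
  rw [← sum_range_sub_eq_sum_Icc, fracSum]
  refine sum_congr rfl fun j hj => ?_
  have hj := mem_range.1 hj
  rw [show p + q - (p - j) - 1 = q + j - 1 by omega, show p - (p - j) = j by omega,
    show p + q - (p - j) = q + j by omega, show q + j - 1 = q - 1 + j by omega, Nat.choose_symm_add]

/-- Hockey stick identity. -/
theorem sum_choose_Icc (p : ℕ) {q : ℕ} (hq : 1 ≤ q) :
    ∑ i ∈ Icc 1 p, ((p + q - i - 1).choose (q - 1) : ℝ) = ((p + q - 1).choose q : ℝ) := by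
  rw [← sum_range_sub_eq_sum_Icc (fun i => ((p + q - i - 1).choose (q - 1) : ℝ))]
  have : ∀ j ∈ range p, ((p + q - (p - j) - 1).choose (q - 1) : ℝ) =
      ((q - 1 + j).choose (q - 1) : ℝ) := by
    intro j hj
    have hj := mem_range.1 hj
    rw [show p + q - (p - j) - 1 = q - 1 + j by omega]
  rw [sum_congr rfl this]
  obtain ⟨k, rfl⟩ : ∃ k, q = k + 1 := ⟨q - 1, by omega⟩
  induction p with
  | zero => simp
  | succ p ih =>
    rw [sum_range_succ, ih (fun j hj => by
      have hj := mem_range.1 hj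
      rw [show p + (k + 1) - (p - j) - 1 = k + 1 - 1 + j by omega])]
    rw [show p + 1 + (k + 1) - 1 = (p + k) + 1 by omega, Nat.choose_succ_succ,
      show p + (k + 1) - 1 = p + k by omega, show k + 1 - 1 + p = p + k by omega]
    simp
    ring

/-! ### Bilateral series and their values as `theta`. -/

/-- The pair of terms `± k` of the bilateral series `∑ b ^ k / (l + n k) ^ i`. -/
noncomputable def pairTerm (b : ℝ) (n i : ℕ) (l : ℝ) (k : ℕ) : ℝ :=
  b ^ (k + 1) * (1 / (l + n * ((k : ℝ) + 1)) ^ i + 1 / (l - n * ((k : ℝ) + 1)) ^ i)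

/-- The bilateral series `∑ b ^ k / (l + n k) ^ i` over the integers `k` with `l + n k ≠ 0`, summed
symmetrically. -/
noncomputable def bilatSum (b : ℝ) (n i : ℕ) (l : ℝ) : ℝ := 1 / l ^ i + ∑' k, pairTerm b n i l k

/-- For `i = 1` the leading parts of the two terms cancel, leaving `2 l / (l² - n² k²)`; for `i ≥ 2`
each term is already of order `k ^ (-2)`. -/
theorem summable_pairTerm {b : ℝ} (hb : b = 1 ∨ b = -1) {n : ℕ} (hn : 1 ≤ n) {i : ℕ} (hi : 1 ≤ i)
    {l : ℝ} (hl : 0 ≤ l) : Summable (pairTerm b n i l) := by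
  have h2 : Summable fun k : ℕ => (5 + 4 * l) * (1 / ((k : ℝ) + 1) ^ 2) :=
    (summable_inv_add_pow le_rfl zero_le_one).mul_left _
  refine Summable.of_norm_bounded_eventually_nat h2 ?_
  -- Beyond this threshold `n K - l` is at least `K / 2` and at least `1`.
  have hev : ∀ᶠ k : ℕ in atTop, 2 * l + 2 ≤ (k : ℝ) :=
    tendsto_natCast_atTop_atTop.eventually_ge_atTop _
  filter_upwards [hev] with k hk
  have hn' : (1 : ℝ) ≤ n := by exact_mod_cast hn
  set K : ℝ := (k : ℝ) + 1 with hK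
  have hK0 : 0 < K := by positivity
  have hnK : K ≤ n * K := by nlinarith
  rw [pairTerm, norm_mul, norm_pow, Real.norm_eq_abs, abs_eq_one' hb, one_pow, one_mul,
    Real.norm_eq_abs]
  rcases hi.eq_or_lt with rfl | hi
  · have hlt : 0 < n * K - l := by linarith
    have e : 1 / (l + n * K) ^ 1 + 1 / (l - n * K) ^ 1 = -(2 * l / ((l + n * K) * (n * K - l))) := by
      have h1 : l + n * K ≠ 0 := by positivity
      have h2 : l - n * K ≠ 0 := by linarith
      have h3 := hlt.ne'
      rw [pow_one, pow_one, div_add_div _ _ h1 h2, ← div_neg]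
      rw [div_eq_div_iff (mul_ne_zero h1 h2) (neg_ne_zero.2 (mul_ne_zero h1 h3))]
      ring
    rw [e, abs_neg, abs_of_nonneg (by positivity)]
    calc 2 * l / ((l + n * K) * (n * K - l)) ≤ 2 * l / (K * (K / 2)) := by
          gcongr
          · linarith
          · linarith
      _ = 4 * l * (1 / K ^ 2) := by field_simp; ring
      _ ≤ _ := by gcongr; linarith
  · have h1 : |1 / (l + n * K) ^ i| ≤ 1 / K ^ 2 := by
      rw [abs_of_nonneg (by positivity)]
      have : (1 : ℝ) ≤ l + n * K := by linarith
      gcongr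
      calc K ^ 2 ≤ (l + n * K) ^ 2 := by gcongr; linarith
        _ ≤ _ := pow_le_pow_right₀ this hi
    have h2 : |1 / (l - n * K) ^ i| ≤ 4 * (1 / K ^ 2) := by
      rw [abs_div, abs_one, abs_pow, abs_of_neg (by linarith)]
      have h3 : K / 2 ≤ -(l - n * K) := by linarith
      have : (1 : ℝ) ≤ -(l - n * K) := by linarith
      calc 1 / (-(l - n * K)) ^ i ≤ 1 / (K / 2) ^ 2 := by
            gcongr
            calc (K / 2) ^ 2 ≤ (-(l - n * K)) ^ 2 := by gcongr
              _ ≤ _ := pow_le_pow_right₀ this hi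
        _ = _ := by field_simp; norm_num
    calc _ ≤ _ := abs_add_le _ _
      _ ≤ 1 / K ^ 2 + 4 * (1 / K ^ 2) := add_le_add h1 h2
      _ = 5 * (1 / K ^ 2) := by ring
      _ ≤ _ := by gcongr; linarith

theorem bilatSum_tendsto {b : ℝ} (hb : b = 1 ∨ b = -1) {n : ℕ} (hn : 1 ≤ n) {i : ℕ} (hi : 1 ≤ i)
    {l : ℝ} (hl : 0 ≤ l) :
    Tendsto (fun K => 1 / l ^ i + ∑ k ∈ range K, pairTerm b n i l k) atTop
      (𝓝 (bilatSum b n i l)) :=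
  ((summable_pairTerm hb hn hi hl).hasSum.tendsto_sum_nat).const_add _

/-- Replacing `l` by `l + n` shifts the symmetric window of indices by one: the term `K + 1` enters
and the term `-K` leaves. The factor is `b` because `b⁻¹ = b`. -/
theorem sum_pairTerm_add {b : ℝ} (hb : b = 1 ∨ b = -1) (n i : ℕ) (l : ℝ) (K : ℕ) :
    1 / (l + n) ^ i + ∑ k ∈ range K, pairTerm b n i (l + n) k =
      b * ((1 / l ^ i + ∑ k ∈ range K, pairTerm b n i l k) +
        (b ^ (K + 1) * (1 / (l + n * ((K : ℝ) + 1)) ^ i) - b ^ K * (1 / (l - n * K) ^ i))) := by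
  have hbb := sq_eq_one hb
  induction K with
  | zero =>
    simp
    linear_combination (-1 / (l + n) ^ i) * hbb
  | succ K ih =>
    rw [sum_range_succ, ← add_assoc, ih, sum_range_succ, pairTerm, pairTerm]
    push_cast
    rw [show l + n + n * ((K : ℝ) + 1) = l + n * (K + 1 + 1) by ring,
      show l + n - n * ((K : ℝ) + 1) = l - n * K by ring]
    simp only [pow_succ b]
    generalize 1 / (l + n * ((K : ℝ) + 1 + 1)) ^ i = X
    generalize 1 / (l - n * (K : ℝ)) ^ i = Y
    linear_combination (-(b * b ^ K * X)) * hbb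

theorem tendsto_one_div_affine_pow {n : ℕ} (hn : 1 ≤ n) {i : ℕ} (hi : 1 ≤ i) (l s : ℝ)
    (hs : s = 1 ∨ s = -1) (d : ℝ) :
    Tendsto (fun K : ℕ => 1 / (l + s * (n * ((K : ℝ) + d))) ^ i) atTop (𝓝 0) := by
  have hn' : (0 : ℝ) < n := by exact_mod_cast hn
  have h1 : Tendsto (fun K : ℕ => (n : ℝ) * ((K : ℝ) + d)) atTop atTop :=
    (tendsto_atTop_add_const_right _ _ tendsto_natCast_atTop_atTop).const_mul_atTop hn'
  have h2 : Tendsto (fun K : ℕ => (l + s * (n * ((K : ℝ) + d)))⁻¹) atTop (𝓝 0) := by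
    rcases hs with rfl | rfl
    · simp only [one_mul]
      exact (tendsto_atTop_add_const_left _ l h1).inv_tendsto_atTop
    · simp only [neg_one_mul]
      exact (tendsto_atBot_add_const_left _ l (tendsto_neg_atTop_atBot.comp h1)).inv_tendsto_atBot
  have := h2.pow i
  rw [zero_pow (by omega)] at this
  refine this.congr fun K => ?_
  rw [inv_pow, one_div]

theorem tendsto_pow_mul_zero {b : ℝ} (hb : b = 1 ∨ b = -1) {f : ℕ → ℝ} (g : ℕ → ℕ)
    (hf : Tendsto f atTop (𝓝 0)) : Tendsto (fun K => b ^ (g K) * f K) atTop (𝓝 0) := by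
  rw [tendsto_zero_iff_norm_tendsto_zero] at hf ⊢
  refine hf.congr fun K => ?_
  rw [norm_mul, norm_pow, Real.norm_eq_abs b, abs_eq_one' hb, one_pow, one_mul]

/-- The boundary terms of the shifted window tend to `0`. This quasi-periodicity is what allows sums
over `l` to be split into residue classes modulo `n`. -/
theorem bilatSum_add {b : ℝ} (hb : b = 1 ∨ b = -1) {n : ℕ} (hn : 1 ≤ n) {i : ℕ} (hi : 1 ≤ i)
    {l : ℝ} (hl : 0 ≤ l) : bilatSum b n i (l + n) = b * bilatSum b n i l := by
  have h1 := bilatSum_tendsto hb hn hi (show 0 ≤ l + n by positivity)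
  have h2 := bilatSum_tendsto hb hn hi hl
  have h3 := tendsto_pow_mul_zero hb (fun K => K + 1)
    (tendsto_one_div_affine_pow hn hi l 1 (Or.inl rfl) 1)
  have h4 := tendsto_pow_mul_zero hb (fun K => K)
    (tendsto_one_div_affine_pow hn hi l (-1) (Or.inr rfl) 0)
  have h5 := (h2.add (h3.sub h4)).const_mul b
  rw [sub_zero, add_zero] at h5
  refine tendsto_nhds_unique h1 (h5.congr fun K => ?_)
  rw [sum_pairTerm_add hb]
  simp only [one_mul, neg_one_mul, add_zero, ← sub_eq_add_neg]

theorem one_div_mul_pow (n i : ℕ) (x : ℝ) :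
    1 / (x * n) ^ i = 1 / (n : ℝ) ^ i * (1 / x ^ i) := by
  rw [mul_pow, one_div_mul_one_div, mul_comm]

/-- For `b = i = 1` this is the Mittag-Leffler expansion of the cotangent. Otherwise the halves `k ≥
0` and `k < 0` converge separately and are the two Lerch values in `theta`. -/
theorem bilatSum_eq_theta {b : ℝ} (hb : b = 1 ∨ b = -1) {n : ℕ} (hn : 1 ≤ n) {i : ℕ} (hi : 1 ≤ i)
    {r : ℝ} (hr0 : 0 < r) (hrn : r < n) :
    bilatSum b n i r = 1 / (n : ℝ) ^ i * theta b i r n := by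
  have hn0 : (n : ℝ) ≠ 0 := by positivity
  have hnp : (0 : ℝ) < n := by positivity
  have hlim := bilatSum_tendsto hb hn hi hr0.le
  rw [theta]
  split_ifs with h
  · obtain ⟨rfl, rfl⟩ := h
    set x : ℝ := r / n with hx
    have hx0 : 0 < x := by positivity
    have hx1 : x < 1 := by rw [hx, div_lt_one hnp]; exact hrn
    have hz : (x : ℂ) ∈ Complex.integerComplement := by
      rw [Complex.mem_integerComplement_iff]
      rintro ⟨k, hk⟩
      have hk' : (k : ℝ) = x := by exact_mod_cast hk
      have h1 : (0 : ℤ) < k := by exact_mod_cast (hk' ▸ hx0 : (0 : ℝ) < k)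
      have h2 : k < (1 : ℤ) := by exact_mod_cast (hk' ▸ hx1 : (k : ℝ) < 1)
      omega
    have hcot := cot_series_rep' hz
    have hs := summable_pairTerm (b := 1) (Or.inl rfl) hn le_rfl hr0.le
    have hc2 : ∑' k : ℕ, (1 / ((x : ℂ) - (k + 1)) + 1 / ((x : ℂ) + (k + 1))) =
        ((∑' k : ℕ, (n : ℝ) * pairTerm 1 n 1 r k : ℝ) : ℂ) := by
      rw [Complex.ofReal_tsum]
      refine tsum_congr fun k => ?_
      have e : (n : ℝ) * pairTerm 1 n 1 r k = 1 / (x - (k + 1)) + 1 / (x + (k + 1)) := by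
        rw [pairTerm, one_pow, one_mul, pow_one, pow_one,
          show r + n * ((k : ℝ) + 1) = n * (x + (k + 1)) by rw [hx]; field_simp,
          show r - n * ((k : ℝ) + 1) = n * (x - (k + 1)) by rw [hx]; field_simp,
          ← one_div_mul_one_div, ← one_div_mul_one_div]
        field_simp
        ring
      rw [e]
      push_cast
      rfl
    rw [hc2, tsum_mul_left] at hcot
    have hcot' : Real.pi * Real.cot (Real.pi * x) - 1 / x =
        n * ∑' k, pairTerm 1 n 1 r k := by exact_mod_cast hcot
    rw [bilatSum, pow_one, pow_one, mul_div_assoc, ← hx]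
    have : 1 / r = 1 / n * (1 / x) := by rw [hx]; field_simp
    rw [this]
    generalize Real.cot (Real.pi * x) = X at *
    field_simp
    field_simp at hcot'
    linear_combination -hcot'
  · have hconv : LerchConv b i := by
      refine ⟨hi, ?_⟩
      rcases hb with rfl | rfl
      · left
        refine ⟨rfl, ?_⟩
        by_contra h'
        exact h ⟨rfl, by omega⟩
      · exact Or.inr rfl
    have h1 := (tendsto_add_atTop_iff_nat 1).2 (lerch_tendsto hconv (show 0 ≤ r / n by positivity))
    have h2 := lerch_tendsto hconv (show 0 ≤ (n - r) / n by
      have : 0 ≤ n - r := by linarith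
      positivity)
    have h3 := ((h1.add (h2.const_mul (b * (-1) ^ i))).const_mul (1 / (n : ℝ) ^ i))
    refine tendsto_nhds_unique hlim (h3.congr fun K => ?_)
    rw [sum_range_succ']
    simp only [pairTerm, mul_add, sum_add_distrib]
    have e1 : ∀ k : ℕ, b ^ (k + 1) * (1 / (r + (n * (k : ℝ) + n * 1)) ^ i) =
        1 / (n : ℝ) ^ i * (b ^ (k + 1) / (((k + 1 : ℕ) : ℝ) + r / n) ^ i) := by
      intro k
      rw [show r + (n * (k : ℝ) + n * 1) = (((k + 1 : ℕ) : ℝ) + r / n) * n by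
        push_cast; field_simp; ring, one_div_mul_pow]
      ring
    have e2 : ∀ k : ℕ, b ^ (k + 1) * (1 / (r - (n * (k : ℝ) + n * 1)) ^ i) =
        1 / (n : ℝ) ^ i * (b * (-1) ^ i * (b ^ k / ((k : ℝ) + (n - r) / n) ^ i)) := by
      intro k
      rw [show r - (n * (k : ℝ) + n * 1) = (-1 * ((k : ℝ) + (n - r) / n)) * n by
        field_simp; ring, one_div_mul_pow, mul_pow]
      have : (1 : ℝ) / ((-1) ^ i * ((k : ℝ) + (n - r) / n) ^ i) =
          (-1) ^ i * (1 / ((k : ℝ) + (n - r) / n) ^ i) := by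
        rcases neg_one_pow_eq_or ℝ i with h | h <;> rw [h] <;> simp
      rw [this]
      ring
    have e3 : 1 / r ^ i = 1 / (n : ℝ) ^ i * (b ^ 0 / (((0 : ℕ) : ℝ) + r / n) ^ i) := by
      rw [pow_zero, Nat.cast_zero, zero_add, ← one_div_mul_pow, div_mul_cancel₀ _ hn0]
    rw [sum_congr rfl fun k _ => e1 k, sum_congr rfl fun k _ => e2 k, e3, ← mul_sum, ← mul_sum,
      ← mul_sum]
    ring

/-- The symmetric sum of `b ^ k / k ^ i` over nonzero integers. -/
theorem hasSum_even_pairs {b : ℝ} (hb : b = 1 ∨ b = -1) {i : ℕ} (hi : 1 ≤ i) :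
    HasSum (fun k : ℕ => b ^ (k + 1) * (1 / ((k : ℝ) + 1) ^ i + 1 / (-((k : ℝ) + 1)) ^ i))
      ((1 + (-1) ^ i) * (b * lerch b i 1)) := by
  have e : ∀ k : ℕ, b ^ (k + 1) * (1 / ((k : ℝ) + 1) ^ i + 1 / (-((k : ℝ) + 1)) ^ i) =
      (1 + (-1) ^ i) * (b * (b ^ k / ((k : ℝ) + 1) ^ i)) := by
    intro k
    rw [neg_pow ((k : ℝ) + 1)]
    rcases neg_one_pow_eq_or ℝ i with h | h <;> rw [h] <;> ring
  simp only [e]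
  -- For `i = 1` the pairs cancel and the factor `1 + (-1) ^ i` is `0`, so the meaningless `lerch 1
  -- 1 1` plays no role.
  rcases hi.eq_or_lt with rfl | hi
  · simp
  · exact ((lerch_eq_tsum (abs_eq_one' hb) hi zero_le_one).mul_left b).mul_left _

theorem bilatSum_zero {b : ℝ} (hb : b = 1 ∨ b = -1) {n : ℕ} (hn : 1 ≤ n) {i : ℕ} (hi : 1 ≤ i) :
    bilatSum b n i 0 = 1 / (n : ℝ) ^ i * ((1 + (-1) ^ i) * (b * lerch b i 1)) := by
  have hn0 : (n : ℝ) ≠ 0 := by positivity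
  rw [bilatSum, zero_pow (by omega), div_zero, zero_add,
    ← ((hasSum_even_pairs hb hi).mul_left (1 / (n : ℝ) ^ i)).tsum_eq]
  refine tsum_congr fun k => ?_
  rw [pairTerm, zero_add, zero_sub, show -((n : ℝ) * (k + 1)) = -((k : ℝ) + 1) * n by ring,
    mul_comm (n : ℝ), one_div_mul_pow, one_div_mul_pow]
  ring

/-! ### The sum over all nonzero k for fixed l. -/

/-- The two terms with index `± (k + 1)` of `∑ b ^ k / (k ^ p (l + n k) ^ q)`. -/
noncomputable def mixedTerm (b : ℝ) (n p q : ℕ) (l : ℝ) (k : ℕ) : ℝ :=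
  b ^ (k + 1) * (1 / ((k : ℝ) + 1) ^ p * (1 / (l + n * ((k : ℝ) + 1)) ^ q) +
    1 / (-((k : ℝ) + 1)) ^ p * (1 / (l - n * ((k : ℝ) + 1)) ^ q))

/-- `b ^ (l / n)` on the multiples of `n`, and `0` elsewhere. -/
noncomputable def multInd (b : ℝ) (n l : ℕ) : ℝ := if n ∣ l then b ^ (l / n) else 0

theorem multInd_add (b : ℝ) {n : ℕ} (hn : 1 ≤ n) (l : ℕ) :
    multInd b n (l + n) = b * multInd b n l := by
  rw [multInd, multInd, Nat.add_div_right _ (by omega)]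
  simp only [Nat.dvd_add_self_right]
  split_ifs
  · rw [pow_succ, mul_comm]
  · simp

theorem hasSum_multInd (b : ℝ) {n : ℕ} (hn : 1 ≤ n) {l : ℕ} (hl : 1 ≤ l) (x : ℝ) :
    HasSum (fun k : ℕ => if n * (k + 1) = l then b ^ (k + 1) * x else 0) (multInd b n l * x) := by
  rw [multInd]
  split_ifs with h
  · obtain ⟨j, rfl⟩ := h
    obtain ⟨k, rfl⟩ : ∃ k, j = k + 1 := ⟨j - 1, by
      rcases Nat.eq_zero_or_pos j with rfl | h
      · simp at hl
      · omega⟩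
    rw [Nat.mul_div_cancel_left _ (by omega)]
    have : ∀ k' : ℕ, (if n * (k' + 1) = n * (k + 1) then b ^ (k' + 1) * x else 0) =
        if k' = k then b ^ (k + 1) * x else 0 := by
      intro k'
      by_cases hk : k' = k
      · simp [hk]
      · have : n * (k' + 1) ≠ n * (k + 1) := fun h => hk (by
          have := Nat.eq_of_mul_eq_mul_left (by omega) h
          omega)
        rw [if_neg hk, if_neg this]
    simp only [this]
    exact hasSum_ite_eq k _
  · rw [zero_mul]
    have : ∀ k' : ℕ, (if n * (k' + 1) = l then b ^ (k' + 1) * x else 0) = 0 := by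
      intro k'
      rw [if_neg]
      rintro rfl
      exact h (dvd_mul_right _ _)
    simp only [this]
    exact hasSum_zero

/-- At the excluded index `k = -l / n` one has `1 / k = -n / l`, so all summands become multiples of
`1 / l ^ (p + q)` and the hockey stick identity adds the coefficients. -/
theorem fracSum_of_mul_eq {n p q : ℕ} (hn : 1 ≤ n) (hq : 1 ≤ q) {K l : ℝ} (hK : 0 < K)
    (hl : l = n * K) :
    fracSum (-n) (1 / l) (1 / -K) p q =
      (-n : ℝ) ^ p * ((p + q - 1).choose q : ℝ) * (1 / l ^ (p + q)) := by
  have hn0 : (n : ℝ) ≠ 0 := by positivity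
  rw [fracSum_eq_sum_Icc _ _ _ _ hq, ← sum_choose_Icc p hq, mul_sum, sum_mul]
  refine sum_congr rfl fun i hi => ?_
  have hi := mem_Icc.1 hi
  have e1 : (1 / -K) = -(n : ℝ) * (1 / l) := by rw [hl]; field_simp
  rw [e1, mul_pow, show p + q = (p + q - i) + i by omega, pow_add l,
    show (-n : ℝ) ^ p = (-n) ^ (p - i) * (-n) ^ i by rw [← pow_add]; congr 1; omega]
  rw [show p + q - i + i - i = p + q - i by omega, one_div_pow, one_div_pow]
  rw [← one_div_mul_one_div]
  ring

theorem mixedTerm_eq {b : ℝ} {n p q : ℕ} (hn : 1 ≤ n) (hp : 1 ≤ p) (hq : 1 ≤ q) {l : ℕ}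
    (hl : 1 ≤ l) (k : ℕ) :
    mixedTerm b n p q l k =
      ∑ i ∈ Icc 1 p, ((p + q - i - 1).choose (q - 1) : ℝ) * (-n : ℝ) ^ (p - i) *
        (1 / (l : ℝ) ^ (p + q - i)) *
          (b ^ (k + 1) * (1 / ((k : ℝ) + 1) ^ i + 1 / (-((k : ℝ) + 1)) ^ i)) +
      (-n : ℝ) ^ p * ∑ i ∈ Icc 1 q, ((p + q - i - 1).choose (p - 1) : ℝ) *
        (1 / (l : ℝ) ^ (p + q - i)) * pairTerm b n i l k -
      (if n * (k + 1) = l then b ^ (k + 1) * ((-n : ℝ) ^ p * ((p + q - 1).choose q : ℝ) *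
        (1 / (l : ℝ) ^ (p + q))) else 0) := by
  have hl0 : (l : ℝ) ≠ 0 := by positivity
  set K : ℝ := (k : ℝ) + 1 with hKdef
  have hK : 0 < K := by positivity
  have hsum : ∀ A M A' M' : ℝ, b ^ (k + 1) * ((fracSum (-n) (1 / l) A p q +
      (-n) ^ p * fracSum 1 (1 / l) M q p) + (fracSum (-n) (1 / l) A' p q +
      (-n) ^ p * fracSum 1 (1 / l) M' q p)) =
      ∑ i ∈ Icc 1 p, ((p + q - i - 1).choose (q - 1) : ℝ) * (-n : ℝ) ^ (p - i) *
        (1 / (l : ℝ) ^ (p + q - i)) * (b ^ (k + 1) * (A ^ i + A' ^ i)) +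
      (-n : ℝ) ^ p * ∑ i ∈ Icc 1 q, ((p + q - i - 1).choose (p - 1) : ℝ) *
        (1 / (l : ℝ) ^ (p + q - i)) * (b ^ (k + 1) * (M ^ i + M' ^ i)) := by
    intro A M A' M'
    simp only [fracSum_eq_sum_Icc _ _ _ _ hq, fracSum_eq_sum_Icc _ _ _ _ hp, mul_add, sum_add_distrib,
      mul_sum, one_pow, mul_one, one_div_pow, add_comm q p]
    have e1 : ∀ X : ℝ, ∀ x y z : ℝ, X * (x * y * z) = x * y * (X * z) := by intros; ring
    have e2 : ∀ X Y : ℝ, ∀ x y z : ℝ, X * (Y * (x * y * z)) = Y * (x * y * (X * z)) := by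
      intros; ring
    have e3 : ∀ X : ℝ, ∀ x y w z : ℝ, X * (x * y * w * z) = x * y * w * (X * z) := by intros; ring
    simp only [e3, e2]
    ring
  have hplus : (1 / K) * (1 / (l + n * K)) = 1 / l * (1 / K + (-n) * (1 / (l + n * K))) := by
    have : (l : ℝ) + n * K ≠ 0 := by positivity
    field_simp
    ring
  have h1 := pow_mul_pow_eq_fracSum hplus p q (by omega)
  have hspec := hsum (1 / K) (1 / (l + n * K)) (1 / -K) (1 / (l - n * K))
  simp only [one_div_pow] at hspec h1
  simp only [pairTerm, mixedTerm, ← hKdef]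
  rw [← hspec, h1]
  -- If `n (k + 1) = l`, the term of index `-(k + 1)` is `0` through division by zero, whereas its
  -- partial fractions in `1 / k` are not; their value is the correction subtracted.
  split_ifs with hnk
  · have hlK : (l : ℝ) = n * K := by rw [← hnk, hKdef]; push_cast; ring
    have h2 := fracSum_of_mul_eq (p := p) hn hq hK hlK
    have h3 : fracSum 1 (1 / (l : ℝ)) (1 / (l - n * K)) q p = 0 := by
      rw [hlK, sub_self, div_zero, fracSum]
      refine sum_eq_zero fun j hj => ?_
      have := mem_range.1 hj
      rw [zero_pow (by omega), mul_zero]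
    rw [h2, h3, show (l : ℝ) - n * K = 0 by rw [hlK, sub_self], zero_pow (by omega), div_zero]
    ring
  · have hne : (l : ℝ) - n * K ≠ 0 := by
      intro h
      apply hnk
      have : ((n * (k + 1) : ℕ) : ℝ) = l := by push_cast; rw [← hKdef]; linarith
      exact_mod_cast this
    have hminus : (1 / -K) * (1 / (l - n * K)) = 1 / l * (1 / -K + (-n) * (1 / (l - n * K))) := by
      generalize hd : (l : ℝ) - n * K = d at hne
      field_simp
      linear_combination -hd
    have h4 := pow_mul_pow_eq_fracSum hminus p q (by omega)
    simp only [one_div_pow] at h4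
    rw [h4, sub_zero]

/-- The sum over all nonzero integers `k` of `b ^ k / (k ^ p (l + n k) ^ q)`. -/
noncomputable def mixedSum (b : ℝ) (n p q l : ℕ) : ℝ :=
  ∑ i ∈ Icc 1 p, ((p + q - i - 1).choose (q - 1) : ℝ) * (-n : ℝ) ^ (p - i) *
    ((1 + (-1) ^ i) * (b * lerch b i 1)) * (1 / (l : ℝ) ^ (p + q - i)) +
  ∑ i ∈ Icc 1 q, (-n : ℝ) ^ p * ((p + q - i - 1).choose (p - 1) : ℝ) *
    (bilatSum b n i l * (1 / (l : ℝ) ^ (p + q - i)) - 1 / (l : ℝ) ^ (p + q)) -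
  (-n : ℝ) ^ p * ((p + q - 1).choose q : ℝ) * (multInd b n l * (1 / (l : ℝ) ^ (p + q)))

theorem hasSum_mixedTerm {b : ℝ} (hb : b = 1 ∨ b = -1) {n p q : ℕ} (hn : 1 ≤ n) (hp : 1 ≤ p)
    (hq : 1 ≤ q) {l : ℕ} (hl : 1 ≤ l) :
    HasSum (mixedTerm b n p q l) (mixedSum b n p q l) := by
  have h1 : HasSum (fun k : ℕ => ∑ i ∈ Icc 1 p, ((p + q - i - 1).choose (q - 1) : ℝ) *
      (-n : ℝ) ^ (p - i) * (1 / (l : ℝ) ^ (p + q - i)) *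
          (b ^ (k + 1) * (1 / ((k : ℝ) + 1) ^ i + 1 / (-((k : ℝ) + 1)) ^ i)))
      (∑ i ∈ Icc 1 p, ((p + q - i - 1).choose (q - 1) : ℝ) * (-n : ℝ) ^ (p - i) *
        (1 / (l : ℝ) ^ (p + q - i)) * ((1 + (-1) ^ i) * (b * lerch b i 1))) :=
    hasSum_sum fun i hi => (hasSum_even_pairs hb (mem_Icc.1 hi).1).mul_left _
  have h2 : HasSum (fun k : ℕ => ∑ i ∈ Icc 1 q, ((p + q - i - 1).choose (p - 1) : ℝ) *
      (1 / (l : ℝ) ^ (p + q - i)) * pairTerm b n i l k)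
      (∑ i ∈ Icc 1 q, ((p + q - i - 1).choose (p - 1) : ℝ) *
        (1 / (l : ℝ) ^ (p + q - i)) * (∑' k, pairTerm b n i l k)) :=
    hasSum_sum fun i hi => ((summable_pairTerm hb hn (mem_Icc.1 hi).1
      (Nat.cast_nonneg l)).hasSum).mul_left _
  have h3 := hasSum_multInd b hn hl ((-n : ℝ) ^ p * ((p + q - 1).choose q : ℝ) *
        (1 / (l : ℝ) ^ (p + q)))
  have h4 := (h1.add (h2.mul_left ((-n : ℝ) ^ p))).sub h3
  simp only [← mixedTerm_eq hn hp hq hl] at h4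
  refine (congrArg (HasSum (mixedTerm b n p q l)) ?_).mpr h4
  rw [mixedSum]
  congr 1
  · congr 1
    · refine sum_congr rfl fun i _ => by ring
    · rw [mul_sum]
      refine sum_congr rfl fun i hi => ?_
      have hi := mem_Icc.1 hi
      -- `bilatSum` contains the index `0`, absent from the mixed series; its term `1 / l ^ i`
      -- accounts for the subtracted `1 / l ^ (p + q)`.
      rw [bilatSum, show (l : ℝ) ^ (p + q) = l ^ (p + q - i) * l ^ i by
        rw [← pow_add]; congr 1; omega, ← one_div_mul_one_div]
      ring
  · ring

/-! ### Damped sums over l of quasi-periodic coefficients, and their Abel limits. -/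

theorem eventually_mem_Ioo : ∀ᶠ ρ : ℝ in 𝓝[<] 1, ρ ∈ Ioo (0 : ℝ) 1 := Ioo_mem_nhdsLT zero_lt_one

theorem abs_mul_lt_one {a ρ : ℝ} (ha : |a| = 1) (hρ : ρ ∈ Ioo (0 : ℝ) 1) : |a * ρ| < 1 := by
  rw [abs_mul, ha, one_mul, abs_of_pos hρ.1]; exact hρ.2

theorem tendsto_pow_nhdsLT_one {n : ℕ} (hn : 1 ≤ n) :
    Tendsto (fun ρ : ℝ => ρ ^ n) (𝓝[<] 1) (𝓝[<] 1) := by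
  refine tendsto_nhdsWithin_iff.2 ⟨?_, ?_⟩
  · have := ((continuous_pow n).tendsto (1 : ℝ)).mono_left (nhdsWithin_le_nhds (s := Set.Iio 1))
    simpa using this
  · filter_upwards [eventually_mem_Ioo] with ρ hρ
    exact pow_lt_one₀ hρ.1.le hρ.2 (by omega)

/-- `∑ z ^ l u l / l ^ e`. -/
noncomputable def dampedSum (z : ℝ) (u : ℕ → ℝ) (e : ℕ) : ℝ :=
  ∑' l : ℕ, z ^ l * (u l * (1 / (l : ℝ) ^ e))

/-- The value of `∑ a ^ l u l / l ^ e` for `u` with `u (l + n) = b u l`. -/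
noncomputable def residueLerch (a b : ℝ) (n : ℕ) (u : ℕ → ℝ) (e : ℕ) : ℝ :=
  ∑ r ∈ range n, a ^ r * u r * (1 / (n : ℝ) ^ e) * lerch (a ^ n * b) e (r / n)

theorem quasiperiodic_mul_add {b : ℝ} {n : ℕ} {u : ℕ → ℝ} (hu : ∀ l, u (l + n) = b * u l)
    (r s : ℕ) : u (r + n * s) = b ^ s * u r := by
  induction s with
  | zero => simp
  | succ s ih => rw [mul_add, mul_one, ← add_assoc, hu, ih, pow_succ]; ring

theorem abs_quasiperiodic_le {b : ℝ} (hb : |b| = 1) {n : ℕ} (hn : 1 ≤ n) {u : ℕ → ℝ}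
    (hu : ∀ l, u (l + n) = b * u l) (l : ℕ) : |u l| ≤ ∑ r ∈ range n, |u r| := by
  conv_lhs => rw [← Nat.mod_add_div l n]
  rw [quasiperiodic_mul_add hu, abs_mul, abs_pow, hb, one_pow, one_mul]
  exact single_le_sum (f := fun r => |u r|) (fun r _ => abs_nonneg _)
    (mem_range.2 (Nat.mod_lt _ hn))

theorem one_div_natCast_pow_le_one (l e : ℕ) : 1 / (l : ℝ) ^ e ≤ 1 := by
  rcases Nat.eq_zero_or_pos l with rfl | hl
  · rcases Nat.eq_zero_or_pos e with rfl | he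
    · simp
    · rw [Nat.cast_zero, zero_pow he.ne', div_zero]; exact zero_le_one
  · have : (1 : ℝ) ≤ l := by exact_mod_cast hl
    rw [div_le_one (by positivity)]
    exact one_le_pow₀ this

theorem summable_damped {z : ℝ} (hz : |z| < 1) {u : ℕ → ℝ} {B : ℝ} (hu : ∀ l, |u l| ≤ B) (e : ℕ) :
    Summable fun l : ℕ => z ^ l * (u l * (1 / (l : ℝ) ^ e)) := by
  refine Summable.of_norm_bounded ((summable_geometric_of_lt_one (abs_nonneg z) hz).mul_right B)
    fun l => ?_
  rw [norm_mul, norm_mul, norm_pow, Real.norm_eq_abs, Real.norm_eq_abs,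
    Real.norm_of_nonneg (by positivity)]
  have h1 := one_div_natCast_pow_le_one l e
  have h2 : |u l| * (1 / (l : ℝ) ^ e) ≤ B * 1 :=
    mul_le_mul (hu l) h1 (by positivity) ((abs_nonneg _).trans (hu l))
  rw [mul_one] at h2
  gcongr

/-- Writing `l = r + n s` gives `u l = b ^ s u r`, so the class of `r` is a Lerch series with ratio
`b (a ρ) ^ n` and shift `r / n`. -/
theorem dampedSum_eq {a b : ℝ} (ha : a * a = 1) (hb : b * b = 1) {n : ℕ} (hn : 1 ≤ n)
    {u : ℕ → ℝ} (hu : ∀ l, u (l + n) = b * u l) (e : ℕ) {ρ : ℝ} (hρ : ρ ∈ Ioo (0 : ℝ) 1) :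
    dampedSum (a * ρ) u e = ∑ r ∈ range n, (a * ρ) ^ r * u r * (1 / (n : ℝ) ^ e) *
      lerchSum (a ^ n * b * ρ ^ n) e (r / n) := by
  have hn0 : (n : ℝ) ≠ 0 := by positivity
  have habs : ∀ {x : ℝ}, x * x = 1 → |x| = 1 := fun h => by
    rcases mul_self_eq_one_iff.1 h with h | h <;> simp [h]
  have hs := summable_damped (abs_mul_lt_one (habs ha) hρ) (abs_quasiperiodic_le (habs hb) hn hu) e
  have : NeZero n := ⟨by omega⟩
  rw [dampedSum, Nat.sumByResidueClasses hs n]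
  obtain ⟨m, rfl⟩ : ∃ m, n = m + 1 := ⟨n - 1, by omega⟩
  rw [← Fin.sum_univ_eq_sum_range (fun r => (a * ρ) ^ r * u r * (1 / ((m + 1 : ℕ) : ℝ) ^ e) *
      lerchSum (a ^ (m + 1) * b * ρ ^ (m + 1)) e ((r : ℝ) / ((m + 1 : ℕ) : ℝ)))]
  refine sum_congr rfl fun r _ => ?_
  rw [lerchSum, ← tsum_mul_left]
  refine tsum_congr fun s => ?_
  rw [quasiperiodic_mul_add hu]
  have e1 : ((ZMod.val r + (m + 1) * s : ℕ) : ℝ) =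
      ((s : ℝ) + (ZMod.val r : ℕ) / ((m + 1 : ℕ) : ℝ)) * ((m + 1 : ℕ) : ℝ) := by
    push_cast at hn0 ⊢
    field_simp
    ring
  rw [e1, one_div_mul_pow, pow_add, pow_mul, show (a * ρ) ^ (m + 1) = a ^ (m + 1) * ρ ^ (m + 1) by
    rw [mul_pow]]
  rw [show a ^ (m + 1) * b * ρ ^ (m + 1) = a ^ (m + 1) * ρ ^ (m + 1) * b by ring, mul_pow _ b]
  change _ = (a * ρ) ^ (ZMod.val r) * u (ZMod.val r) * _ *
    (_ / ((s : ℝ) + (ZMod.val r : ℕ) / ((m + 1 : ℕ) : ℝ)) ^ e)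
  ring

theorem tendsto_dampedSum {a b : ℝ} (ha : a * a = 1) (hb : b * b = 1) {n : ℕ} (hn : 1 ≤ n)
    {u : ℕ → ℝ} (hu : ∀ l, u (l + n) = b * u l) {e : ℕ} (hc : LerchConv (a ^ n * b) e) :
    Tendsto (fun ρ : ℝ => dampedSum (a * ρ) u e) (𝓝[<] 1) (𝓝 (residueLerch a b n u e)) := by
  have h1 : Tendsto (fun ρ : ℝ => ∑ r ∈ range n, (a * ρ) ^ r * u r * (1 / (n : ℝ) ^ e) *
      lerchSum (a ^ n * b * ρ ^ n) e (r / n)) (𝓝[<] 1) (𝓝 (residueLerch a b n u e)) := by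
    refine tendsto_finsetSum _ fun r _ => ?_
    refine Tendsto.mul (Tendsto.mul_const _ (Tendsto.mul_const _ ?_))
      ((lerchSum_tendsto hc (by positivity)).comp (tendsto_pow_nhdsLT_one hn))
    have : Tendsto (fun ρ : ℝ => (a * ρ) ^ r) (𝓝 1) (𝓝 ((a * 1) ^ r)) := by
      exact (((continuous_const.mul continuous_id).pow r).tendsto 1)
    rw [mul_one] at this
    exact this.mono_left nhdsWithin_le_nhds
  refine h1.congr' ?_
  filter_upwards [eventually_mem_Ioo] with ρ hρ
  rw [dampedSum_eq ha hb hn hu e hρ]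

theorem dampedSum_one (z : ℝ) (e : ℕ) : dampedSum z (fun _ => 1) e = lerchSum z e 0 := by
  rw [dampedSum, lerchSum]
  refine tsum_congr fun l => ?_
  rw [add_zero]
  ring

theorem LerchConv.mono {c : ℝ} {e e' : ℕ} (h : LerchConv c e) (he : e ≤ e') : LerchConv c e' :=
  ⟨h.1.trans he, h.2.imp (fun h => ⟨h.1, h.2.trans he⟩) id⟩

theorem bilatSum_natCast_add {b : ℝ} (hb : b = 1 ∨ b = -1) {n : ℕ} (hn : 1 ≤ n) {i : ℕ}
    (hi : 1 ≤ i) (l : ℕ) :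
    bilatSum b n i ((l + n : ℕ) : ℝ) = b * bilatSum b n i l := by
  rw [Nat.cast_add]
  exact bilatSum_add hb hn hi (Nat.cast_nonneg l)

theorem exists_abs_quasiperiodic_le {n : ℕ} (hn : 1 ≤ n) {b : ℝ} (hb : b = 1 ∨ b = -1) {u : ℕ → ℝ}
    (hu : ∀ l, u (l + n) = b * u l) : ∃ B, ∀ l, |u l| ≤ B :=
  ⟨_, abs_quasiperiodic_le (abs_eq_one' hb) hn hu⟩

/-- The limit of `∑ z ^ l mixedSum l` as `z → a`. -/
noncomputable def mixedLimit (a b : ℝ) (n p q : ℕ) : ℝ :=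
  ∑ i ∈ Icc 1 p, ((p + q - i - 1).choose (q - 1) : ℝ) * (-n : ℝ) ^ (p - i) *
    ((1 + (-1) ^ i) * (b * lerch b i 1)) * lerch a (p + q - i) 0 +
  ∑ i ∈ Icc 1 q, (-n : ℝ) ^ p * ((p + q - i - 1).choose (p - 1) : ℝ) *
    (residueLerch a b n (fun l => bilatSum b n i l) (p + q - i) - lerch a (p + q) 0) -
  (-n : ℝ) ^ p * ((p + q - 1).choose q : ℝ) * residueLerch a b n (multInd b n) (p + q)

theorem hasSum_pow_mul_mixedSum {b : ℝ} (hb : b = 1 ∨ b = -1) {n p q : ℕ} (hn : 1 ≤ n)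
    {z : ℝ} (hz : |z| < 1) :
    HasSum (fun l : ℕ => z ^ l * mixedSum b n p q l)
      (∑ i ∈ Icc 1 p, ((p + q - i - 1).choose (q - 1) : ℝ) * (-n : ℝ) ^ (p - i) *
        ((1 + (-1) ^ i) * (b * lerch b i 1)) * lerchSum z (p + q - i) 0 +
      ∑ i ∈ Icc 1 q, (-n : ℝ) ^ p * ((p + q - i - 1).choose (p - 1) : ℝ) *
        (dampedSum z (fun l => bilatSum b n i l) (p + q - i) - lerchSum z (p + q) 0) -
      (-n : ℝ) ^ p * ((p + q - 1).choose q : ℝ) * dampedSum z (multInd b n) (p + q)) := by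
  have hone : ∀ e, HasSum (fun l : ℕ => z ^ l * (1 * (1 / (l : ℝ) ^ e))) (lerchSum z e 0) := by
    intro e
    rw [← dampedSum_one]
    exact (summable_damped hz (B := 1) (fun l => by simp) e).hasSum
  have h1 : HasSum (fun l : ℕ => ∑ i ∈ Icc 1 p, ((p + q - i - 1).choose (q - 1) : ℝ) *
      (-n : ℝ) ^ (p - i) * ((1 + (-1) ^ i) * (b * lerch b i 1)) *
        (z ^ l * (1 * (1 / (l : ℝ) ^ (p + q - i))))) _ :=
    hasSum_sum fun i _ => (hone (p + q - i)).mul_left _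
  have h2 : HasSum (fun l : ℕ => ∑ i ∈ Icc 1 q, (-n : ℝ) ^ p *
      ((p + q - i - 1).choose (p - 1) : ℝ) *
      (z ^ l * (bilatSum b n i l * (1 / (l : ℝ) ^ (p + q - i))) -
        z ^ l * (1 * (1 / (l : ℝ) ^ (p + q))))) _ :=
    hasSum_sum fun i hi => by
      obtain ⟨B, hB⟩ := exists_abs_quasiperiodic_le hn hb
        (u := fun l : ℕ => bilatSum b n i l) (bilatSum_natCast_add hb hn (mem_Icc.1 hi).1)
      exact ((summable_damped hz hB (p + q - i)).hasSum.sub (hone (p + q))).mul_left _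
  have h3 : HasSum (fun l : ℕ => (-n : ℝ) ^ p * ((p + q - 1).choose q : ℝ) *
      (z ^ l * (multInd b n l * (1 / (l : ℝ) ^ (p + q)))))
      ((-n : ℝ) ^ p * ((p + q - 1).choose q : ℝ) * dampedSum z (multInd b n) (p + q)) := by
    obtain ⟨B, hB⟩ := exists_abs_quasiperiodic_le hn hb (multInd_add b hn)
    exact (summable_damped hz hB (p + q)).hasSum.mul_left _
  refine ((h1.add h2).sub h3).congr_fun fun l => ?_
  rw [mixedSum, mul_sub, mul_add, mul_sum, mul_sum]
  congr 1
  · congr 1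
    · exact sum_congr rfl fun i _ => by ring
    · exact sum_congr rfl fun i _ => by ring
  · ring

/-- The orders `p + q - i` are at least `q` in the first sum and at least `p` in the second, so the
two convergence hypotheses cover every series that occurs. -/
theorem tendsto_tsum_mixedSum {a b : ℝ} (ha : a * a = 1) (hb : b = 1 ∨ b = -1) {n p q : ℕ}
    (hn : 1 ≤ n) (hca : LerchConv a q) (hcp : LerchConv (a ^ n * b) p) :
    Tendsto (fun ρ : ℝ => ∑' l : ℕ, (a * ρ) ^ l * mixedSum b n p q l) (𝓝[<] 1)
      (𝓝 (mixedLimit a b n p q)) := by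
  have hbb := sq_eq_one hb
  have hlim : Tendsto (fun ρ : ℝ => (∑ i ∈ Icc 1 p, ((p + q - i - 1).choose (q - 1) : ℝ) *
        (-n : ℝ) ^ (p - i) *
        ((1 + (-1) ^ i) * (b * lerch b i 1)) * lerchSum (a * ρ) (p + q - i) 0 +
      ∑ i ∈ Icc 1 q, (-n : ℝ) ^ p * ((p + q - i - 1).choose (p - 1) : ℝ) *
        (dampedSum (a * ρ) (fun l => bilatSum b n i l) (p + q - i) - lerchSum (a * ρ) (p + q) 0) -
      (-n : ℝ) ^ p * ((p + q - 1).choose q : ℝ) * dampedSum (a * ρ) (multInd b n) (p + q)))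
      (𝓝[<] 1) (𝓝 (mixedLimit a b n p q)) := by
    refine Tendsto.sub (Tendsto.add (tendsto_finsetSum _ fun i hi => ?_)
      (tendsto_finsetSum _ fun i hi => ?_)) (Tendsto.const_mul _ ?_)
    · have := (mem_Icc.1 hi).2
      exact (lerchSum_tendsto (hca.mono (by omega)) le_rfl).const_mul _
    · have := mem_Icc.1 hi
      refine Tendsto.const_mul _ (Tendsto.sub ?_ (lerchSum_tendsto (hca.mono (by omega)) le_rfl))
      exact tendsto_dampedSum ha hbb hn (bilatSum_natCast_add hb hn this.1) (hcp.mono (by omega))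
    · exact tendsto_dampedSum ha hbb hn (multInd_add b hn) (hcp.mono (by omega))
  refine hlim.congr' ?_
  filter_upwards [eventually_mem_Ioo] with ρ hρ
  exact ((hasSum_pow_mul_mixedSum hb hn (abs_mul_lt_one hca.abs_eq_one hρ)).tsum_eq).symm

/-! ### The damped double series and its two orders of summation. -/

/-- Meant for the integers `x = l ± n K`, where `K ≤ |x| + l ≤ |x| (1 + l)` if `x ≠ 0`. It gains a
factor `1 / K` at the price of a growth in `l` that the damping absorbs. -/
theorem abs_one_div_pow_le {x K l : ℝ} {q : ℕ} (hq : 1 ≤ q) (hK : 0 < K) (hl : 0 ≤ l)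
    (hx : x = 0 ∨ 1 ≤ |x| ∧ K ≤ |x| * (1 + l)) : |1 / x ^ q| ≤ (1 + l) / K := by
  rcases hx with rfl | ⟨h1, h2⟩
  · rw [zero_pow (by omega), div_zero, abs_zero]
    positivity
  · rw [abs_div, abs_one, abs_pow, div_le_div_iff₀ (by positivity) hK, one_mul]
    have : |x| ≤ |x| ^ q := by
      calc |x| = |x| ^ 1 := (pow_one _).symm
        _ ≤ _ := pow_le_pow_right₀ h1 hq
    calc K ≤ |x| * (1 + l) := h2
      _ ≤ |x| ^ q * (1 + l) := by gcongr
      _ = _ := mul_comm _ _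

theorem summable_prod_of_le {b z : ℝ} (hb : b = 1 ∨ b = -1) (hz : |z| < 1) {p : ℕ} (hp : 1 ≤ p)
    {s : ℝ} (hs : s = 1 ∨ s = -1) {g : ℕ → ℕ → ℝ}
    (hg : ∀ k j : ℕ, |g k j| ≤ (1 + ((j : ℝ) + 1)) / ((k : ℝ) + 1)) :
    Summable fun x : ℕ × ℕ => z ^ (x.2 + 1) *
      (b ^ (x.1 + 1) * (1 / (s * ((x.1 : ℝ) + 1)) ^ p * g x.1 x.2)) := by
  have h1 : Summable fun k : ℕ => 1 / ((k : ℝ) + 1) ^ 2 := summable_inv_add_pow le_rfl zero_le_one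
  have h2 : Summable fun j : ℕ => (1 + ((j : ℝ) + 1)) * |z| ^ (j + 1) := by
    have h3 := summable_pow_mul_geometric_of_norm_lt_one 1 (r := |z|) (by simpa using hz)
    have h4 := summable_geometric_of_lt_one (abs_nonneg z) hz
    have := (summable_nat_add_iff 1).2 (h4.add h3)
    refine this.congr fun j => ?_
    push_cast
    ring
  refine Summable.of_norm_bounded
    (h1.mul_of_nonneg h2 (fun k => by positivity) (fun j => by positivity)) fun x => ?_
  have hK : (1 : ℝ) ≤ (x.1 : ℝ) + 1 := by have := Nat.cast_nonneg (α := ℝ) x.1; linarith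
  have hsK : |s * ((x.1 : ℝ) + 1)| = (x.1 : ℝ) + 1 := by
    rw [abs_mul, abs_eq_one' hs, one_mul, abs_of_pos (by positivity)]
  rw [norm_mul, norm_mul, norm_mul, norm_pow, norm_pow, norm_div, norm_one, norm_pow,
    Real.norm_eq_abs, Real.norm_eq_abs, Real.norm_eq_abs, Real.norm_eq_abs, abs_eq_one' hb, one_pow,
    one_mul, hsK]
  have h5 := hg x.1 x.2
  have h6 : 1 / ((x.1 : ℝ) + 1) ^ p ≤ 1 / ((x.1 : ℝ) + 1) := by
    gcongr
    calc (x.1 : ℝ) + 1 = ((x.1 : ℝ) + 1) ^ 1 := (pow_one _).symm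
      _ ≤ _ := pow_le_pow_right₀ hK hp
  calc _ ≤ |z| ^ (x.2 + 1) * (1 / ((x.1 : ℝ) + 1) *
        ((1 + ((x.2 : ℝ) + 1)) / ((x.1 : ℝ) + 1))) := by gcongr
    _ = _ := by field_simp

theorem tsum_pow_div_add (z : ℝ) (q N : ℕ) :
    ∑' j : ℕ, z ^ (j + 1) * (1 / (((j : ℝ) + 1) + N) ^ q) = z * lerchSum z q ((N : ℝ) + 1) := by
  rw [lerchSum, ← tsum_mul_left]
  refine tsum_congr fun j => ?_
  rw [show (j : ℝ) + 1 + N = j + (N + 1) by ring]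
  ring

/-- The terms of index below `N` in the expansion of `∑ z ^ l / (l - N) ^ q`. -/
noncomputable def reflectedSum (z : ℝ) (q N : ℕ) : ℝ := ∑ m ∈ Icc 1 (N - 1), z ^ (N - m) / (m : ℝ) ^ q

/-- With `l = j + 1`, the terms `l > N` form a series of their own, `l = N` contributes `1 / 0 ^ q =
0`, and `m = N - l` reflects the terms `l < N`, producing the sign `(-1) ^ q`. -/
theorem tsum_pow_div_sub {z : ℝ} (q : ℕ) {N : ℕ} (hN : 1 ≤ N)
    (hs : Summable fun j : ℕ => z ^ (j + 1) * (1 / (((j : ℝ) + 1) - N) ^ q)) :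
    ∑' j : ℕ, z ^ (j + 1) * (1 / (((j : ℝ) + 1) - N) ^ q) =
      z ^ N * lerchSum z q 0 + (-1) ^ q * reflectedSum z q N := by
  obtain ⟨M, rfl⟩ : ∃ M, N = M + 1 := ⟨N - 1, by omega⟩
  rw [← hs.sum_add_tsum_nat_add M, add_comm]
  congr 1
  · rw [lerchSum, ← tsum_mul_left]
    refine tsum_congr fun j => ?_
    push_cast
    rw [show (j : ℝ) + M + 1 - (M + 1) = j + 0 by ring]
    ring
  · rw [reflectedSum, Nat.add_sub_cancel,
      ← sum_range_sub_eq_sum_Icc (fun m => z ^ (M + 1 - m) / (m : ℝ) ^ q), mul_sum]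
    refine sum_congr rfl fun j hj => ?_
    have hj := mem_range.1 hj
    have h1 : ((M - j : ℕ) : ℝ) = M - j := by rw [Nat.cast_sub hj.le]
    rw [h1, show M + 1 - (M - j) = j + 1 by omega]
    push_cast
    rw [show (j : ℝ) + 1 - (M + 1) = -1 * (M - j) by ring, mul_pow]
    rcases neg_one_pow_eq_or ℝ q with h | h <;> rw [h]
    · ring
    · rw [neg_one_mul, one_div_neg_eq_neg_one_div]; ring

theorem mixedSum_zero (b : ℝ) (n : ℕ) {p q : ℕ} (hp : 1 ≤ p) (hq : 1 ≤ q) :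
    mixedSum b n p q 0 = 0 := by
  have h : ∀ {e : ℕ}, 1 ≤ e → 1 / ((0 : ℕ) : ℝ) ^ e = 0 := fun he => by
    rw [Nat.cast_zero, zero_pow (by omega), div_zero]
  rw [mixedSum, sum_eq_zero, sum_eq_zero, h (by omega)]
  · simp
  · intro i hi
    have := mem_Icc.1 hi
    rw [h (by omega), h (by omega)]
    simp
  · intro i hi
    have := mem_Icc.1 hi
    rw [h (by omega), mul_zero]

theorem abs_lerchSum_le' {a : ℝ} {q : ℕ} (h : LerchConv a q) (N : ℕ) {σ : ℝ}
    (hσ : σ ∈ Ioo (0 : ℝ) 1) : |lerchSum (a * σ) q ((N : ℝ) + 1)| ≤ 8 / ((N : ℝ) + 1) := by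
  obtain ⟨m, rfl⟩ : ∃ m, q = m + 1 := ⟨q - 1, by have := h.1; omega⟩
  exact abs_lerchSum_le h N hσ

/-- The damped double series over the positive quadrant. -/
noncomputable def quadrantTerm (b : ℝ) (n p q : ℕ) (z : ℝ) (k : ℕ) : ℝ :=
  b ^ (k + 1) * (1 / ((k : ℝ) + 1) ^ p) * (z * lerchSum z q (((n * (k + 1) : ℕ) : ℝ) + 1))

theorem abs_quadrantTerm_le {a b : ℝ} (hb : b = 1 ∨ b = -1) {n p q : ℕ} (hn : 1 ≤ n) (hp : 1 ≤ p)
    (h : LerchConv a q) {ρ : ℝ} (hρ : ρ ∈ Ioo (0 : ℝ) 1) (k : ℕ) :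
    ‖quadrantTerm b n p q (a * ρ) k‖ ≤ 8 * (1 / ((k : ℝ) + 1) ^ 2) := by
  have h1 := abs_lerchSum_le' h (n * (k + 1)) hρ
  have hK : (1 : ℝ) ≤ (k : ℝ) + 1 := by have := Nat.cast_nonneg (α := ℝ) k; linarith
  have h4 : (k : ℝ) + 1 ≤ ((n * (k + 1) : ℕ) : ℝ) + 1 := by
    have : (k + 1 : ℕ) ≤ n * (k + 1) := Nat.le_mul_of_pos_left _ hn
    have : ((k + 1 : ℕ) : ℝ) ≤ ((n * (k + 1) : ℕ) : ℝ) := by exact_mod_cast this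
    push_cast at *
    linarith
  rw [quadrantTerm, norm_mul, norm_mul, norm_mul, norm_pow, Real.norm_eq_abs, Real.norm_eq_abs,
    Real.norm_eq_abs, Real.norm_eq_abs, abs_eq_one' hb, one_pow, one_mul,
    abs_of_nonneg (by positivity : 0 ≤ 1 / ((k : ℝ) + 1) ^ p)]
  have h6 : 1 / ((k : ℝ) + 1) ^ p ≤ 1 / ((k : ℝ) + 1) := by
    gcongr
    calc (k : ℝ) + 1 = ((k : ℝ) + 1) ^ 1 := (pow_one _).symm
      _ ≤ _ := pow_le_pow_right₀ hK hp
  have h7 : 8 / (((n * (k + 1) : ℕ) : ℝ) + 1) ≤ 8 / ((k : ℝ) + 1) := by gcongr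
  calc _ ≤ 1 / ((k : ℝ) + 1) * (1 * (8 / ((k : ℝ) + 1))) := by
        gcongr
        · exact (abs_mul_lt_one h.abs_eq_one hρ).le
        · exact h1.trans h7
    _ = _ := by field_simp

theorem tendsto_tsum_quadrantTerm {a b : ℝ} (hb : b = 1 ∨ b = -1) {n p q : ℕ} (hn : 1 ≤ n)
    (hp : 1 ≤ p) (h : LerchConv a q) :
    Tendsto (fun ρ : ℝ => ∑' k, quadrantTerm b n p q (a * ρ) k) (𝓝[<] 1)
      (𝓝 (∑' k : ℕ, b ^ (k + 1) * (1 / ((k : ℝ) + 1) ^ p) *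
        (a * lerch a q (((n * (k + 1) : ℕ) : ℝ) + 1)))) := by
  refine tendsto_tsum_of_dominated_convergence (bound := fun k : ℕ => 8 * (1 / ((k : ℝ) + 1) ^ 2))
    ((summable_inv_add_pow le_rfl zero_le_one).mul_left _) (fun k => ?_) ?_
  · refine Tendsto.const_mul _ (Tendsto.mul ?_ (lerchSum_tendsto h (by positivity)))
    have : Tendsto (fun ρ : ℝ => a * ρ) (𝓝 1) (𝓝 (a * 1)) :=
      (continuous_const.mul continuous_id).tendsto 1
    rw [mul_one] at this
    exact this.mono_left nhdsWithin_le_nhds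
  · filter_upwards [eventually_mem_Ioo] with ρ hρ k
    exact abs_quadrantTerm_le hb hn hp h hρ k

/-- The terms of the damped double series. -/
noncomputable def dampedTerm (b z : ℝ) (n p q k j : ℕ) : ℝ :=
  z ^ (j + 1) * mixedTerm b n p q ((j + 1 : ℕ) : ℝ) k

/-- The two orders of summation of the damped double series. -/
theorem hasSum_reflectedSum {a b : ℝ} (hb : b = 1 ∨ b = -1) {n p q : ℕ} (hn : 1 ≤ n) (hp : 1 ≤ p)
    (h : LerchConv a q) (hpq : Odd (p + q)) {ρ : ℝ} (hρ : ρ ∈ Ioo (0 : ℝ) 1) :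
    HasSum (fun k : ℕ => b ^ (k + 1) * (1 / ((k : ℝ) + 1) ^ p) *
        reflectedSum (a * ρ) q (n * (k + 1)))
      ((∑' k, quadrantTerm b n p q (a * ρ) k) +
        (-1) ^ p * (lerchSum (a ^ n * b * ρ ^ n) p 0 * lerchSum (a * ρ) q 0) -
        ∑' l : ℕ, (a * ρ) ^ l * mixedSum b n p q l) := by
  set z := a * ρ with hzdef
  have hz : |z| < 1 := abs_mul_lt_one h.abs_eq_one hρ
  have hq := h.1
  have hn' : (1 : ℝ) ≤ n := by exact_mod_cast hn
  have hplus : Summable fun x : ℕ × ℕ => z ^ (x.2 + 1) * (b ^ (x.1 + 1) *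
      (1 / (1 * ((x.1 : ℝ) + 1)) ^ p *
        (1 / (((x.2 : ℝ) + 1) + ((n * (x.1 + 1) : ℕ) : ℝ)) ^ q))) := by
    refine summable_prod_of_le hb hz hp (Or.inl rfl)
      (g := fun k j => 1 / (((j : ℝ) + 1) + ((n * (k + 1) : ℕ) : ℝ)) ^ q) fun k j => ?_
    refine abs_one_div_pow_le hq (by positivity) (by positivity) (Or.inr ?_)
    have hk := Nat.cast_nonneg (α := ℝ) k
    have hj := Nat.cast_nonneg (α := ℝ) j
    push_cast
    rw [abs_of_pos (by positivity)]
    constructor <;> nlinarith [mul_nonneg hk hj]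
  have hminus : Summable fun x : ℕ × ℕ => z ^ (x.2 + 1) * (b ^ (x.1 + 1) *
      (1 / (-1 * ((x.1 : ℝ) + 1)) ^ p *
        (1 / (((x.2 : ℝ) + 1) - ((n * (x.1 + 1) : ℕ) : ℝ)) ^ q))) := by
    refine summable_prod_of_le hb hz hp (Or.inr rfl)
      (g := fun k j => 1 / (((j : ℝ) + 1) - ((n * (k + 1) : ℕ) : ℝ)) ^ q) fun k j => ?_
    refine abs_one_div_pow_le hq (by positivity) (by positivity) ?_
    set x : ℝ := ((j : ℝ) + 1) - ((n * (k + 1) : ℕ) : ℝ) with hx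
    rcases eq_or_ne x 0 with h0 | h0
    · exact Or.inl h0
    · have hxz : x = (((j : ℤ) + 1 - (n * (k + 1) : ℕ) : ℤ) : ℝ) := by rw [hx]; push_cast; ring
      have h1 : 1 ≤ |x| := by
        rw [hxz] at h0 ⊢
        have : ((j : ℤ) + 1 - (n * (k + 1) : ℕ) : ℤ) ≠ 0 := by exact_mod_cast h0
        exact_mod_cast Int.one_le_abs this
      refine Or.inr ⟨h1, ?_⟩
      have h2 : -x ≤ |x| := neg_le_abs x
      have hk := Nat.cast_nonneg (α := ℝ) k
      have hj := Nat.cast_nonneg (α := ℝ) j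
      have h3 : (n : ℝ) * (k + 1) ≤ |x| + (j + 1) := by
        rw [hx] at h2 ⊢
        push_cast at h2 ⊢
        linarith
      nlinarith
  have hterm : ∀ k j : ℕ, dampedTerm b z n p q k j =
      z ^ (j + 1) * (b ^ (k + 1) * (1 / (1 * ((k : ℝ) + 1)) ^ p *
        (1 / (((j : ℝ) + 1) + ((n * (k + 1) : ℕ) : ℝ)) ^ q))) +
      z ^ (j + 1) * (b ^ (k + 1) * (1 / (-1 * ((k : ℝ) + 1)) ^ p *
        (1 / (((j : ℝ) + 1) - ((n * (k + 1) : ℕ) : ℝ)) ^ q))) := by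
    intro k j
    rw [dampedTerm, mixedTerm, one_mul, neg_one_mul]
    push_cast
    ring
  have hall : Summable (Function.uncurry (dampedTerm b z n p q)) :=
    (hplus.add hminus).congr fun x => (hterm x.1 x.2).symm
  -- Summing over `k` first gives `mixedSum`; the index `l = 0` is harmless, since `mixedSum`
  -- vanishes there.
  have hG : ∑' l : ℕ, z ^ l * mixedSum b n p q l =
      ∑' k : ℕ, ∑' j : ℕ, dampedTerm b z n p q k j := by
    rw [← (hasSum_pow_mul_mixedSum hb hn hz).summable.sum_add_tsum_nat_add 1, sum_range_one,
      mixedSum_zero b n hp hq, mul_zero, zero_add, ← Summable.tsum_comm hall]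
    refine tsum_congr fun j => ?_
    simp only [dampedTerm]
    rw [tsum_mul_left, (hasSum_mixedTerm hb hn hp hq (by omega : 1 ≤ j + 1)).tsum_eq]
  have hinner : ∀ k : ℕ, ∑' j : ℕ, dampedTerm b z n p q k j =
      quadrantTerm b n p q z k + (-1) ^ p * (b ^ (k + 1) * (1 / ((k : ℝ) + 1) ^ p) *
        (z ^ (n * (k + 1)) * lerchSum z q 0)) -
        b ^ (k + 1) * (1 / ((k : ℝ) + 1) ^ p) * reflectedSum z q (n * (k + 1)) := by
    intro k
    have s1 := hplus.prod_factor k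
    have s2 := hminus.prod_factor k
    have e1 : ∀ X : ℝ, ∀ Y : ℝ, ∀ j : ℕ, z ^ (j + 1) * (b ^ (k + 1) * (X * Y)) =
        b ^ (k + 1) * X * (z ^ (j + 1) * Y) := by intros; ring
    have hb0 : b ≠ 0 := by rcases hb with rfl | rfl <;> norm_num
    have hk0 : (k : ℝ) + 1 ≠ 0 := by positivity
    have s3 : Summable fun j : ℕ => z ^ (j + 1) *
        (1 / (((j : ℝ) + 1) - ((n * (k + 1) : ℕ) : ℝ)) ^ q) := by
      simp only [e1] at s2
      refine (summable_mul_left_iff ?_).1 s2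
      exact mul_ne_zero (pow_ne_zero _ hb0)
        (one_div_ne_zero (pow_ne_zero _ (mul_ne_zero (by norm_num) hk0)))
    simp only [hterm]
    rw [s1.tsum_add s2]
    simp only [e1]
    rw [tsum_mul_left, tsum_mul_left, tsum_pow_div_add, tsum_pow_div_sub q
      (Nat.mul_pos (by omega) (by omega)) s3, quadrantTerm, one_mul, mul_pow (-1 : ℝ)]
    have hinv : (1 : ℝ) / ((-1) ^ p * ((k : ℝ) + 1) ^ p) = (-1) ^ p * (1 / ((k : ℝ) + 1) ^ p) := by
      rcases neg_one_pow_eq_or ℝ p with h | h <;> rw [h] <;> simp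
    -- Here the parity hypothesis enters: the reflected terms carry the sign `(-1) ^ (p + q)`. With
    -- the opposite parity `quadrantSum` would cancel in the end instead of being doubled.
    have hsign : ((-1 : ℝ) ^ p) * (-1) ^ q = -1 := by rw [← pow_add, hpq.neg_one_pow]
    rw [hinv]
    linear_combination b ^ (k + 1) * (1 / ((k : ℝ) + 1) ^ p) * reflectedSum z q (n * (k + 1)) * hsign
  have hS : Summable (quadrantTerm b n p q z) :=
    Summable.of_norm_bounded ((summable_inv_add_pow le_rfl zero_le_one).mul_left 8)
      fun k => abs_quadrantTerm_le hb hn hp h hρ k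
  have hP : HasSum (fun k : ℕ => b ^ (k + 1) * (1 / ((k : ℝ) + 1) ^ p) *
      (z ^ (n * (k + 1)) * lerchSum z q 0))
      (lerchSum (a ^ n * b * ρ ^ n) p 0 * lerchSum z q 0) := by
    have hcz : |a ^ n * b * ρ ^ n| < 1 := by
      rw [show a ^ n * b * ρ ^ n = b * (a * ρ) ^ n by rw [mul_pow]; ring, abs_mul, abs_eq_one' hb,
        one_mul, abs_pow]
      exact pow_lt_one₀ (abs_nonneg _) hz (by omega)
    have h1 := (hasSum_nat_add_iff' 1).2 (summable_lerchSum hcz p le_rfl).hasSum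
    rw [sum_range_one, Nat.cast_zero, add_zero, zero_pow (by omega), div_zero, sub_zero] at h1
    refine (h1.mul_right (lerchSum z q 0)).congr_fun fun k => ?_
    rw [show a ^ n * b * ρ ^ n = b * z ^ n by rw [hzdef, mul_pow]; ring, mul_pow b, ← pow_mul,
      add_zero]
    push_cast
    ring
  have hGk : HasSum (fun k : ℕ => ∑' j : ℕ, dampedTerm b z n p q k j)
      (∑' l : ℕ, z ^ l * mixedSum b n p q l) := by
    rw [hG]
    exact hall.prod.hasSum
  refine ((hS.hasSum.add (hP.mul_left ((-1) ^ p))).sub hGk).congr_fun fun k => ?_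
  rw [hinner]
  ring

/-! ### The Abel limit of the reflected double sum. -/

theorem abs_lerch_le {a : ℝ} {q : ℕ} (h : LerchConv a q) (N : ℕ) :
    |lerch a q ((N : ℝ) + 1)| ≤ 8 / ((N : ℝ) + 1) := by
  refine le_of_tendsto (lerchSum_tendsto h (by positivity)).abs ?_
  filter_upwards [eventually_mem_Ioo] with σ hσ
  exact abs_lerchSum_le' h N hσ

/-- The value of the double series `∑ b ^ k a ^ l / (k ^ p (n k + l) ^ q)`. -/
noncomputable def quadrantSum (a b : ℝ) (n p q : ℕ) : ℝ :=
  ∑' k : ℕ, b ^ (k + 1) * (1 / ((k : ℝ) + 1) ^ p) *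
    (a * lerch a q (((n * (k + 1) : ℕ) : ℝ) + 1))

theorem hasSum_quadrantSum {a b : ℝ} (hb : b = 1 ∨ b = -1) {n p q : ℕ} (hn : 1 ≤ n)
    (hp : 1 ≤ p) (h : LerchConv a q) :
    HasSum (fun k : ℕ => b ^ (k + 1) * (1 / ((k : ℝ) + 1) ^ p) *
      (a * lerch a q (((n * (k + 1) : ℕ) : ℝ) + 1))) (quadrantSum a b n p q) := by
  refine Summable.hasSum (Summable.of_norm_bounded
    ((summable_inv_add_pow le_rfl zero_le_one).mul_left 8) fun k => ?_)
  have h1 := abs_lerch_le h (n * (k + 1))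
  have hK : (1 : ℝ) ≤ (k : ℝ) + 1 := by have := Nat.cast_nonneg (α := ℝ) k; linarith
  have h4 : (k : ℝ) + 1 ≤ ((n * (k + 1) : ℕ) : ℝ) + 1 := by
    have : (k + 1 : ℕ) ≤ n * (k + 1) := Nat.le_mul_of_pos_left _ hn
    have : ((k + 1 : ℕ) : ℝ) ≤ ((n * (k + 1) : ℕ) : ℝ) := by exact_mod_cast this
    push_cast at *
    linarith
  rw [norm_mul, norm_mul, norm_mul, norm_pow, Real.norm_eq_abs, Real.norm_eq_abs,
    Real.norm_eq_abs, Real.norm_eq_abs, abs_eq_one' hb, one_pow, one_mul, h.abs_eq_one, one_mul,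
    abs_of_nonneg (by positivity : 0 ≤ 1 / ((k : ℝ) + 1) ^ p)]
  have h6 : 1 / ((k : ℝ) + 1) ^ p ≤ 1 / ((k : ℝ) + 1) := by
    gcongr
    calc (k : ℝ) + 1 = ((k : ℝ) + 1) ^ 1 := (pow_one _).symm
      _ ≤ _ := pow_le_pow_right₀ hK hp
  have h7 : 8 / (((n * (k + 1) : ℕ) : ℝ) + 1) ≤ 8 / ((k : ℝ) + 1) := by gcongr
  calc _ ≤ 1 / ((k : ℝ) + 1) * (8 / ((k : ℝ) + 1)) := by
        gcongr
        exact h1.trans h7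
    _ = _ := by field_simp

theorem summable_one_div_rpow : Summable fun k : ℕ => 1 / ((k : ℝ) + 1) ^ (3 / 2 : ℝ) := by
  have h := (summable_nat_add_iff 1).2 (Real.summable_one_div_nat_rpow.2
    (show (1 : ℝ) < 3 / 2 by norm_num))
  simpa using h

theorem hasSum_lerch_zero {c : ℝ} {e : ℕ} (hc : |c| = 1) (he : 2 ≤ e) :
    HasSum (fun k : ℕ => c ^ (k + 1) * (1 / ((k : ℝ) + 1) ^ e)) (lerch c e 0) := by
  have h1 := (hasSum_nat_add_iff' 1).2 (lerch_eq_tsum hc he le_rfl)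
  rw [sum_range_one, Nat.cast_zero, add_zero, zero_pow (by omega), div_zero, sub_zero] at h1
  refine h1.congr_fun fun k => ?_
  rw [add_zero]
  push_cast
  ring

theorem sum_one_div_le_sqrt (M : ℕ) : ∑ m ∈ Icc 1 M, 1 / (m : ℝ) ≤ 2 * √(M : ℝ) := by
  induction M with
  | zero => simp
  | succ M ih =>
    rw [sum_Icc_succ_top (by omega)]
    push_cast
    have h1 := Real.sq_sqrt (show (0 : ℝ) ≤ (M : ℝ) + 1 by positivity)
    have h2 := Real.sq_sqrt (show (0 : ℝ) ≤ M by positivity)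
    have h3 := Real.sqrt_nonneg (M : ℝ)
    have h4 : 1 ≤ √((M : ℝ) + 1) := Real.one_le_sqrt.2 (by have := Nat.cast_nonneg (α := ℝ) M; linarith)
    set s := √((M : ℝ) + 1)
    set t := √(M : ℝ)
    have h5 : 1 / ((M : ℝ) + 1) ≤ 2 * s - 2 * t := by
      rw [← h1, div_le_iff₀ (by positivity)]
      have h6 : (s - t) * (s + t) = 1 := by nlinarith
      have h7 : t ≤ s := by
        by_contra hlt
        push Not at hlt
        nlinarith
      nlinarith [mul_nonneg (sub_nonneg.2 h7) (by linarith : 0 ≤ s - 1)]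
    linarith

/-- The crude bound `√N` for the harmonic sum suffices: for `p ≥ 2` it leads to the summable
majorant `k ^ (-3/2)`, also when `q = 1`. -/
theorem abs_reflectedSum_le {z : ℝ} (hz : |z| ≤ 1) {q : ℕ} (hq : 1 ≤ q) (N : ℕ) :
    |reflectedSum z q N| ≤ 2 * √(N : ℝ) := by
  calc |reflectedSum z q N| ≤ ∑ m ∈ Icc 1 (N - 1), 1 / (m : ℝ) := by
        refine (abs_sum_le_sum_abs _ _).trans (sum_le_sum fun m hm => ?_)
        have hm := (mem_Icc.1 hm).1
        have hm' : (1 : ℝ) ≤ m := by exact_mod_cast hm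
        rw [abs_div, abs_pow, abs_pow, abs_of_pos (by positivity : (0 : ℝ) < m)]
        gcongr
        · exact pow_le_one₀ (abs_nonneg _) hz
        · calc (m : ℝ) = (m : ℝ) ^ 1 := (pow_one _).symm
            _ ≤ _ := pow_le_pow_right₀ hm' hq
    _ ≤ 2 * √((N - 1 : ℕ) : ℝ) := sum_one_div_le_sqrt _
    _ ≤ _ := by
      gcongr
      omega

theorem mul_self_pow {a : ℝ} (ha : a * a = 1) (N : ℕ) : a ^ N * a ^ N = 1 := by
  rw [← mul_pow, ha, one_pow]

theorem pow_sub_of_sq {a : ℝ} (ha : a * a = 1) {N m : ℕ} (h : m ≤ N) :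
    a ^ (N - m) = a ^ N * a ^ m := by
  have : a ^ N = a ^ (N - m) * a ^ m := by rw [← pow_add, Nat.sub_add_cancel h]
  rw [this, mul_assoc, mul_self_pow ha, mul_one]

/-- As `a⁻¹ = a`, the sum is `a ^ N` times the terms `0 < m < N` of the full series, which is
completed by the term `m = N` and the tail `m > N`. -/
theorem reflectedSum_eq_lerch {a : ℝ} {q : ℕ} (h : LerchConv a q) {N : ℕ} (hN : 1 ≤ N) :
    reflectedSum a q N = a ^ N * lerch a q 0 - 1 / (N : ℝ) ^ q - a * lerch a q ((N : ℝ) + 1) := by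
  have ha := h.sq
  have hq := h.1
  have h1 := lerch_eq_sum_add h le_rfl (N + 1)
  obtain ⟨M, rfl⟩ : ∃ M, N = M + 1 := ⟨N - 1, by omega⟩
  have h2 : reflectedSum a q (M + 1) = a ^ (M + 1) * ∑ m ∈ Icc 1 M, a ^ m / (m : ℝ) ^ q := by
    rw [reflectedSum, mul_sum, Nat.add_sub_cancel]
    refine sum_congr rfl fun m hm => ?_
    have := mem_Icc.1 hm
    rw [pow_sub_of_sq ha (by omega)]
    ring
  have h3 : ∑ m ∈ range (M + 1 + 1), a ^ m / ((m : ℝ) + 0) ^ q =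
      ∑ m ∈ Icc 1 M, a ^ m / (m : ℝ) ^ q + a ^ (M + 1) / ((M + 1 : ℕ) : ℝ) ^ q := by
    rw [sum_range_succ, Nat.range_succ_eq_Icc_zero, sum_Icc_zero_eq]
    simp [show q ≠ 0 by omega]
  rw [h3] at h1
  rw [h2, h1, zero_add]
  have h4 := mul_self_pow ha (M + 1)
  rw [pow_succ a (M + 1)]
  push_cast
  linear_combination (-(1 / ((M : ℝ) + 1) ^ q) - a * lerch a q ((M : ℝ) + 1 + 1)) * h4

theorem hasSum_lerch_scaled {b : ℝ} (hb : b = 1 ∨ b = -1) {n p q : ℕ} (hpq : 2 ≤ p + q) :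
    HasSum (fun k : ℕ => b ^ (k + 1) * (1 / ((k : ℝ) + 1) ^ p) *
      (1 / ((n * (k + 1) : ℕ) : ℝ) ^ q)) (1 / (n : ℝ) ^ q * lerch b (p + q) 0) := by
  refine ((hasSum_lerch_zero (abs_eq_one' hb) hpq).mul_left (1 / (n : ℝ) ^ q)).congr_fun fun k => ?_
  push_cast
  rw [mul_pow, pow_add ((k : ℝ) + 1), ← one_div_mul_one_div, ← one_div_mul_one_div]
  ring

theorem tendsto_mul_pow (a : ℝ) (N : ℕ) :
    Tendsto (fun ρ : ℝ => (a * ρ) ^ N) (𝓝[<] 1) (𝓝 (a ^ N)) := by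
  have : Tendsto (fun ρ : ℝ => (a * ρ) ^ N) (𝓝 1) (𝓝 ((a * 1) ^ N)) :=
    ((continuous_const.mul continuous_id).pow N).tendsto 1
  rw [mul_one] at this
  exact this.mono_left nhdsWithin_le_nhds

theorem tendsto_tsum_reflectedSum_of_two_le_left {a b : ℝ} (hb : b = 1 ∨ b = -1) {n p q : ℕ}
    (hn : 1 ≤ n) (hp : 2 ≤ p) (h : LerchConv a q) :
    Tendsto (fun ρ : ℝ => ∑' k : ℕ, b ^ (k + 1) * (1 / ((k : ℝ) + 1) ^ p) *
        reflectedSum (a * ρ) q (n * (k + 1))) (𝓝[<] 1)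
      (𝓝 (lerch (a ^ n * b) p 0 * lerch a q 0 - 1 / (n : ℝ) ^ q * lerch b (p + q) 0 -
        quadrantSum a b n p q)) := by
  have hval : HasSum (fun k : ℕ => b ^ (k + 1) * (1 / ((k : ℝ) + 1) ^ p) *
        reflectedSum a q (n * (k + 1)))
      (lerch (a ^ n * b) p 0 * lerch a q 0 - 1 / (n : ℝ) ^ q * lerch b (p + q) 0 -
        quadrantSum a b n p q) := by
    have hc : |a ^ n * b| = 1 := by
      rw [abs_mul, abs_pow, h.abs_eq_one, abs_eq_one' hb, one_pow, one_mul]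
    have h1 := (hasSum_lerch_zero hc hp).mul_right (lerch a q 0)
    have h2 := hasSum_lerch_scaled hb (n := n) (p := p) (q := q) (by omega)
    have h3 := hasSum_quadrantSum hb hn (by omega : 1 ≤ p) h
    refine ((h1.sub h2).sub h3).congr_fun fun k => ?_
    rw [reflectedSum_eq_lerch h (Nat.mul_pos (by omega) (by omega)), mul_pow (a ^ n), ← pow_mul]
    ring
  rw [← hval.tsum_eq]
  refine tendsto_tsum_of_dominated_convergence
    (bound := fun k : ℕ => 2 * √(n : ℝ) * (1 / ((k : ℝ) + 1) ^ (3 / 2 : ℝ)))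
    (summable_one_div_rpow.mul_left _) (fun k => ?_) ?_
  · refine Tendsto.const_mul _ (tendsto_finsetSum _ fun m _ => ?_)
    exact (tendsto_mul_pow a _).div_const _
  · filter_upwards [eventually_mem_Ioo] with ρ hρ k
    have h1 := abs_reflectedSum_le (abs_mul_lt_one h.abs_eq_one hρ).le h.1 (n * (k + 1))
    have hK : (1 : ℝ) ≤ (k : ℝ) + 1 := by have := Nat.cast_nonneg (α := ℝ) k; linarith
    have hK0 : (0 : ℝ) < (k : ℝ) + 1 := by positivity
    rw [norm_mul, norm_mul, norm_pow, Real.norm_eq_abs, Real.norm_eq_abs, Real.norm_eq_abs,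
      abs_eq_one' hb, one_pow, one_mul, abs_of_nonneg (by positivity : 0 ≤ 1 / ((k : ℝ) + 1) ^ p)]
    have h2 : 1 / ((k : ℝ) + 1) ^ p ≤ 1 / ((k : ℝ) + 1) ^ 2 := by gcongr
    have h3 : √((k : ℝ) + 1) = ((k : ℝ) + 1) ^ (1 / 2 : ℝ) := Real.sqrt_eq_rpow _
    have h4 : ((k : ℝ) + 1) ^ 2 = ((k : ℝ) + 1) ^ (3 / 2 : ℝ) * ((k : ℝ) + 1) ^ (1 / 2 : ℝ) := by
      rw [← Real.rpow_add hK0, ← Real.rpow_natCast]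
      norm_num
    calc _ ≤ 1 / ((k : ℝ) + 1) ^ 2 * (2 * √((n * (k + 1) : ℕ) : ℝ)) := by gcongr
      _ = _ := by
        push_cast
        rw [Real.sqrt_mul (Nat.cast_nonneg n), h4, h3]
        field_simp

/-- For fixed `M`, the damped sum over `k` with `M < n k`. -/
theorem hasSum_damped_tail {b z : ℝ} {n : ℕ} (hn : 1 ≤ n) (p M : ℕ) (hbz : |b * z ^ n| < 1) :
    HasSum (fun k : ℕ => if M < n * (k + 1) then
        b ^ (k + 1) * (1 / ((k : ℝ) + 1) ^ p) * z ^ (n * (k + 1) - M) else 0)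
      (b ^ (M / n + 1) * z ^ (n * (M / n + 1) - M) *
        lerchSum (b * z ^ n) p (((M / n : ℕ) : ℝ) + 1)) := by
  have hM1 : n * (M / n) ≤ M := Nat.mul_div_le M n
  have hM2 : M < n * (M / n + 1) := Nat.lt_mul_div_succ M (by omega)
  rw [← hasSum_nat_add_iff' (M / n), sum_eq_zero, sub_zero]
  · refine ((summable_lerchSum hbz p (by positivity)).hasSum.mul_left _).congr_fun fun s => ?_
    have h1 : M < n * (s + M / n + 1) := by
      have : n * (M / n + 1) ≤ n * (s + M / n + 1) := Nat.mul_le_mul_left n (by omega)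
      omega
    have h2 : n * (s + M / n + 1) - M = (n * (M / n + 1) - M) + n * s := by
      have : n * (s + M / n + 1) = n * (M / n + 1) + n * s := by ring
      omega
    rw [if_pos h1, h2, mul_pow, pow_add z, pow_mul]
    push_cast
    rw [show (s : ℝ) + ((M / n : ℕ) : ℝ) + 1 = s + (((M / n : ℕ) : ℝ) + 1) by ring]
    rw [show s + M / n + 1 = (M / n + 1) + s by ring, pow_add b]
    ring
  · intro k hk
    have hk := mem_range.1 hk
    have : n * (k + 1) ≤ n * (M / n) := Nat.mul_le_mul_left n (by omega)
    rw [if_neg (by omega)]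

theorem sum_range_succ_eq_sum_Icc (f : ℕ → ℝ) (p : ℕ) :
    ∑ j ∈ range p, f (j + 1) = ∑ i ∈ Icc 1 p, f i := by
  induction p with
  | zero => simp
  | succ p ih => rw [sum_range_succ, ih, sum_Icc_succ_top (by omega)]

theorem hasSum_reflectedSum_ite (z : ℝ) (q N : ℕ) :
    HasSum (fun m : ℕ => if m + 1 < N then z ^ (N - (m + 1)) / ((m : ℝ) + 1) ^ q else 0)
      (reflectedSum z q N) := by
  have h1 : reflectedSum z q N = ∑ m ∈ range (N - 1),
      if m + 1 < N then z ^ (N - (m + 1)) / ((m : ℝ) + 1) ^ q else 0 := by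
    rw [reflectedSum, ← sum_range_succ_eq_sum_Icc]
    refine sum_congr rfl fun m hm => ?_
    have := mem_range.1 hm
    rw [if_pos (by omega)]
    push_cast
    rfl
  rw [h1]
  refine hasSum_sum_of_ne_finset_zero fun m hm => ?_
  rw [mem_range] at hm
  rw [if_neg (by omega)]

theorem lerchSum_le {x : ℝ} (hx0 : 0 ≤ x) (hx1 : x < 1) (e : ℕ) {α : ℝ} (hα : 1 ≤ α) :
    0 ≤ lerchSum x e α ∧ lerchSum x e α ≤ (1 - x)⁻¹ := by
  refine ⟨tsum_nonneg fun m => by positivity, ?_⟩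
  rw [← tsum_geometric_of_lt_one hx0 hx1]
  refine (summable_lerchSum (by rwa [abs_of_nonneg hx0]) e (by linarith)).tsum_le_tsum
    (fun m => ?_) (summable_geometric_of_lt_one hx0 hx1)
  refine div_le_self (by positivity) (one_le_pow₀ ?_)
  have := Nat.cast_nonneg (α := ℝ) m
  linarith

/-- The terms of the double series obtained by expanding `reflectedSum`. -/
noncomputable def reflectedTerm (b z : ℝ) (n p q m k : ℕ) : ℝ :=
  1 / ((m : ℝ) + 1) ^ q * if m + 1 < n * (k + 1) then
        b ^ (k + 1) * (1 / ((k : ℝ) + 1) ^ p) * z ^ (n * (k + 1) - (m + 1)) else 0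

theorem norm_reflectedTerm (b z : ℝ) (n p q m k : ℕ) :
    ‖reflectedTerm b z n p q m k‖ = reflectedTerm |b| |z| n p q m k := by
  rw [reflectedTerm, reflectedTerm, norm_mul, Real.norm_of_nonneg (by positivity)]
  split_ifs
  · rw [norm_mul, norm_mul, norm_pow, norm_pow, Real.norm_of_nonneg
      (show 0 ≤ 1 / ((k : ℝ) + 1) ^ p by positivity)]
    rfl
  · simp

theorem summable_reflectedTerm {b z : ℝ} (hb : |b| = 1) (hz : |z| < 1) {n : ℕ} (hn : 1 ≤ n)
    (p : ℕ) {q : ℕ} (hq : 2 ≤ q) : Summable (Function.uncurry (reflectedTerm b z n p q)) := by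
  rw [← summable_norm_iff]
  have hzn : |z| ^ n < 1 := pow_lt_one₀ (abs_nonneg _) hz (by omega)
  have hfib : ∀ m : ℕ, HasSum (fun k => reflectedTerm |b| |z| n p q m k) _ := fun m =>
    (hasSum_damped_tail hn p (m + 1) (b := |b|) (z := |z|) (by
      rw [hb, one_mul, abs_of_nonneg (by positivity)]; exact hzn)).mul_left _
  have hnorm : (fun x : ℕ × ℕ => ‖Function.uncurry (reflectedTerm b z n p q) x‖) =
      fun x => reflectedTerm |b| |z| n p q x.1 x.2 :=
    funext fun x => norm_reflectedTerm b z n p q x.1 x.2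
  rw [hnorm, summable_prod_of_nonneg]
  · refine ⟨fun m => (hfib m).summable, ?_⟩
    have h1 : Summable fun m : ℕ => 1 / ((m : ℝ) + 1) ^ q * (1 - |z| ^ n)⁻¹ :=
      (summable_inv_add_pow hq zero_le_one).mul_right _
    refine Summable.of_nonneg_of_le (fun m => tsum_nonneg fun k => ?_) (fun m => ?_) h1
    · rw [← norm_reflectedTerm]; exact norm_nonneg _
    · rw [(hfib m).tsum_eq, hb, one_pow, one_mul, one_mul]
      have h2 := lerchSum_le (pow_nonneg (abs_nonneg z) n) hzn p
        (α := (((m + 1) / n : ℕ) : ℝ) + 1) (by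
          have := Nat.cast_nonneg (α := ℝ) ((m + 1) / n); linarith)
      gcongr
      calc _ ≤ 1 * lerchSum (|z| ^ n) p ((((m + 1) / n : ℕ) : ℝ) + 1) := by
            gcongr
            · exact h2.1
            · exact pow_le_one₀ (abs_nonneg _) hz.le
        _ ≤ _ := by rw [one_mul]; exact h2.2
  · intro x
    dsimp only [Pi.zero_apply]
    rw [← norm_reflectedTerm]; exact norm_nonneg _

/-- Serves the case `p = 1`, where the majorant in `k` is not summable. After the exchange the outer
sum runs over `m` with weight `1 / m ^ q`, `q ≥ 2`, and the inner one is a Lerch tail bounded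
uniformly in the damping. -/
theorem tsum_reflectedSum_comm {b z : ℝ} (hb : |b| = 1) (hz : |z| < 1) {n : ℕ} (hn : 1 ≤ n)
    (p : ℕ) {q : ℕ} (hq : 2 ≤ q) :
    ∑' k : ℕ, b ^ (k + 1) * (1 / ((k : ℝ) + 1) ^ p) * reflectedSum z q (n * (k + 1)) =
      ∑' m : ℕ, 1 / ((m : ℝ) + 1) ^ q * (b ^ ((m + 1) / n + 1) *
        z ^ (n * ((m + 1) / n + 1) - (m + 1)) *
        lerchSum (b * z ^ n) p ((((m + 1) / n : ℕ) : ℝ) + 1)) := by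
  have hzn : |b * z ^ n| < 1 := by
    rw [abs_mul, hb, one_mul, abs_pow]; exact pow_lt_one₀ (abs_nonneg _) hz (by omega)
  have h1 : ∀ k : ℕ, ∑' m, reflectedTerm b z n p q m k =
      b ^ (k + 1) * (1 / ((k : ℝ) + 1) ^ p) * reflectedSum z q (n * (k + 1)) := by
    intro k
    rw [← (hasSum_reflectedSum_ite z q (n * (k + 1))).tsum_eq, ← tsum_mul_left]
    refine tsum_congr fun m => ?_
    rw [reflectedTerm]
    split_ifs
    · ring
    · simp
  simp only [← h1]
  rw [Summable.tsum_comm (summable_reflectedTerm hb hz hn p hq)]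
  refine tsum_congr fun m => ?_
  exact ((hasSum_damped_tail hn p (m + 1) hzn).mul_left _).tsum_eq

/-- The terms with `n k ≤ m` of the product of two Lerch series. -/
noncomputable def triangleTerm (a c : ℝ) (n p q m k : ℕ) : ℝ :=
  if n * (k + 1) ≤ m + 1 then
    c ^ (k + 1) * (1 / ((k : ℝ) + 1) ^ p) * (a ^ (m + 1) * (1 / ((m : ℝ) + 1) ^ q)) else 0

/-- Since `k ≤ m` on the support, half a power moves from `m` to `k`: `k m² ≥ k ^ (3/2) m ^ (3/2)`.
-/
theorem summable_triangleTerm {a c : ℝ} (ha : |a| = 1) (hc : |c| = 1) {n p q : ℕ} (hn : 1 ≤ n)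
    (hp : 1 ≤ p) (hq : 2 ≤ q) : Summable (Function.uncurry (triangleTerm a c n p q)) := by
  refine Summable.of_norm_bounded (summable_one_div_rpow.mul_of_nonneg summable_one_div_rpow
    (fun k => by positivity) (fun k => by positivity)) fun x => ?_
  obtain ⟨m, k⟩ := x
  simp only [Function.uncurry_apply_pair, triangleTerm]
  split_ifs with h
  · have hkm : (k : ℝ) + 1 ≤ (m : ℝ) + 1 := by
      have : k + 1 ≤ m + 1 := (Nat.le_mul_of_pos_left _ hn).trans h
      exact_mod_cast this
    have hk0 : (0 : ℝ) < (k : ℝ) + 1 := by positivity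
    have hm0 : (0 : ℝ) < (m : ℝ) + 1 := by positivity
    have hk1 : (1 : ℝ) ≤ (k : ℝ) + 1 := by have := Nat.cast_nonneg (α := ℝ) k; linarith
    have hm1 : (1 : ℝ) ≤ (m : ℝ) + 1 := hk1.trans hkm
    rw [norm_mul, norm_mul, norm_mul, norm_pow, norm_pow, Real.norm_eq_abs c, Real.norm_eq_abs a, ha, hc,
      one_pow, one_pow, one_mul, one_mul, Real.norm_of_nonneg (by positivity),
      Real.norm_of_nonneg (by positivity), one_div_mul_one_div, one_div_mul_one_div]
    have e1 : ((m : ℝ) + 1) ^ 2 = ((m : ℝ) + 1) ^ (3 / 2 : ℝ) * ((m : ℝ) + 1) ^ (1 / 2 : ℝ) := by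
      rw [← Real.rpow_add hm0, ← Real.rpow_natCast]
      norm_num
    have e2 : ((k : ℝ) + 1) ^ (3 / 2 : ℝ) = ((k : ℝ) + 1) * ((k : ℝ) + 1) ^ (1 / 2 : ℝ) := by
      rw [show (3 / 2 : ℝ) = 1 + 1 / 2 by norm_num, Real.rpow_add hk0, Real.rpow_one]
    refine one_div_le_one_div_of_le (by positivity) ?_
    calc ((m : ℝ) + 1) ^ (3 / 2 : ℝ) * ((k : ℝ) + 1) ^ (3 / 2 : ℝ)
        = ((k : ℝ) + 1) * (((m : ℝ) + 1) ^ (3 / 2 : ℝ) * ((k : ℝ) + 1) ^ (1 / 2 : ℝ)) := by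
          rw [e2]; ring
      _ ≤ ((k : ℝ) + 1) * (((m : ℝ) + 1) ^ (3 / 2 : ℝ) * ((m : ℝ) + 1) ^ (1 / 2 : ℝ)) := by gcongr
      _ = ((k : ℝ) + 1) ^ 1 * ((m : ℝ) + 1) ^ 2 := by rw [e1, pow_one]
      _ ≤ _ := by gcongr
  · rw [norm_zero]
    positivity

theorem hasSum_lerch_tail {a : ℝ} {q : ℕ} (h : LerchConv a q) (hq : 2 ≤ q) {N : ℕ} (hN : 1 ≤ N) :
    HasSum (fun m : ℕ => if N ≤ m + 1 then a ^ (m + 1) * (1 / ((m : ℝ) + 1) ^ q) else 0)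
      (a ^ N * (1 / (N : ℝ) ^ q + a * lerch a q ((N : ℝ) + 1))) := by
  obtain ⟨M, rfl⟩ : ∃ M, N = M + 1 := ⟨N - 1, by omega⟩
  have h0 := lerch_eq_sum_add h (show (0 : ℝ) ≤ ((M + 1 : ℕ) : ℝ) by positivity) 1
  have h1 : 1 / ((M + 1 : ℕ) : ℝ) ^ q + a * lerch a q (((M + 1 : ℕ) : ℝ) + 1) =
      lerch a q ((M + 1 : ℕ) : ℝ) := by
    rw [h0]
    simp
  rw [h1, ← hasSum_nat_add_iff' M, sum_eq_zero, sub_zero]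
  · refine ((lerch_eq_tsum h.abs_eq_one hq (by positivity)).mul_left _).congr_fun fun s => ?_
    rw [if_pos (by omega)]
    push_cast
    rw [show (s : ℝ) + M + 1 = s + (M + 1) by ring, show s + M + 1 = (M + 1) + s by ring, pow_add]
    ring
  · intro m hm
    have := mem_range.1 hm
    rw [if_neg (by omega)]

theorem hasSum_triangle_fiber {a c : ℝ} {n : ℕ} (hn : 1 ≤ n) (p q m : ℕ) :
    HasSum (triangleTerm a c n p q m)
      (a ^ (m + 1) * (1 / ((m : ℝ) + 1) ^ q) * ∑ k ∈ Icc 1 ((m + 1) / n), c ^ k / (k : ℝ) ^ p) := by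
  have h1 : a ^ (m + 1) * (1 / ((m : ℝ) + 1) ^ q) * ∑ k ∈ Icc 1 ((m + 1) / n), c ^ k / (k : ℝ) ^ p =
      ∑ k ∈ range ((m + 1) / n), triangleTerm a c n p q m k := by
    rw [← sum_range_succ_eq_sum_Icc, mul_sum]
    refine sum_congr rfl fun k hk => ?_
    have hk := mem_range.1 hk
    have : n * (k + 1) ≤ m + 1 := by
      rw [mul_comm]; exact (Nat.le_div_iff_mul_le (by omega)).1 hk
    rw [triangleTerm, if_pos this]
    push_cast
    ring
  rw [h1]
  refine hasSum_sum_of_ne_finset_zero fun k hk => ?_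
  rw [mem_range, not_lt] at hk
  rw [triangleTerm, if_neg]
  intro hle
  have : k + 1 ≤ (m + 1) / n := (Nat.le_div_iff_mul_le (by omega)).2 (by rwa [mul_comm] at hle)
  omega

theorem tendsto_tsum_reflectedSum_of_two_le_right {a b : ℝ} (hb : b = 1 ∨ b = -1) {n p q : ℕ}
    (hn : 1 ≤ n) (hq : 2 ≤ q) (h : LerchConv a q) (hcp : LerchConv (a ^ n * b) p) :
    Tendsto (fun ρ : ℝ => ∑' k : ℕ, b ^ (k + 1) * (1 / ((k : ℝ) + 1) ^ p) *
        reflectedSum (a * ρ) q (n * (k + 1))) (𝓝[<] 1)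
      (𝓝 (lerch (a ^ n * b) p 0 * lerch a q 0 - 1 / (n : ℝ) ^ q * lerch b (p + q) 0 -
        quadrantSum a b n p q)) := by
  set c := a ^ n * b with hc
  have hp := hcp.1
  have ha := h.sq
  have hlim : Tendsto (fun ρ : ℝ => ∑' m : ℕ, 1 / ((m : ℝ) + 1) ^ q * (b ^ ((m + 1) / n + 1) *
        (a * ρ) ^ (n * ((m + 1) / n + 1) - (m + 1)) *
        lerchSum (c * ρ ^ n) p ((((m + 1) / n : ℕ) : ℝ) + 1))) (𝓝[<] 1)
      (𝓝 (∑' m : ℕ, 1 / ((m : ℝ) + 1) ^ q * (b ^ ((m + 1) / n + 1) *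
        a ^ (n * ((m + 1) / n + 1) - (m + 1)) *
        lerch c p ((((m + 1) / n : ℕ) : ℝ) + 1)))) := by
    refine tendsto_tsum_of_dominated_convergence (bound := fun m : ℕ => 1 / ((m : ℝ) + 1) ^ q * 8)
      ((summable_inv_add_pow hq zero_le_one).mul_right _) (fun m => ?_) ?_
    · refine Tendsto.const_mul _ (Tendsto.mul (Tendsto.const_mul _ (tendsto_mul_pow a _)) ?_)
      exact (lerchSum_tendsto hcp (by positivity)).comp (tendsto_pow_nhdsLT_one hn)
    · filter_upwards [eventually_mem_Ioo] with ρ hρ m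
      have hρn : ρ ^ n ∈ Ioo (0 : ℝ) 1 := ⟨pow_pos hρ.1 n, pow_lt_one₀ hρ.1.le hρ.2 (by omega)⟩
      have h1 := abs_lerchSum_le' hcp ((m + 1) / n) hρn
      have h2 : 8 / ((((m + 1) / n : ℕ) : ℝ) + 1) ≤ 8 := by
        refine div_le_self (by norm_num) ?_
        have := Nat.cast_nonneg (α := ℝ) ((m + 1) / n)
        linarith
      rw [norm_mul, norm_mul, norm_mul, norm_pow, norm_pow, Real.norm_of_nonneg (by positivity),
        Real.norm_eq_abs, Real.norm_eq_abs, Real.norm_eq_abs, abs_eq_one' hb, one_pow, one_mul]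
      gcongr
      calc _ ≤ 1 * |lerchSum (c * ρ ^ n) p ((((m + 1) / n : ℕ) : ℝ) + 1)| := by
            gcongr
            exact pow_le_one₀ (abs_nonneg _) (abs_mul_lt_one h.abs_eq_one hρ).le
        _ ≤ 8 := by rw [one_mul]; exact h1.trans h2
  have hval : HasSum (fun m : ℕ => 1 / ((m : ℝ) + 1) ^ q * (b ^ ((m + 1) / n + 1) *
        a ^ (n * ((m + 1) / n + 1) - (m + 1)) *
        lerch c p ((((m + 1) / n : ℕ) : ℝ) + 1)))
      (lerch c p 0 * lerch a q 0 - 1 / (n : ℝ) ^ q * lerch b (p + q) 0 -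
        quadrantSum a b n p q) := by
    have hs := summable_triangleTerm h.abs_eq_one hcp.abs_eq_one (p := p) (q := q) hn hp hq
    have h1 := (hasSum_lerch_zero h.abs_eq_one hq).mul_right (lerch c p 0)
    -- The part `n k ≤ m` of the product of the two single series, summed over `m` first: the term
    -- `m = n k` gives the diagonal and the terms `m > n k` give `quadrantSum`.
    have h2 : HasSum (fun m : ℕ => a ^ (m + 1) * (1 / ((m : ℝ) + 1) ^ q) *
        ∑ k ∈ Icc 1 ((m + 1) / n), c ^ k / (k : ℝ) ^ p)
        (1 / (n : ℝ) ^ q * lerch b (p + q) 0 + quadrantSum a b n p q) := by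
      have h3 : ∑' k, ∑' m, triangleTerm a c n p q m k =
          1 / (n : ℝ) ^ q * lerch b (p + q) 0 + quadrantSum a b n p q := by
        refine (((hasSum_lerch_scaled hb (n := n) (p := p) (q := q) (by omega)).add
          (hasSum_quadrantSum hb hn hp h)).congr_fun fun k => ?_).tsum_eq
        have hN : 1 ≤ n * (k + 1) := Nat.mul_pos (by omega) (by omega)
        have h4 := ((hasSum_lerch_tail h hq hN).mul_left
          (c ^ (k + 1) * (1 / ((k : ℝ) + 1) ^ p))).tsum_eq
        have h5 : ∑' m, triangleTerm a c n p q m k = c ^ (k + 1) * (1 / ((k : ℝ) + 1) ^ p) *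
            (a ^ (n * (k + 1)) * (1 / ((n * (k + 1) : ℕ) : ℝ) ^ q +
              a * lerch a q (((n * (k + 1) : ℕ) : ℝ) + 1))) := by
          rw [← h4]
          refine tsum_congr fun m => ?_
          rw [triangleTerm]
          split_ifs
          · rfl
          · simp
        rw [h5, hc, mul_pow, ← pow_mul]
        have h6 := mul_self_pow ha (n * (k + 1))
        linear_combination (b ^ (k + 1) * (1 / ((k : ℝ) + 1) ^ p) *
          (1 / ((n * (k + 1) : ℕ) : ℝ) ^ q + a * lerch a q (((n * (k + 1) : ℕ) : ℝ) + 1))) * h6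
      rw [← h3, Summable.tsum_comm hs]
      have h4 := hs.prod.hasSum
      refine h4.congr_fun fun m => ?_
      exact (hasSum_triangle_fiber hn p q m).tsum_eq.symm
    have h3 := h1.sub h2
    rw [show lerch c p 0 * lerch a q 0 - 1 / (n : ℝ) ^ q * lerch b (p + q) 0 -
        quadrantSum a b n p q = lerch a q 0 * lerch c p 0 -
        (1 / (n : ℝ) ^ q * lerch b (p + q) 0 + quadrantSum a b n p q) by ring]
    refine h3.congr_fun fun m => ?_
    have hM2 : m + 1 < n * ((m + 1) / n + 1) := Nat.lt_mul_div_succ (m + 1) (by omega)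
    have h4 := lerch_eq_sum_add hcp le_rfl ((m + 1) / n + 1)
    have h5 : ∑ k ∈ range ((m + 1) / n + 1), c ^ k / ((k : ℝ) + 0) ^ p =
        ∑ k ∈ Icc 1 ((m + 1) / n), c ^ k / (k : ℝ) ^ p := by
      rw [Nat.range_succ_eq_Icc_zero, sum_Icc_zero_eq]
      simp [show p ≠ 0 by omega]
    rw [h5, zero_add] at h4
    rw [h4, pow_sub_of_sq ha hM2.le]
    have h6 : c ^ ((m + 1) / n + 1) = a ^ (n * ((m + 1) / n + 1)) * b ^ ((m + 1) / n + 1) := by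
      rw [hc, mul_pow, ← pow_mul]
    rw [h6]
    push_cast
    ring
  rw [← hval.tsum_eq]
  refine hlim.congr' ?_
  filter_upwards [eventually_mem_Ioo] with ρ hρ
  rw [tsum_reflectedSum_comm (abs_eq_one' hb) (abs_mul_lt_one h.abs_eq_one hρ) hn p hq]
  refine tsum_congr fun m => ?_
  rw [show b * (a * ρ) ^ n = c * ρ ^ n by rw [hc, mul_pow]; ring]

/-! ### The parity theorem and the evaluation of its right-hand side. -/

/-- The parity theorem for the double series `∑ b ^ k a ^ l / (k ^ p (n k + l) ^ q)`. -/
theorem two_mul_quadrantSum {a b : ℝ} (hb : b = 1 ∨ b = -1) {n p q : ℕ} (hn : 1 ≤ n)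
    (h : LerchConv a q) (hcp : LerchConv (a ^ n * b) p) (hpq : Odd (p + q)) :
    2 * quadrantSum a b n p q = mixedLimit a b n p q +
      (1 - (-1) ^ p) * (lerch (a ^ n * b) p 0 * lerch a q 0) -
      1 / (n : ℝ) ^ q * lerch b (p + q) 0 := by
  have hp := hcp.1
  have hq := h.1
  have h1 : Tendsto (fun ρ : ℝ => ∑' k : ℕ, b ^ (k + 1) * (1 / ((k : ℝ) + 1) ^ p) *
        reflectedSum (a * ρ) q (n * (k + 1))) (𝓝[<] 1)
      (𝓝 (lerch (a ^ n * b) p 0 * lerch a q 0 - 1 / (n : ℝ) ^ q * lerch b (p + q) 0 -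
        quadrantSum a b n p q)) := by
    rcases Nat.lt_or_ge p 2 with hp2 | hp2
    -- Here `p = 1`, so `q` is even and hence at least `2`.
    · refine tendsto_tsum_reflectedSum_of_two_le_right hb hn ?_ h hcp
      obtain ⟨k, hk⟩ := hpq
      omega
    · exact tendsto_tsum_reflectedSum_of_two_le_left hb hn hp2 h
  have h2 := ((tendsto_tsum_quadrantTerm hb hn hp h).add
    ((((lerchSum_tendsto hcp le_rfl).comp (tendsto_pow_nhdsLT_one hn)).mul
      (lerchSum_tendsto h le_rfl)).const_mul ((-1) ^ p))).sub
    (tendsto_tsum_mixedSum h.sq hb hn h hcp)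
  -- Two evaluations of the same Abel limit, in which `quadrantSum` occurs with opposite signs.
  have h3 := tendsto_nhds_unique h1 (h2.congr' (by
    filter_upwards [eventually_mem_Ioo] with ρ hρ
    exact ((hasSum_reflectedSum hb hn hp h hpq hρ).tsum_eq).symm))
  change _ = quadrantSum a b n p q + _ - _ at h3
  linear_combination -h3

theorem theta_sub {b : ℝ} (hb : b = 1 ∨ b = -1) (i : ℕ) {r s : ℝ} (hr : r ≠ 0) :
    theta b i (r - s) r = (-1) ^ i * b * theta b i s r := by
  rw [theta, theta]
  split_ifs with h
  · obtain ⟨rfl, rfl⟩ := h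
    rw [show Real.pi * (r - s) / r = Real.pi - Real.pi * s / r by field_simp,
      Real.cot_eq_cos_div_sin, Real.cot_eq_cos_div_sin, Real.cos_pi_sub, Real.sin_pi_sub]
    ring
  · have h1 : ((-1 : ℝ) ^ i) * (-1) ^ i = 1 := by rw [← mul_pow]; simp
    have h2 := sq_eq_one hb
    rw [sub_sub_cancel]
    linear_combination (-(b * b) * lerch b i ((r - s) / r)) * h1 - lerch b i ((r - s) / r) * h2

theorem residueLerch_multInd (a b : ℝ) {n : ℕ} (hn : 1 ≤ n) (e : ℕ) :
    residueLerch a b n (multInd b n) e = 1 / (n : ℝ) ^ e * lerch (a ^ n * b) e 0 := by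
  rw [residueLerch, sum_eq_single_of_mem 0 (mem_range.2 hn)]
  · simp [multInd]
  · intro r hr h0
    have : ¬ n ∣ r := fun h => absurd (Nat.le_of_dvd (by omega) h) (by have := mem_range.1 hr; omega)
    simp [multInd, this]

/-- The residue `0` gives the even-order Lerch values, the others `theta`. The substitution `r = n -
j + 1` and the reflection `theta_sub` lead to the argument `j - 1`. -/
theorem residueLerch_bilatSum {a b : ℝ} (ha : a * a = 1) (hb : b = 1 ∨ b = -1) {n : ℕ} (hn : 1 ≤ n)
    {i : ℕ} (hi : 1 ≤ i) (e : ℕ) :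
    residueLerch a b n (fun l => bilatSum b n i l) e = 1 / (n : ℝ) ^ (i + e) *
      ((1 + (-1) ^ i) * (b * lerch b i 1) * lerch (a ^ n * b) e 0 +
        a * a ^ n * b * ∑ j ∈ Icc 2 n, a ^ j * (-1) ^ i * theta b i ((j : ℝ) - 1) n *
          lerch (a ^ n * b) e (((n : ℝ) - j + 1) / n)) := by
  have hn0 : (n : ℝ) ≠ 0 := by positivity
  have hrange : range n = insert 0 (Icc 1 (n - 1)) := by ext; simp; omega
  rw [residueLerch, hrange, sum_insert (by simp), mul_add, mul_sum, mul_sum]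
  congr 1
  · rw [Nat.cast_zero, bilatSum_zero hb hn hi, pow_zero, zero_div, pow_add, ← one_div_mul_one_div]
    ring
  · refine sum_nbij' (fun r => n - r + 1) (fun j => n - j + 1) ?_ ?_ ?_ ?_ ?_
    · intro r hr; rw [mem_Icc] at hr ⊢; omega
    · intro r hr; rw [mem_Icc] at hr ⊢; omega
    · intro r hr; rw [mem_Icc] at hr; omega
    · intro r hr; rw [mem_Icc] at hr; omega
    · intro r hr
      rw [mem_Icc] at hr
      have hr0 : (0 : ℝ) < r := by exact_mod_cast hr.1
      have hrn : (r : ℝ) < n := by exact_mod_cast (by omega : r < n)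
      have hcast : (((n - r + 1 : ℕ) : ℝ)) = n - r + 1 := by
        rw [Nat.cast_add, Nat.cast_sub (by omega), Nat.cast_one]
      rw [bilatSum_eq_theta hb hn hi hr0 hrn, hcast, show (n : ℝ) - r + 1 - 1 = n - r by ring,
        show (n : ℝ) - (n - r + 1) + 1 = r by ring, theta_sub hb i hn0, pow_add (n : ℝ),
        ← one_div_mul_one_div]
      have h1 : ((-1 : ℝ) ^ i) * (-1) ^ i = 1 := by rw [← mul_pow]; simp
      have h2 := sq_eq_one hb
      have h3 : a * a ^ n * a ^ (n - r + 1) = a ^ r := by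
        have : a * a ^ n * a ^ (n - r + 1) = (a * a) ^ (n - r + 1) * a ^ r := by
          rw [mul_pow, ← pow_add, ← pow_add, ← pow_succ', ← pow_add]
          congr 1; omega
        rw [this, ha, one_pow, one_mul]
      rw [← h3]
      linear_combination (-(a * a ^ n * a ^ (n - r + 1)) * (1 / (n : ℝ) ^ i) * (1 / (n : ℝ) ^ e) *
        theta b i r n * lerch (a ^ n * b) e (r / n)) * (h1 * b * b + h2)

theorem zpow_neg_natCast_eq (x : ℝ) (k : ℕ) : x ^ (-(k : ℤ)) = 1 / x ^ k := by
  rw [zpow_neg, one_div, zpow_natCast]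

theorem zpow_neg_two_mul (x : ℝ) (k : ℕ) : x ^ (-(2 * k : ℤ)) = 1 / x ^ (2 * k) := by
  rw [← zpow_neg_natCast_eq, Nat.cast_mul, Nat.cast_ofNat]

theorem neg_pow_sub_two_mul {x : ℝ} (hx : x ≠ 0) {p k : ℕ} (h : 2 * k ≤ p) :
    (-x) ^ (p - 2 * k) = (-1) ^ p * x ^ p * x ^ (-(2 * k : ℤ)) := by
  rw [zpow_neg_two_mul, mul_one_div, eq_div_iff (pow_ne_zero _ hx), ← (even_two_mul k).neg_pow,
    ← pow_add, Nat.sub_add_cancel h, ← mul_pow, neg_one_mul]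

theorem mul_lerch_zero_one {b : ℝ} (hb : b = 1 ∨ b = -1) : 2 * (b * lerch b 0 1) = -1 := by
  rcases hb with rfl | rfl <;> norm_num [lerch]

theorem sum_even_mul_lerch {a b : ℝ} {n p q : ℕ} (hn : 1 ≤ n) (h : LerchConv a q) :
    ∑ i ∈ Icc 1 p, ((p + q - i - 1).choose (q - 1) : ℝ) * (-n : ℝ) ^ (p - i) *
      ((1 + (-1) ^ i) * (b * lerch b i 1)) * lerch a (p + q - i) 0 =
    2 * a * b * ((-1) ^ p * (n : ℝ) ^ p) * ∑ k ∈ Icc 1 (p / 2),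
      ((p + q - 2 * k - 1).choose (q - 1) : ℝ) * (n : ℝ) ^ (-(2 * k : ℤ)) * lerch b (2 * k) 1 *
        lerch a (p + q - 2 * k) 1 := by
  have hn0 : (n : ℝ) ≠ 0 := by positivity
  trans ∑ i ∈ Icc 1 p, (1 + (-1) ^ i) * (((p + q - i - 1).choose (q - 1) : ℝ) *
    (-n : ℝ) ^ (p - i) * (b * lerch b i 1) * (a * lerch a (p + q - i) 1))
  · refine sum_congr rfl fun i hi => ?_
    rw [mem_Icc] at hi
    rw [lerch_zero (h.mono (by omega))]
    ring
  · rw [sum_even_terms p (fun i => ((p + q - i - 1).choose (q - 1) : ℝ) *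
      (-n : ℝ) ^ (p - i) * (b * lerch b i 1) * (a * lerch a (p + q - i) 1)), mul_sum, mul_sum]
    refine sum_congr rfl fun k hk => ?_
    rw [mem_Icc] at hk
    rw [neg_pow_sub_two_mul hn0 (by omega)]
    ring

theorem sum_choose_mul_residueLerch {a b : ℝ} (ha : a * a = 1) (hb : b = 1 ∨ b = -1) {n p q : ℕ}
    (hn : 1 ≤ n) (h : LerchConv (a ^ n * b) p) :
    ∑ i ∈ Icc 1 q, ((p + q - i - 1).choose (p - 1) : ℝ) *
      residueLerch a b n (fun l => bilatSum b n i l) (p + q - i) =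
    1 / (n : ℝ) ^ (p + q) * (2 * a ^ n * ∑ j ∈ Icc 1 (q / 2),
      ((p + q - 2 * j - 1).choose (p - 1) : ℝ) * lerch b (2 * j) 1 *
        lerch (a ^ n * b) (p + q - 2 * j) 1 +
      a * a ^ n * b * ∑ j ∈ Icc 2 n, ∑ k ∈ Icc 1 q, ((p + q - k - 1).choose (p - 1) : ℝ) * a ^ j *
        (-1) ^ k * theta b k ((j : ℝ) - 1) n *
          lerch (a ^ n * b) (p + q - k) (((n : ℝ) - j + 1) / n)) := by
  have h1 : 2 * a ^ n * ∑ j ∈ Icc 1 (q / 2), ((p + q - 2 * j - 1).choose (p - 1) : ℝ) *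
      lerch b (2 * j) 1 * lerch (a ^ n * b) (p + q - 2 * j) 1 =
      ∑ i ∈ Icc 1 q, (1 + (-1) ^ i) * (a ^ n * (((p + q - i - 1).choose (p - 1) : ℝ) *
        lerch b i 1 * lerch (a ^ n * b) (p + q - i) 1)) := by
    rw [sum_even_terms q (fun i => a ^ n * (((p + q - i - 1).choose (p - 1) : ℝ) *
        lerch b i 1 * lerch (a ^ n * b) (p + q - i) 1)), ← mul_sum]
    ring
  rw [h1, sum_comm (s := Icc 2 n), mul_sum, ← sum_add_distrib, mul_sum]
  refine sum_congr rfl fun i hi => ?_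
  rw [mem_Icc] at hi
  rw [residueLerch_bilatSum ha hb hn hi.1, lerch_zero (h.mono (by omega)),
    show i + (p + q - i) = p + q by omega]
  have h2 : ∑ j ∈ Icc 2 n, ((p + q - i - 1).choose (p - 1) : ℝ) * a ^ j *
        (-1) ^ i * theta b i ((j : ℝ) - 1) n *
          lerch (a ^ n * b) (p + q - i) (((n : ℝ) - j + 1) / n) =
      ((p + q - i - 1).choose (p - 1) : ℝ) * ∑ j ∈ Icc 2 n, a ^ j *
        (-1) ^ i * theta b i ((j : ℝ) - 1) n *
          lerch (a ^ n * b) (p + q - i) (((n : ℝ) - j + 1) / n) := by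
    rw [mul_sum]
    exact sum_congr rfl fun j _ => by ring
  rw [h2]
  linear_combination (1 / (n : ℝ) ^ (p + q) * (1 + (-1) ^ i) * a ^ n * lerch b i 1 *
    lerch (a ^ n * b) (p + q - i) 1 * ((p + q - i - 1).choose (p - 1) : ℝ)) * sq_eq_one hb

/-- The corrections of order `p + q`, for the index `0` and for the excluded index `-l / n`, become
the summands `k = 0` and `j = 0` by the hockey stick identity and `lerch b 0 1 = -b / 2`. -/
theorem mul_mixedLimit {a b : ℝ} (hb : b = 1 ∨ b = -1) {n p q : ℕ} (hn : 1 ≤ n)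
    (h : LerchConv a q) (hc : LerchConv (a ^ n * b) p) :
    a * mixedLimit a b n p q = 2 * (-1) ^ p *
      (a ^ (n - 1) * (n : ℝ) ^ (-(q : ℤ)) *
        ∑ j ∈ Icc 0 (q / 2), ((p + q - 2 * j - 1).choose (p - 1) : ℝ) * lerch b (2 * j) 1 *
          lerch (a ^ n * b) (p + q - 2 * j) 1 +
      b * (n : ℝ) ^ p * ∑ k ∈ Icc 0 (p / 2), ((p + q - 2 * k - 1).choose (q - 1) : ℝ) *
        (n : ℝ) ^ (-(2 * k : ℤ)) * lerch b (2 * k) 1 * lerch a (p + q - 2 * k) 1 +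
      1 / 2 * a ^ n * b * (n : ℝ) ^ (-(q : ℤ)) *
        ∑ j ∈ Icc 2 n, ∑ k ∈ Icc 1 q, ((p + q - k - 1).choose (p - 1) : ℝ) * a ^ j *
          (-1) ^ k * theta b k ((j : ℝ) - 1) n *
            lerch (a ^ n * b) (p + q - k) (((n : ℝ) - j + 1) / n)) := by
  have hn0 : (n : ℝ) ≠ 0 := by positivity
  have hp := hc.1
  have hq := h.1
  have hcomm : ∑ i ∈ Icc 1 q, ((p + q - i - 1).choose (p - 1) : ℝ) =
      ((p + q - 1).choose p : ℝ) := by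
    rw [add_comm p q]; exact sum_choose_Icc q hp
  have hsplit : ∑ i ∈ Icc 1 q, (-n : ℝ) ^ p * ((p + q - i - 1).choose (p - 1) : ℝ) *
      (residueLerch a b n (fun l => bilatSum b n i l) (p + q - i) - lerch a (p + q) 0) =
      (-n : ℝ) ^ p * (∑ i ∈ Icc 1 q, ((p + q - i - 1).choose (p - 1) : ℝ) *
        residueLerch a b n (fun l => bilatSum b n i l) (p + q - i) -
        ((p + q - 1).choose p : ℝ) * lerch a (p + q) 0) := by
    rw [← hcomm, sum_mul, ← sum_sub_distrib, mul_sum]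
    exact sum_congr rfl fun i _ => by ring
  have hsym1 : (p + q - 1).choose q = (p + q - 1).choose (p - 1) :=
    Nat.choose_symm_of_eq_add (by omega)
  have hsym2 : (p + q - 1).choose p = (p + q - 1).choose (q - 1) :=
    Nat.choose_symm_of_eq_add (by omega)
  have hapow : a ^ n = a * a ^ (n - 1) := by rw [← pow_succ', Nat.sub_add_cancel hn]
  rw [mixedLimit, hsplit, sum_even_mul_lerch hn h, sum_choose_mul_residueLerch h.sq hb hn hc,
    residueLerch_multInd a b hn, lerch_zero (h.mono (by omega)), lerch_zero (hc.mono (by omega)),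
    sum_Icc_zero_eq (fun j => ((p + q - 2 * j - 1).choose (p - 1) : ℝ) * lerch b (2 * j) 1 *
          lerch (a ^ n * b) (p + q - 2 * j) 1),
    sum_Icc_zero_eq (fun k => ((p + q - 2 * k - 1).choose (q - 1) : ℝ) *
        (n : ℝ) ^ (-(2 * k : ℤ)) * lerch b (2 * k) 1 * lerch a (p + q - 2 * k) 1),
    hsym1, hsym2, zpow_neg_natCast_eq]
  simp only [Nat.sub_zero, Nat.cast_zero, mul_zero, neg_zero, zpow_zero, mul_one]
  rw [neg_pow, pow_add (n : ℝ), ← one_div_mul_one_div]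
  have hnp : (n : ℝ) ^ p * (1 / (n : ℝ) ^ p) = 1 := mul_one_div_cancel (pow_ne_zero _ hn0)
  have ha := h.sq
  have hb2 := sq_eq_one hb
  have hb0 := mul_lerch_zero_one hb
  set S1 := ∑ j ∈ Icc 1 (q / 2), ((p + q - 2 * j - 1).choose (p - 1) : ℝ) *
      lerch b (2 * j) 1 * lerch (a ^ n * b) (p + q - 2 * j) 1
  set S2 := ∑ k ∈ Icc 1 (p / 2), ((p + q - 2 * k - 1).choose (q - 1) : ℝ) *
        (n : ℝ) ^ (-(2 * k : ℤ)) * lerch b (2 * k) 1 * lerch a (p + q - 2 * k) 1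
  set S3 := ∑ j ∈ Icc 2 n, ∑ k ∈ Icc 1 q, ((p + q - k - 1).choose (p - 1) : ℝ) * a ^ j *
          (-1) ^ k * theta b k ((j : ℝ) - 1) n *
            lerch (a ^ n * b) (p + q - k) (((n : ℝ) - j + 1) / n)
  have hlb : lerch b 0 1 = -(b / 2) := by
    linear_combination (-(lerch b 0 1)) * hb2 + b / 2 * hb0
  have haa : a * a ^ n = a ^ (n - 1) := by rw [hapow, ← mul_assoc, ha, one_mul]
  set P := (n : ℝ) ^ p
  set P' := 1 / (n : ℝ) ^ p
  set Q := 1 / (n : ℝ) ^ q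
  set C1 := ((p + q - 1).choose (p - 1) : ℝ)
  set C2 := ((p + q - 1).choose (q - 1) : ℝ)
  set L := lerch (a ^ n * b) (p + q) 1
  set M := lerch a (p + q) 1
  set σ := (-1 : ℝ) ^ p
  trans (a * a) * (2 * b * σ * P * S2 - σ * P * C2 * M) + (P * P') * Q * σ *
      (2 * (a * a ^ n) * S1 + (a * a) * a ^ n * b * S3 - (a * a ^ n) * b * C1 * L)
  · ring
  · rw [ha, haa, hnp, hlb]
    linear_combination (C2 * P * M * σ) * hb2

/-! ### Evaluation of the two integrals. -/

theorem lerchConv_left {a : ℝ} (ha : a = 1 ∨ a = -1) {q : ℕ} (hq : 1 ≤ q) (h : a = 1 → q ≠ 1) :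
    LerchConv a q :=
  ⟨hq, ha.imp (fun ha => ⟨ha, by have := h ha; omega⟩) id⟩

theorem pow_mul_eq_one_or {a b : ℝ} (ha : a = 1 ∨ a = -1) (hb : b = 1 ∨ b = -1) (n : ℕ) :
    a ^ n * b = 1 ∨ a ^ n * b = -1 := by
  have : a ^ n = 1 ∨ a ^ n = -1 := by
    rcases ha with rfl | rfl
    · exact Or.inl (one_pow n)
    · exact neg_one_pow_eq_or ℝ n
  rcases this with h | h <;> rcases hb with rfl | rfl <;> rw [h] <;> norm_num

/-- The factor `a` occurs because `quadrantSum` counts `l` from `1` and the Lerch series counts from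
`0`; `a² = 1`. -/
theorem integral_log_pow_mul_polylog_eq_quadrantSum {a b : ℝ} (hb : b = 1 ∨ b = -1) {n p q : ℕ}
    (hn : 1 ≤ n) (hp : 1 ≤ p) (h : LerchConv a q) :
    ∫ x in Ioo 0 1, Real.log x ^ (q - 1) * polylog p (b * x ^ n) / (1 - a * x) =
      (-1) ^ (q - 1) * ((q - 1).factorial : ℝ) * (a * quadrantSum a b n p q) := by
  have hq := h.1
  have hq' : q - 1 + 1 = q := by omega
  have h1 := (integral_log_pow_mul_polylog (m := q - 1) hp hn (hq'.symm ▸ h)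
    (abs_eq_one' hb)).2
  have h2 := ((hasSum_quadrantSum hb hn hp h).mul_left a).mul_left
    ((-1) ^ (q - 1) * ((q - 1).factorial : ℝ))
  refine h1.unique (h2.congr_fun fun k => ?_)
  rw [hq']
  linear_combination (-((-1) ^ (q - 1) * ((q - 1).factorial : ℝ) * b ^ (k + 1) *
    (1 / ((k : ℝ) + 1) ^ p) * lerch a q (((n * (k + 1) : ℕ) : ℝ) + 1))) * h.sq

theorem integral_log_pow_mul_polylog_eq {a b : ℝ} (hb : b = 1 ∨ b = -1) {n p q : ℕ}
    (hn : 1 ≤ n) (hpq : Odd (p + q)) (h : LerchConv a q) (hc : LerchConv (a ^ n * b) p) :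
    ∫ x in Ioo 0 1, Real.log x ^ (q - 1) * polylog p (b * x ^ n) / (1 - a * x) =
      1 / 2 * a * b * (-1) ^ q * (Nat.factorial (q - 1) : ℝ) * (n : ℝ) ^ (-(q : ℤ)) *
          lerch b (p + q) 1
        - 1 / 2 * a ^ n * b * (1 + (-1) ^ q) * (Nat.factorial (q - 1) : ℝ) *
            lerch a q 1 * lerch (a ^ n * b) p 1
        + a ^ (n - 1) * (n : ℝ) ^ (-(q : ℤ)) * (Nat.factorial (q - 1) : ℝ) *
            ∑ j ∈ Finset.Icc 0 (q / 2), (Nat.choose (p + q - 2 * j - 1) (p - 1) : ℝ) *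
              lerch b (2 * j) 1 * lerch (a ^ n * b) (p + q - 2 * j) 1
        + b * (n : ℝ) ^ p * (Nat.factorial (q - 1) : ℝ) *
            ∑ k ∈ Finset.Icc 0 (p / 2), (Nat.choose (p + q - 2 * k - 1) (q - 1) : ℝ) *
              (n : ℝ) ^ (-(2 * k : ℤ)) * lerch b (2 * k) 1 * lerch a (p + q - 2 * k) 1
        + 1 / 2 * a ^ n * b * (n : ℝ) ^ (-(q : ℤ)) * (Nat.factorial (q - 1) : ℝ) *
            ∑ j ∈ Finset.Icc 2 n, ∑ k ∈ Finset.Icc 1 q,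
              (Nat.choose (p + q - k - 1) (p - 1) : ℝ) * a ^ j * (-1) ^ k *
              theta b k ((j : ℝ) - 1) (n : ℝ) *
              lerch (a ^ n * b) (p + q - k) (((n : ℝ) - (j : ℝ) + 1) / (n : ℝ)) := by
  have hw : LerchConv b (p + q) := by
    have h1 := h.1
    have h2 := hc.1
    exact ⟨by omega, hb.imp (fun hb => ⟨hb, by omega⟩) id⟩
  have hS := two_mul_quadrantSum hb hn h hc hpq
  have hM := mul_mixedLimit hb hn h hc
  rw [lerch_zero h, lerch_zero hc, lerch_zero hw, ← zpow_neg_natCast_eq] at hS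
  have hsq : (-1 : ℝ) ^ (q - 1) = -(-1) ^ q := by
    obtain ⟨m, rfl⟩ : ∃ m, q = m + 1 := ⟨q - 1, by have := h.1; omega⟩
    rw [Nat.add_sub_cancel, pow_succ]; ring
  have hsp : (-1 : ℝ) ^ p = -(-1) ^ q := by
    have h1 : ((-1 : ℝ) ^ q) * (-1) ^ q = 1 := by rw [← mul_pow]; simp
    have h2 : ((-1 : ℝ) ^ p) * (-1) ^ q = -1 := by rw [← pow_add, hpq.neg_one_pow]
    linear_combination (-((-1 : ℝ) ^ p)) * h1 + (-1) ^ q * h2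
  have hs : ((-1 : ℝ) ^ q) * (-1) ^ q = 1 := by rw [← mul_pow]; simp
  rw [integral_log_pow_mul_polylog_eq_quadrantSum hb hn hc.1 h, hsq]
  rw [hsp] at hM hS
  have ha := h.sq
  set S1 := ∑ j ∈ Finset.Icc 0 (q / 2), (Nat.choose (p + q - 2 * j - 1) (p - 1) : ℝ) *
              lerch b (2 * j) 1 * lerch (a ^ n * b) (p + q - 2 * j) 1
  set S2 := ∑ k ∈ Finset.Icc 0 (p / 2), (Nat.choose (p + q - 2 * k - 1) (q - 1) : ℝ) *
              (n : ℝ) ^ (-(2 * k : ℤ)) * lerch b (2 * k) 1 * lerch a (p + q - 2 * k) 1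
  set S3 := ∑ j ∈ Finset.Icc 2 n, ∑ k ∈ Finset.Icc 1 q,
              (Nat.choose (p + q - k - 1) (p - 1) : ℝ) * a ^ j * (-1) ^ k *
              theta b k ((j : ℝ) - 1) (n : ℝ) *
              lerch (a ^ n * b) (p + q - k) (((n : ℝ) - (j : ℝ) + 1) / (n : ℝ))
  set F := (Nat.factorial (q - 1) : ℝ)
  set s := (-1 : ℝ) ^ q
  set Q := (n : ℝ) ^ (-(q : ℤ))
  linear_combination (-(s * F * a / 2)) * hS - (s * F / 2) * hM +
    (F * (a ^ (n - 1) * Q * S1 + b * (n : ℝ) ^ p * S2 + 1 / 2 * a ^ n * b * Q * S3) -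
      F / 2 * a ^ n * b * lerch a q 1 * lerch (a ^ n * b) p 1) * hs -
    (F / 2 * s * (1 + s) * a ^ n * b * lerch a q 1 * lerch (a ^ n * b) p 1) * ha

theorem log_pow_mul_polylog_inv {a b : ℝ} (hb : b = 1 ∨ b = -1) {n p : ℕ} (hn : 1 ≤ n)
    (hp : 1 ≤ p) (m : ℕ) {x : ℝ} (hx : x ∈ Ioo (0 : ℝ) 1) :
    Real.log x ^ m * polylog p (b * x ^ (-(n : ℤ))) / (1 - a * x) =
      (-1) ^ p * (∑ k ∈ Icc 0 (p / 2), 2 * b * lerch b (2 * k) 1 *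
        ((n : ℝ) ^ (p - 2 * k) / ((p - 2 * k).factorial : ℝ)) *
          (x ^ 0 * (Real.log x ^ (m + (p - 2 * k)) / (1 - a * x))) -
        Real.log x ^ m * polylog p (b * x ^ n) / (1 - a * x)) := by
  have ht : x ^ n ∈ Ioo (0 : ℝ) 1 := ⟨pow_pos hx.1 n, pow_lt_one₀ hx.1.le hx.2 (by omega)⟩
  rw [zpow_neg_natCast_eq, mul_one_div, polylog_inversion hb ht hp, Real.log_pow, mul_sum,
    mul_left_comm, mul_div_assoc, mul_sub, sub_div, mul_sum, sum_div]
  congr 2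
  refine sum_congr rfl fun k _ => ?_
  rw [mul_pow, pow_add, pow_zero]
  ring

theorem choose_mul_factorial_div {p q k : ℕ} (hq : 1 ≤ q) (hk : 2 * k ≤ p) :
    ((p + q - 2 * k - 1).factorial : ℝ) / ((p - 2 * k).factorial : ℝ) =
      ((q - 1).factorial : ℝ) * ((p + q - 2 * k - 1).choose (q - 1) : ℝ) := by
  have h1 := Nat.choose_mul_factorial_mul_factorial (n := p + q - 2 * k - 1) (k := q - 1) (by omega)
  rw [show p + q - 2 * k - 1 - (q - 1) = p - 2 * k by omega] at h1
  rw [div_eq_iff (by positivity), ← h1]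
  push_cast
  ring

theorem integral_log_pow_mul_polylog_inv {a b : ℝ} (hb : b = 1 ∨ b = -1) {n p q : ℕ}
    (hn : 1 ≤ n) (hp : 1 ≤ p) (hpq : Odd (p + q)) (h : LerchConv a q) :
    IntegrableOn (fun x : ℝ => Real.log x ^ (q - 1) * polylog p (b * x ^ (-(n : ℤ))) / (1 - a * x))
        (Ioo 0 1) ∧
      ∫ x in Ioo 0 1, Real.log x ^ (q - 1) * polylog p (b * x ^ (-(n : ℤ))) / (1 - a * x) =
        2 * b * (-(n : ℝ)) ^ p * ((q - 1).factorial : ℝ) * ∑ k ∈ Icc 0 (p / 2),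
          ((p + q - 2 * k - 1).choose (q - 1) : ℝ) * (n : ℝ) ^ (-(2 * k : ℤ)) *
            lerch b (2 * k) 1 * lerch a (p + q - 2 * k) 1 -
        (-1) ^ p * ∫ x in Ioo 0 1, Real.log x ^ (q - 1) * polylog p (b * x ^ n) / (1 - a * x) := by
  have hq := h.1
  have hn0 : (n : ℝ) ≠ 0 := by positivity
  have hq' : q - 1 + 1 = q := by omega
  have hf := (integral_log_pow_mul_polylog (m := q - 1) hp hn (hq'.symm ▸ h)
    (abs_eq_one' hb)).1
  have hk : ∀ k, LerchConv a (q - 1 + (p - 2 * k) + 1) := fun k => h.mono (by omega)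
  have hg : ∀ k ∈ Icc 0 (p / 2), IntegrableOn (fun x : ℝ => 2 * b * lerch b (2 * k) 1 *
        ((n : ℝ) ^ (p - 2 * k) / ((p - 2 * k).factorial : ℝ)) *
          (x ^ 0 * (Real.log x ^ (q - 1 + (p - 2 * k)) / (1 - a * x)))) (Ioo 0 1) :=
    fun k _ => (integrableOn_pow_mul_kernel (hk k) 0).const_mul _
  have heq : Set.EqOn
      (fun x : ℝ => Real.log x ^ (q - 1) * polylog p (b * x ^ (-(n : ℤ))) / (1 - a * x)) _
      (Ioo 0 1) := fun x hx => log_pow_mul_polylog_inv hb hn hp (q - 1) hx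
  have hsum := integrable_finsetSum _ hg
  refine ⟨((integrableOn_congr_fun heq measurableSet_Ioo).2 ((hsum.sub hf).const_mul _)), ?_⟩
  rw [setIntegral_congr_fun measurableSet_Ioo heq, integral_const_mul, integral_sub hsum hf,
    integral_finsetSum _ hg, mul_sub, mul_sum, mul_sum]
  congr 1
  refine sum_congr rfl fun k hk' => ?_
  rw [mem_Icc] at hk'
  have hkp : 2 * k ≤ p := by omega
  -- Parity again: the power of the logarithm is even, so its integral carries no sign.
  have heven : Even (q - 1 + (p - 2 * k)) := by
    obtain ⟨s, hs⟩ := hpq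
    exact ⟨s - k, by omega⟩
  have hpow : (n : ℝ) ^ (p - 2 * k) = (n : ℝ) ^ p * (n : ℝ) ^ (-(2 * k : ℤ)) := by
    rw [zpow_neg_two_mul, mul_one_div, eq_div_iff (pow_ne_zero _ hn0), ← pow_add,
      Nat.sub_add_cancel hkp]
  have hfac := choose_mul_factorial_div hq hkp
  rw [integral_const_mul, integral_pow_mul_kernel (hk k) 0, Nat.cast_zero, zero_add,
    heven.neg_one_pow, one_mul, neg_pow (n : ℝ), hpow,
    show q - 1 + (p - 2 * k) + 1 = p + q - 2 * k by omega,
    show q - 1 + (p - 2 * k) = p + q - 2 * k - 1 by omega]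
  linear_combination ((-1) ^ p * 2 * b * lerch b (2 * k) 1 * (n : ℝ) ^ p *
    (n : ℝ) ^ (-(2 * k : ℤ)) * lerch a (p + q - 2 * k) 1) * hfac

end LerchPolylog

theorem theorem3 (p q n : ℕ) (hp : 1 ≤ p) (hq : 1 ≤ q) (hn : 1 ≤ n) (hpq : Odd (p + q))
    (a b : ℝ) (ha : a = 1 ∨ a = -1) (hb : b = 1 ∨ b = -1)
    (hp1 : a ^ n * b = 1 → p ≠ 1) (hq1 : a = 1 → q ≠ 1) :
    -- part (i)
    (IntervalIntegrable
        (fun x : ℝ => Real.log x ^ (q - 1) * LerchPolylog.polylog p (b * x ^ n) / (1 - a * x))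
        MeasureTheory.volume 0 1 ∧
      ∫ x in (0 : ℝ)..1,
          Real.log x ^ (q - 1) * LerchPolylog.polylog p (b * x ^ n) / (1 - a * x) =
        1 / 2 * a * b * (-1) ^ q * (Nat.factorial (q - 1) : ℝ) * (n : ℝ) ^ (-(q : ℤ)) *
            LerchPolylog.lerch b (p + q) 1
        - 1 / 2 * a ^ n * b * (1 + (-1) ^ q) * (Nat.factorial (q - 1) : ℝ) *
            LerchPolylog.lerch a q 1 * LerchPolylog.lerch (a ^ n * b) p 1
        + a ^ (n - 1) * (n : ℝ) ^ (-(q : ℤ)) * (Nat.factorial (q - 1) : ℝ) *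
            ∑ j ∈ Finset.Icc 0 (q / 2), (Nat.choose (p + q - 2 * j - 1) (p - 1) : ℝ) *
              LerchPolylog.lerch b (2 * j) 1 *
              LerchPolylog.lerch (a ^ n * b) (p + q - 2 * j) 1
        + b * (n : ℝ) ^ p * (Nat.factorial (q - 1) : ℝ) *
            ∑ k ∈ Finset.Icc 0 (p / 2), (Nat.choose (p + q - 2 * k - 1) (q - 1) : ℝ) *
              (n : ℝ) ^ (-(2 * k : ℤ)) * LerchPolylog.lerch b (2 * k) 1 *
              LerchPolylog.lerch a (p + q - 2 * k) 1
        + 1 / 2 * a ^ n * b * (n : ℝ) ^ (-(q : ℤ)) * (Nat.factorial (q - 1) : ℝ) *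
            ∑ j ∈ Finset.Icc 2 n, ∑ k ∈ Finset.Icc 1 q,
              (Nat.choose (p + q - k - 1) (p - 1) : ℝ) * a ^ j * (-1) ^ k *
              LerchPolylog.theta b k ((j : ℝ) - 1) (n : ℝ) *
              LerchPolylog.lerch (a ^ n * b) (p + q - k) (((n : ℝ) - (j : ℝ) + 1) / (n : ℝ))) ∧
    -- part (ii); the first clause says that the principal values defining `Li_p` beyond `1` exist
    ((∀ z : ℝ, 1 < z →
        ∃ I : ℝ, LerchPolylog.HasCauchyPV (LerchPolylog.polylogKernel p z) 0 (1 / z) 1 I) ∧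
      IntervalIntegrable
        (fun x : ℝ =>
          Real.log x ^ (q - 1) * LerchPolylog.polylog p (b * x ^ (-(n : ℤ))) / (1 - a * x))
        MeasureTheory.volume 0 1 ∧
      ∫ x in (0 : ℝ)..1,
          Real.log x ^ (q - 1) * LerchPolylog.polylog p (b * x ^ (-(n : ℤ))) / (1 - a * x) =
        1 / 2 * a * b * (Nat.factorial (q - 1) : ℝ) * (n : ℝ) ^ (-(q : ℤ)) *
            LerchPolylog.lerch b (p + q) 1
        - 1 / 2 * a ^ n * b * (1 + (-1) ^ q) * (Nat.factorial (q - 1) : ℝ) *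
            LerchPolylog.lerch (a ^ n * b) p 1 * LerchPolylog.lerch a q 1
        + a ^ (n - 1) * (-(n : ℝ)) ^ (-(q : ℤ)) * (Nat.factorial (q - 1) : ℝ) *
            ∑ j ∈ Finset.Icc 0 (q / 2), (Nat.choose (p + q - 2 * j - 1) (p - 1) : ℝ) *
              LerchPolylog.lerch b (2 * j) 1 *
              LerchPolylog.lerch (a ^ n * b) (p + q - 2 * j) 1
        + b * (-(n : ℝ)) ^ p * (Nat.factorial (q - 1) : ℝ) *
            ∑ k ∈ Finset.Icc 0 (p / 2), (Nat.choose (p + q - 2 * k - 1) (q - 1) : ℝ) *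
              (n : ℝ) ^ (-(2 * k : ℤ)) * LerchPolylog.lerch b (2 * k) 1 *
              LerchPolylog.lerch a (p + q - 2 * k) 1
        + 1 / 2 * a ^ n * b * (-(n : ℝ)) ^ (-(q : ℤ)) * (Nat.factorial (q - 1) : ℝ) *
            ∑ j ∈ Finset.Icc 2 n, ∑ k ∈ Finset.Icc 1 q,
              (Nat.choose (p + q - k - 1) (p - 1) : ℝ) * a ^ j * (-1) ^ k *
              LerchPolylog.theta b k ((j : ℝ) - 1) (n : ℝ) *
              LerchPolylog.lerch (a ^ n * b) (p + q - k)
                (((n : ℝ) - (j : ℝ) + 1) / (n : ℝ))) := by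
  have h : LerchPolylog.LerchConv a q := LerchPolylog.lerchConv_left ha hq hq1
  have hc : LerchPolylog.LerchConv (a ^ n * b) p :=
    LerchPolylog.lerchConv_left (LerchPolylog.pow_mul_eq_one_or ha hb n) hp hp1
  have hI := LerchPolylog.integral_log_pow_mul_polylog_eq hb hn hpq h hc
  obtain ⟨hint, hJ⟩ := LerchPolylog.integral_log_pow_mul_polylog_inv hb hn hp hpq h
  have hq' : q - 1 + 1 = q := by omega
  have hint' := (LerchPolylog.integral_log_pow_mul_polylog (m := q - 1) hp hn (hq'.symm ▸ h)
    (LerchPolylog.abs_eq_one' hb)).1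
  refine ⟨⟨(intervalIntegrable_iff_integrableOn_Ioo_of_le zero_le_one).2 hint', ?_⟩,
    fun z hz => LerchPolylog.exists_hasCauchyPV_polylogKernel p hz,
    (intervalIntegrable_iff_integrableOn_Ioo_of_le zero_le_one).2 hint, ?_⟩
  · rw [intervalIntegral.integral_of_le zero_le_one, MeasureTheory.integral_Ioc_eq_integral_Ioo, hI]
  · rw [intervalIntegral.integral_of_le zero_le_one, MeasureTheory.integral_Ioc_eq_integral_Ioo, hJ,
      hI]
    have hs : ((-1 : ℝ) ^ q) * (-1) ^ q = 1 := by rw [← mul_pow]; simp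
    have hsp : (-1 : ℝ) ^ p = -(-1) ^ q := by
      have h2 : ((-1 : ℝ) ^ p) * (-1) ^ q = -1 := by rw [← pow_add, hpq.neg_one_pow]
      linear_combination (-((-1 : ℝ) ^ p)) * hs + (-1) ^ q * h2
    have hz : (-(n : ℝ)) ^ (-(q : ℤ)) = (-1) ^ q * (n : ℝ) ^ (-(q : ℤ)) := by
      rw [LerchPolylog.zpow_neg_natCast_eq, LerchPolylog.zpow_neg_natCast_eq, neg_pow,
        ← one_div_mul_one_div, ← one_div_pow]
      norm_num
    -- As `-(-1) ^ p = (-1) ^ q`, (i) enters with the factor `(-1) ^ q`, which turns `n ^ (-q)` into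
    -- `(-n) ^ (-q)`. The inversion formula supplies twice the sum over `k` with factor `(-n) ^ p`,
    -- and (i) takes one copy away.
    rw [hz, neg_pow (n : ℝ) p, hsp]
    generalize (-1 : ℝ) ^ q = s at hs ⊢
    generalize ((q - 1).factorial : ℝ) = F
    generalize (∑ j ∈ Finset.Icc 0 (q / 2), _ : ℝ) = S1
    generalize (∑ k ∈ Finset.Icc 0 (p / 2), _ : ℝ) = S2
    linear_combination (1 / 2 * a * b * F * (n : ℝ) ^ (-(q : ℤ)) *
      LerchPolylog.lerch b (p + q) 1 - 1 / 2 * a ^ n * b * F * LerchPolylog.lerch a q 1 *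
      LerchPolylog.lerch (a ^ n * b) p 1) * hs
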